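/- All spaces are over $\mathbb C$. For a field $A(z)=\sum_{n\in\mathbb Z}A_{(n)}z^{-n-1}$ the operators $A_{(n)}$ are its modes. Let $M$ be the Weyl vertex algebra, i.e. the simple vertex algebra generated by even fields $a(z)=\sum_n a(n)z^{-n-1}$ and $a^*(z)=\sum_n a^*(n)z^{-n}$ with $[a(n),a^*(m)]=\delta_{n+m,0}$, $[a(n),a(m)]=[a^*(n),a^*(m)]=0$ and $a(n)\mathbf 1=a^*(n+1)\mathbf 1=0$ for $n\ge 0$. Put $a=a(-1)\mathbf 1$, $a^*=a^*(0)\mathbf 1$, $\beta=a(-1)a^*(0)\mathbf 1$, $\omega=a(-1)a^*(-1)\mathbf 1$, $\beta(n)=\beta_{(n)}$ and $L(n)=\omega_{(n+1)}$. An $M$-module is called weight if $\beta(0)$ and $L(0)$ act semisimply (diagonalizably) on it. Let $F$ be the Clifford vertex (super)algebra generated by odd fields $\psi(z)=\sum_n\psi(n+\tfrac12)z^{-n-1}$ and $\psi^*(z)=\sum_n\psi^*(n+\tfrac12)z^{-n-1}$ with $\{\psi(r),\psi^*(s)\}=\delta_{r+s,0}$, $\{\psi(r),\psi(s)\}=\{\psi^*(r),\psi^*(s)\}=0$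 and $\psi(r)\mathbf 1=\psi^*(r)\mathbf 1=0$ for $r>0$. Put $\psi=\psi(-\tfrac12)\mathbf 1$, $\psi^*=\psi^*(-\tfrac12)\mathbf 1$ and $\gamma=\psi(-\tfrac12)\psi^*(-\tfrac12)\mathbf 1$. Let $\mathfrak g=gl(1|1)$ with even basis $E,N$, odd basis $\Psi^{\pm}$, nonzero brackets $[\Psi^+,\Psi^-]=E$, $[N,\Psi^\pm]=\pm\Psi^\pm$, and invariant supersymmetric form determined by $(N,E)=(E,N)=1$, $(\Psi^+,\Psi^-)=-(\Psi^-,\Psi^+)=1$ (all other products zero). Let $V_1(\mathfrak g)$ be the simple affine vertex superalgebra of level $1$ associated to $\mathfrak g$. For an $M$-module $\mathcal N$, the space $\mathcal N\otimes F$ is an $M\otimes F$-module via $Y(u\otimes f,z)=Y_{\mathcal N}(u,z)\otimes Y_F(f,z)$. In $M\otimes F$ put $$E=\gamma+\beta,\quad N=\tfrac12(\gamma-\beta),\quad \Psi^+=a\otimes\psi,\quad \Psi^-=a^*\otimes\psi^*$$ (writing $\beta$ for $\beta\otimes\mathbf 1$ and $\gamma$ for $\mathbf 1\otimes\gamma$),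 and let $E(0)=E_{(0)}$ on $\mathcal N\otimes F$. **Theorem.** Let $\mathcal N$ be an irreducible weight $M$-module, and let $\Delta\in\mathbb C$ be such that $$\mathcal N=\bigoplus_{s\in\mathbb Z+\Delta}\mathcal N^s,\qquad \beta(0)|_{\mathcal N^s}=s\,\mathrm{Id}.$$ Then there is a unique $V_1(\mathfrak g)$-module structure on $\mathcal N\otimes F$ in which, for each $X\in\{E,N,\Psi^+,\Psi^-\}$, the generator $X(-1)\mathbf 1$ of $V_1(\mathfrak g)$ acts by the field $Y(X,z)$ of the corresponding vector $X\in M\otimes F$. With this structure $\mathcal N\otimes F$ is a completely reducible $V_1(\mathfrak g)$-module. More precisely, $$\mathcal N\otimes F=\bigoplus_{s\in\mathbb Z}\mathcal L_s(\mathcal N),\qquad \mathcal L_s(\mathcal N)=\{v\in\mathcal N\otimes F\mid E(0)v=(s+\Delta)v\},$$ and each $\mathcal L_s(\mathcal N)$, $s\in\mathbb Z$, is an irreducible $V_1(\mathfrak g)$-module (in particular nonzero). -/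

import Mathlib

open scoped TensorProduct VertexOperator

noncomputable section

namespace VertexTheory

universe u v w

/-! ### Fields

A field on `W` is a Mathlib `VertexOperator ℂ W`; `A[[n]]` is its mode `A_(n)` in the expansion
`A(z) = ∑ A_(n) z^(-n-1)`. -/

/-- For every vector `w`, the modes `A_(n) w` vanish for all large `n`. -/
theorem field_trunc {W : Type u} [AddCommGroup W] [Module ℂ W] (A : VertexOperator ℂ W) (w : W) :
    ∃ N : ℤ, ∀ n, N ≤ n → (A[[n]]) w = 0 := by
  refine ⟨-((HahnModule.of ℂ).symm (A w)).order, fun n hn => ?_⟩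
  exact VertexOperator.ncoeff_eq_zero_of_lt_order A n w (by linarith)

/-- The field with prescribed modes `f n`. -/
def mkField {W : Type u} [AddCommGroup W] [Module ℂ W] (f : ℤ → Module.End ℂ W)
    (hf : ∀ w, ∃ N : ℤ, ∀ n, N ≤ n → f n w = 0) : VertexOperator ℂ W :=
  VertexOperator.of_coeff (fun k => f (-k - 1)) (fun w => by
    obtain ⟨N, hN⟩ := hf w
    refine ⟨-N, fun k hk => ?_⟩
    by_contra hlt
    exact hk (hN _ (by omega)))

theorem mkField_mode {W : Type u} [AddCommGroup W] [Module ℂ W] (f : ℤ → Module.End ℂ W)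
    (hf : ∀ w, ∃ N : ℤ, ∀ n, N ≤ n → f n w = 0) (n : ℤ) : (mkField f hf)[[n]] = f n := by
  unfold mkField
  rw [VertexOperator.ncoeff_of_coeff]
  congr 1
  ring

theorem field_ext {W : Type u} [AddCommGroup W] [Module ℂ W] {A B : VertexOperator ℂ W}
    (h : ∀ n w, (A[[n]]) w = (B[[n]]) w) : A = B := by
  apply HVertexOperator.coeff_inj
  funext k
  ext w
  have := h (-k - 1) w
  rwa [VertexOperator.ncoeff_apply, VertexOperator.ncoeff_apply,
    show -(-k - 1) - 1 = k by ring] at this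

/-- The identity field `id_W z^0`. -/
def idField (W : Type u) [AddCommGroup W] [Module ℂ W] : VertexOperator ℂ W :=
  mkField (fun n => if n = -1 then LinearMap.id else 0)
    (fun _ => ⟨0, fun n hn => by rw [if_neg (by omega)]; rfl⟩)

/-- The sign `(-1)^(p q)`. -/
def koszul (p q : ZMod 2) : ℂ := if p = 1 ∧ q = 1 then -1 else 1

/-- `(-1)^j * binom(n, j)` for an integer `n`. -/
def sgnChoose (n : ℤ) (j : ℕ) : ℂ := (-1 : ℂ) ^ j * ((Ring.choose n j : ℤ) : ℂ)

theorem nthProd_finite_left {W : Type u} [AddCommGroup W] [Module ℂ W]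
    (A B : VertexOperator ℂ W) (c : ℕ → ℂ) (n m : ℤ) (w : W) :
    (Function.support fun j : ℕ => c j • (A[[n - j]]) ((B[[m + j]]) w)).Finite := by
  obtain ⟨N, hN⟩ := field_trunc B w
  refine (Set.finite_lt_nat (N - m).toNat).subset fun j hj => ?_
  by_contra hlt
  apply hj
  have hlt' : ¬ j < (N - m).toNat := hlt
  simp [hN (m + j) (by omega)]

theorem nthProd_finite_right {W : Type u} [AddCommGroup W] [Module ℂ W]
    (A B : VertexOperator ℂ W) (c : ℕ → ℂ) (n m : ℤ) (w : W) :
    (Function.support fun j : ℕ => c j • (B[[n + m - j]]) ((A[[(j : ℤ)]]) w)).Finite := by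
  obtain ⟨N, hN⟩ := field_trunc A w
  refine (Set.finite_lt_nat N.toNat).subset fun j hj => ?_
  by_contra hlt
  apply hj
  have hlt' : ¬ j < N.toNat := hlt
  simp [hN j (by omega)]

/-- The mode `(A_(n) B)_(m)` of the `n`-th product of two fields, where `ε` is the sign
`(-1)^(|A| |B|)`:
`∑_j (-1)^j binom(n, j) (A_(n-j) B_(m+j) - ε (-1)^n B_(n+m-j) A_(j))`. -/
def nthProdMode {W : Type u} [AddCommGroup W] [Module ℂ W] (ε : ℂ) (A : VertexOperator ℂ W)
    (n : ℤ) (B : VertexOperator ℂ W) (m : ℤ) : Module.End ℂ W where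
  toFun w := (∑ᶠ j : ℕ, sgnChoose n j • (A[[n - j]]) ((B[[m + j]]) w))
    - (ε * (-1 : ℂ) ^ n) • ∑ᶠ j : ℕ, sgnChoose n j • (B[[n + m - j]]) ((A[[(j : ℤ)]]) w)
  map_add' v w := by
    simp only [map_add, smul_add]
    rw [finsum_add_distrib (nthProd_finite_left A B _ n m v) (nthProd_finite_left A B _ n m w),
      finsum_add_distrib (nthProd_finite_right A B _ n m v) (nthProd_finite_right A B _ n m w),
      smul_add]
    abel
  map_smul' r w := by
    simp only [map_smul, RingHom.id_apply]
    rw [smul_sub, smul_comm r (ε * (-1 : ℂ) ^ n), smul_finsum r, smul_finsum r]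
    simp only [smul_comm r]

/-- The `n`-th product `A(z)_(n) B(z)` of two fields with sign `ε = (-1)^(|A| |B|)`. -/
def nthProd {W : Type u} [AddCommGroup W] [Module ℂ W] (ε : ℂ) (A : VertexOperator ℂ W) (n : ℤ)
    (B : VertexOperator ℂ W) : VertexOperator ℂ W :=
  mkField (nthProdMode ε A n B) (fun w => by
    obtain ⟨N, hN⟩ := field_trunc B w
    obtain ⟨K, hK⟩ := field_trunc A w
    choose P hP using fun j : ℕ => field_trunc B ((A[[(j : ℤ)]]) w)
    refine ⟨max N ((∑ j ∈ Finset.range K.toNat, |P j|) + K.toNat - n), fun m hm => ?_⟩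
    have h1 : ∀ j : ℕ, sgnChoose n j • (A[[n - j]]) ((B[[m + j]]) w) = 0 := fun j => by
      have : N ≤ m := le_trans (le_max_left _ _) hm
      simp [hN (m + j) (by omega)]
    have h2 : ∀ j : ℕ, sgnChoose n j • (B[[n + m - j]]) ((A[[(j : ℤ)]]) w) = 0 := fun j => by
      by_cases hj : K ≤ j
      · simp [hK j hj]
      · have hj' : j ∈ Finset.range K.toNat := by
          rw [Finset.mem_range]
          omega
        have h3 : |P j| ≤ ∑ j ∈ Finset.range K.toNat, |P j| :=
          Finset.single_le_sum (f := fun j => |P j|) (fun i _ => abs_nonneg _) hj'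
        have h4 := le_trans (le_max_right _ _) hm
        have h5 := le_abs_self (P j)
        rw [hP j (n + m - j) (by omega), smul_zero]
    simp [nthProdMode, h1, h2])

/-! ### Vertex superalgebras and their modules -/

/-- The structure maps of a vertex superalgebra on `V`: vacuum, even and odd part, and the
state-field correspondence. -/
structure VertexSuperData (V : Type u) [AddCommGroup V] [Module ℂ V] where
  vac : V
  part : ZMod 2 → Submodule ℂ V
  Y : V →ₗ[ℂ] VertexOperator ℂ V

/-- `YW` makes `W` a module: `Y_W(vac, z) = id` and the Jacobi identity holds. The Jacobi identity
is written as the equality of the coefficients of `z₀^(-n-1) z₁^(-m-1) z₂^(-k-1)`. -/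
def IsModule {V : Type u} [AddCommGroup V] [Module ℂ V] (𝒱 : VertexSuperData V)
    {W : Type v} [AddCommGroup W] [Module ℂ W] (YW : V →ₗ[ℂ] VertexOperator ℂ W) : Prop :=
  YW 𝒱.vac = idField W ∧
  ∀ p q : ZMod 2, ∀ a ∈ 𝒱.part p, ∀ b ∈ 𝒱.part q, ∀ (m n k : ℤ) (w : W),
    ∑ᶠ j : ℕ, ((Ring.choose m j : ℤ) : ℂ) •
        ((YW (((𝒱.Y a)[[n + j]]) b))[[m + k - j]]) w
    = (∑ᶠ j : ℕ, sgnChoose n j • ((YW a)[[m + n - j]]) (((YW b)[[k + j]]) w))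
      - (koszul p q * (-1 : ℂ) ^ n) •
        ∑ᶠ j : ℕ, sgnChoose n j • ((YW b)[[n + k - j]]) (((YW a)[[m + j]]) w)

/-- A subspace stable under all modes of all fields `Y_W(a, z)`. -/
def IsStable {V : Type u} [AddCommGroup V] [Module ℂ V] {W : Type v} [AddCommGroup W] [Module ℂ W]
    (YW : V →ₗ[ℂ] VertexOperator ℂ W) (S : Submodule ℂ W) : Prop :=
  ∀ (a : V) (n : ℤ), ∀ w ∈ S, ((YW a)[[n]]) w ∈ S

/-- `S` is an irreducible submodule of `W`: a nonzero submodule whose only submodules (graded by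
parity or not) are `0` and `S`. -/
def IsIrreducibleSub {V : Type u} [AddCommGroup V] [Module ℂ V] {W : Type v} [AddCommGroup W]
    [Module ℂ W] (YW : V →ₗ[ℂ] VertexOperator ℂ W) (S : Submodule ℂ W) : Prop :=
  IsStable YW S ∧ S ≠ ⊥ ∧ ∀ T : Submodule ℂ W, IsStable YW T → T ≤ S → T = ⊥ ∨ T = S

/-- `W` is an irreducible module. -/
def IsIrreducible {V : Type u} [AddCommGroup V] [Module ℂ V] {W : Type v} [AddCommGroup W]
    [Module ℂ W] (YW : V →ₗ[ℂ] VertexOperator ℂ W) : Prop :=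
  IsIrreducibleSub YW ⊤

/-- `W` is a direct sum of irreducible submodules. -/
def IsCompletelyReducible {V : Type u} [AddCommGroup V] [Module ℂ V] {W : Type v} [AddCommGroup W]
    [Module ℂ W] (YW : V →ₗ[ℂ] VertexOperator ℂ W) : Prop :=
  ∃ 𝒮 : Set (Submodule ℂ W), (∀ S ∈ 𝒮, IsIrreducibleSub YW S) ∧ sSupIndep 𝒮 ∧ sSup 𝒮 = ⊤

/-- An operator acts semisimply: the space is the sum of its eigenspaces. -/
def ActsSemisimply {W : Type v} [AddCommGroup W] [Module ℂ W] (T : Module.End ℂ W) : Prop :=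
  ⨆ μ : ℂ, T.eigenspace μ = ⊤

/-! ### Tensor products of fields -/

theorem tensor_finite {W₁ : Type u} {W₂ : Type v} [AddCommGroup W₁] [Module ℂ W₁]
    [AddCommGroup W₂] [Module ℂ W₂] (A : VertexOperator ℂ W₁) (B : VertexOperator ℂ W₂) (n : ℤ)
    (x : W₁) (y : W₂) :
    (Function.support fun i : ℤ => (A[[i]]) x ⊗ₜ[ℂ] (B[[n - 1 - i]]) y).Finite := by
  obtain ⟨N, hN⟩ := field_trunc A x
  obtain ⟨K, hK⟩ := field_trunc B y
  refine (Set.finite_Icc (n - 1 - K) N).subset fun i hi => ?_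
  by_contra hlt
  apply hi
  have hlt' : ¬ (n - 1 - K ≤ i ∧ i ≤ N) := hlt
  by_cases h : N ≤ i
  · simp [hN i h]
  · simp [hK (n - 1 - i) (by omega)]

/-- The mode `∑_{i + j = n - 1} A_(i) ⊗ B_(j)` of `A(z) ⊗ B(z)`. No sign occurs as long as `A` is an
even field on a purely even space. -/
def tensorMode {W₁ : Type u} {W₂ : Type v} [AddCommGroup W₁] [Module ℂ W₁]
    [AddCommGroup W₂] [Module ℂ W₂] (A : VertexOperator ℂ W₁) (B : VertexOperator ℂ W₂) (n : ℤ) :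
    Module.End ℂ (W₁ ⊗[ℂ] W₂) :=
  TensorProduct.lift (LinearMap.mk₂ ℂ
    (fun x y => ∑ᶠ i : ℤ, (A[[i]]) x ⊗ₜ[ℂ] (B[[n - 1 - i]]) y)
    (fun x x' y => by
      simp only [map_add, TensorProduct.add_tmul]
      exact finsum_add_distrib (tensor_finite A B n x y) (tensor_finite A B n x' y))
    (fun c x y => by
      simp only [map_smul, ← TensorProduct.smul_tmul']
      exact (smul_finsum _ _).symm)
    (fun x y y' => by
      simp only [map_add, TensorProduct.tmul_add]
      exact finsum_add_distrib (tensor_finite A B n x y) (tensor_finite A B n x y'))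
    (fun c x y => by
      simp only [map_smul, TensorProduct.tmul_smul]
      exact (smul_finsum _ _).symm))

theorem tensorMode_tmul {W₁ : Type u} {W₂ : Type v} [AddCommGroup W₁] [Module ℂ W₁]
    [AddCommGroup W₂] [Module ℂ W₂] (A : VertexOperator ℂ W₁) (B : VertexOperator ℂ W₂) (n : ℤ)
    (x : W₁) (y : W₂) :
    tensorMode A B n (x ⊗ₜ y) = ∑ᶠ i : ℤ, (A[[i]]) x ⊗ₜ[ℂ] (B[[n - 1 - i]]) y := rfl

/-- The field `A(z) ⊗ B(z)` on `W₁ ⊗ W₂`. -/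
def tensorField {W₁ : Type u} {W₂ : Type v} [AddCommGroup W₁] [Module ℂ W₁]
    [AddCommGroup W₂] [Module ℂ W₂] (A : VertexOperator ℂ W₁) (B : VertexOperator ℂ W₂) :
    VertexOperator ℂ (W₁ ⊗[ℂ] W₂) :=
  mkField (tensorMode A B) (fun t => by
    induction t using TensorProduct.induction_on with
    | zero => exact ⟨0, fun n _ => map_zero _⟩
    | tmul x y =>
      obtain ⟨N, hN⟩ := field_trunc A x
      obtain ⟨K, hK⟩ := field_trunc B y
      refine ⟨N + K + 1, fun n hn => ?_⟩
      rw [tensorMode_tmul]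
      refine finsum_eq_zero_of_forall_eq_zero fun i => ?_
      by_cases h : N ≤ i
      · simp [hN i h]
      · simp [hK (n - 1 - i) (by omega)]
    | add s t hs ht =>
      obtain ⟨N, hN⟩ := hs
      obtain ⟨K, hK⟩ := ht
      refine ⟨max N K, fun n hn => ?_⟩
      rw [map_add, hN n (le_trans (le_max_left _ _) hn), hK n (le_trans (le_max_right _ _) hn),
        add_zero])

/-- `Y(u ⊗ f, z) = Y₁(u, z) ⊗ Y₂(f, z)`, the action of `V₁ ⊗ V₂` on `W₁ ⊗ W₂` (with `V₁` and `W₁`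
purely even). -/
def tensorY {V₁ : Type u} {V₂ : Type v} {W₁ : Type w} {W₂ : Type v}
    [AddCommGroup V₁] [Module ℂ V₁] [AddCommGroup V₂] [Module ℂ V₂]
    [AddCommGroup W₁] [Module ℂ W₁] [AddCommGroup W₂] [Module ℂ W₂]
    (Y₁ : V₁ →ₗ[ℂ] VertexOperator ℂ W₁) (Y₂ : V₂ →ₗ[ℂ] VertexOperator ℂ W₂) :
    (V₁ ⊗[ℂ] V₂) →ₗ[ℂ] VertexOperator ℂ (W₁ ⊗[ℂ] W₂) :=
  TensorProduct.lift (LinearMap.mk₂ ℂ (fun a b => tensorField (Y₁ a) (Y₂ b))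
    (fun a a' b => by
      refine field_ext fun n t => ?_
      induction t using TensorProduct.induction_on with
      | zero => simp only [map_zero]
      | add s t hs ht =>
        exact (map_add _ _ _).trans ((congrArg₂ _ hs ht).trans (map_add _ _ _).symm)
      | tmul x y =>
        simp only [map_add, Pi.add_apply, LinearMap.add_apply, tensorField, mkField_mode,
          tensorMode_tmul, TensorProduct.add_tmul]
        exact finsum_add_distrib (tensor_finite _ _ n x y) (tensor_finite _ _ n x y))
    (fun c a b => by
      refine field_ext fun n t => ?_
      induction t using TensorProduct.induction_on with
      | zero => simp only [map_zero]
      | add s t hs ht =>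
        exact (map_add _ _ _).trans ((congrArg₂ _ hs ht).trans (map_add _ _ _).symm)
      | tmul x y =>
        simp only [map_smul, Pi.smul_apply, LinearMap.smul_apply, tensorField, mkField_mode,
          tensorMode_tmul, ← TensorProduct.smul_tmul']
        exact (smul_finsum _ _).symm)
    (fun a b b' => by
      refine field_ext fun n t => ?_
      induction t using TensorProduct.induction_on with
      | zero => simp only [map_zero]
      | add s t hs ht =>
        exact (map_add _ _ _).trans ((congrArg₂ _ hs ht).trans (map_add _ _ _).symm)
      | tmul x y =>
        simp only [map_add, Pi.add_apply, LinearMap.add_apply, tensorField, mkField_mode,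
          tensorMode_tmul, TensorProduct.tmul_add]
        exact finsum_add_distrib (tensor_finite _ _ n x y) (tensor_finite _ _ n x y))
    (fun c a b => by
      refine field_ext fun n t => ?_
      induction t using TensorProduct.induction_on with
      | zero => simp only [map_zero]
      | add s t hs ht =>
        exact (map_add _ _ _).trans ((congrArg₂ _ hs ht).trans (map_add _ _ _).symm)
      | tmul x y =>
        simp only [map_smul, Pi.smul_apply, LinearMap.smul_apply, tensorField, mkField_mode,
          tensorMode_tmul, TensorProduct.tmul_smul]
        exact (smul_finsum _ _).symm))

/-! ### Simple vertex superalgebras generated by finitely many fields with linear OPE -/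

/-- Structure constants of the (super)commutation relations
`[x_(n), y_(m)] = ∑_z bracket x y z • z_(n+m) + form₀ x y δ_{n+m+1,0} + n form₁ x y δ_{n+m,0}`
between the modes of generating fields `x(z)`, `x ∈ G`. -/
structure LinearOPE (G : Type) where
  parity : G → ZMod 2
  bracket : G → G → G → ℂ
  form₀ : G → G → ℂ
  form₁ : G → G → ℂ

/-- The free associative algebra on the symbols `x_(n)`. -/
abbrev FreeModes (G : Type) : Type := FreeAlgebra ℂ (G × ℤ)

/-- The symbol `x_(n)`. -/
def sym {G : Type} (x : G) (n : ℤ) : FreeModes G := FreeAlgebra.ι ℂ (x, n)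

/-- Left-hand side minus right-hand side of the (super)commutation relation. -/
def LinearOPE.relator {G : Type} [Fintype G] (D : LinearOPE G) (x y : G) (n m : ℤ) :
    FreeModes G :=
  sym x n * sym y m - koszul (D.parity x) (D.parity y) • (sym y m * sym x n)
    - ∑ z, D.bracket x y z • sym z (n + m)
    - algebraMap ℂ (FreeModes G) (if n + m + 1 = 0 then D.form₀ x y else 0)
    - algebraMap ℂ (FreeModes G) (if n + m = 0 then (n : ℂ) * D.form₁ x y else 0)

/-- The left ideal generated by the two-sided ideal of relations and by the symbols `x_(n)`,
`n ≥ 0`. The quotient by it is the universal module generated by a vacuum vector. -/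
def LinearOPE.vacIdeal {G : Type} [Fintype G] (D : LinearOPE G) :
    Submodule (FreeModes G) (FreeModes G) :=
  Submodule.span (FreeModes G)
    ({r | ∃ (x y : G) (n m : ℤ) (b : FreeModes G), r = D.relator x y n m * b} ∪
      {r | ∃ (x : G) (n : ℤ), 0 ≤ n ∧ r = sym x n})

/-- The sum of all proper left ideals above `vacIdeal`: the quotient by it is the universal vacuum
module modulo its largest proper submodule. -/
def LinearOPE.maxIdeal {G : Type} [Fintype G] (D : LinearOPE G) :
    Submodule (FreeModes G) (FreeModes G) :=
  D.vacIdeal ⊔ sSup {I | D.vacIdeal ≤ I ∧ I ≠ ⊤}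

/-- The simple vacuum module. -/
def LinearOPE.Space {G : Type} [Fintype G] (D : LinearOPE G) : Type :=
  FreeModes G ⧸ D.maxIdeal

instance {G : Type} [Fintype G] (D : LinearOPE G) : AddCommGroup D.Space :=
  inferInstanceAs (AddCommGroup (FreeModes G ⧸ D.maxIdeal))

instance {G : Type} [Fintype G] (D : LinearOPE G) : Module (FreeModes G) D.Space :=
  inferInstanceAs (Module (FreeModes G) (FreeModes G ⧸ D.maxIdeal))

instance {G : Type} [Fintype G] (D : LinearOPE G) : Module ℂ D.Space :=
  inferInstanceAs (Module ℂ (FreeModes G ⧸ D.maxIdeal))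

instance {G : Type} [Fintype G] (D : LinearOPE G) : IsScalarTower ℂ (FreeModes G) D.Space :=
  inferInstanceAs (IsScalarTower ℂ (FreeModes G) (FreeModes G ⧸ D.maxIdeal))

/-- The projection from the free algebra onto the simple vacuum module. -/
def LinearOPE.proj {G : Type} [Fintype G] (D : LinearOPE G) :
    FreeModes G →ₗ[FreeModes G] D.Space :=
  D.maxIdeal.mkQ

theorem LinearOPE.proj_surjective {G : Type} [Fintype G] (D : LinearOPE G) :
    Function.Surjective D.proj := D.maxIdeal.mkQ_surjective

theorem LinearOPE.proj_eq_zero {G : Type} [Fintype G] (D : LinearOPE G) (b : FreeModes G) :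
    D.proj b = 0 ↔ b ∈ D.maxIdeal := Submodule.Quotient.mk_eq_zero _

/-- The vacuum vector. -/
def LinearOPE.vac {G : Type} [Fintype G] (D : LinearOPE G) : D.Space := D.proj 1

theorem LinearOPE.smul_vac {G : Type} [Fintype G] (D : LinearOPE G) (b : FreeModes G) :
    b • D.vac = D.proj b := by
  rw [LinearOPE.vac, ← map_smul, smul_eq_mul, mul_one]

theorem LinearOPE.relator_smul {G : Type} [Fintype G] (D : LinearOPE G) (x y : G) (n m : ℤ)
    (v : D.Space) : D.relator x y n m • v = 0 := by
  obtain ⟨b, rfl⟩ := D.proj_surjective v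
  rw [← map_smul, D.proj_eq_zero]
  exact (le_sup_left : D.vacIdeal ≤ D.maxIdeal)
    (Submodule.subset_span (Or.inl ⟨x, y, n, m, b, rfl⟩))

theorem LinearOPE.sym_vac {G : Type} [Fintype G] (D : LinearOPE G) (x : G) (n : ℤ) (hn : 0 ≤ n) :
    sym x n • D.vac = 0 := by
  rw [D.smul_vac, D.proj_eq_zero]
  exact (le_sup_left : D.vacIdeal ≤ D.maxIdeal) (Submodule.subset_span (Or.inr ⟨x, n, hn, rfl⟩))

theorem LinearOPE.sym_comm {G : Type} [Fintype G] (D : LinearOPE G) (x y : G) (n m : ℤ)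
    (v : D.Space) : sym x n • sym y m • v
      = koszul (D.parity x) (D.parity y) • sym y m • sym x n • v
        + ∑ z, D.bracket x y z • sym z (n + m) • v
        + (if n + m + 1 = 0 then D.form₀ x y else 0) • v
        + (if n + m = 0 then (n : ℂ) * D.form₁ x y else 0) • v := by
  have h := D.relator_smul x y n m v
  simp only [LinearOPE.relator, sub_smul, mul_smul, Finset.sum_smul, smul_assoc,
    algebraMap_smul] at h
  rw [← sub_eq_zero, ← h]
  abel

theorem LinearOPE.sym_trunc {G : Type} [Fintype G] (D : LinearOPE G) (v : D.Space) :
    ∀ x : G, ∃ N : ℤ, ∀ n, N ≤ n → sym x n • v = 0 := by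
  have key : ∀ (b : FreeModes G) (v : D.Space),
      (∀ x : G, ∃ N : ℤ, ∀ n, N ≤ n → sym x n • v = 0) →
      ∀ x : G, ∃ N : ℤ, ∀ n, N ≤ n → sym x n • b • v = 0 := by
    intro b
    induction b using FreeAlgebra.induction with
    | grade0 r =>
      intro v hv x
      obtain ⟨N, hN⟩ := hv x
      refine ⟨N, fun n hn => ?_⟩
      rw [algebraMap_smul, smul_comm, hN n hn, smul_zero]
    | grade1 ym =>
      obtain ⟨y, m⟩ := ym
      intro v hv x
      choose N hN using hv
      refine ⟨|N x| + ∑ z, |N z| + |m| + 1, fun n hn => ?_⟩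
      have hz : ∀ z, |N z| ≤ ∑ z, |N z| := fun z =>
        Finset.single_le_sum (f := fun z => |N z|) (fun i _ => abs_nonneg _) (Finset.mem_univ z)
      have hx := hz x
      have h1 := le_abs_self (N x)
      have h2 := neg_abs_le m
      have h3 := abs_nonneg (N x)
      have h6 := abs_nonneg m
      have h := D.sym_comm x y n m v
      have h7 : n + m + 1 ≠ 0 := by linarith
      have h8 : n + m ≠ 0 := by linarith
      simp only [hN x n (by linarith), smul_zero, zero_add, if_neg h7, if_neg h8, zero_smul,
        add_zero] at h
      refine h.trans (Finset.sum_eq_zero fun z _ => ?_)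
      have h4 := le_abs_self (N z)
      have h5 := hz z
      rw [hN z (n + m) (by linarith), smul_zero]
    | mul a b ha hb =>
      intro v hv
      rw [mul_smul]
      exact ha _ (hb v hv)
    | add a b ha hb =>
      intro v hv x
      obtain ⟨N, hN⟩ := ha v hv x
      obtain ⟨K, hK⟩ := hb v hv x
      refine ⟨max N K, fun n hn => ?_⟩
      rw [add_smul, smul_add, hN n (le_trans (le_max_left _ _) hn),
        hK n (le_trans (le_max_right _ _) hn), add_zero]
  obtain ⟨b, rfl⟩ := D.proj_surjective v
  have h := key b D.vac (fun x => ⟨0, fun n hn => D.sym_vac x n hn⟩)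
  rwa [D.smul_vac] at h

/-- The generating field `x(z) = ∑ x_(n) z^(-n-1)`. -/
def LinearOPE.genField {G : Type} [Fintype G] (D : LinearOPE G) (x : G) :
    VertexOperator ℂ D.Space :=
  mkField (fun n => Algebra.lsmul ℂ ℂ D.Space (sym x n)) (fun v => D.sym_trunc v x)

/-- The state `x¹_(n₁) ⋯ xʳ_(nᵣ) vac`. -/
def LinearOPE.state {G : Type} [Fintype G] (D : LinearOPE G) : List (G × ℤ) → D.Space
  | [] => D.vac
  | (x, n) :: l => sym x n • D.state l

/-- The parity of `x¹_(n₁) ⋯ xʳ_(nᵣ) vac`. -/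
def LinearOPE.wordParity {G : Type} (D : LinearOPE G) : List (G × ℤ) → ZMod 2
  | [] => 0
  | (x, _) :: l => D.parity x + D.wordParity l

/-- The field `x¹(z)_(n₁) (x²(z)_(n₂) (⋯ (xʳ(z)_(nᵣ) id)))`. -/
def LinearOPE.wordField {G : Type} [Fintype G] (D : LinearOPE G) :
    List (G × ℤ) → VertexOperator ℂ D.Space
  | [] => idField D.Space
  | (x, n) :: l =>
      nthProd (koszul (D.parity x) (D.wordParity l)) (D.genField x) n (D.wordField l)

open Classical in
/-- The vertex superalgebra generated by the fields `x(z)` on the simple vacuum module. Its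
state-field correspondence is the linear map with
`Y(x¹_(n₁) ⋯ xʳ_(nᵣ) vac, z) = x¹(z)_(n₁) (⋯ (xʳ(z)_(nᵣ) id))`. It is unique because the states
`x¹_(n₁) ⋯ xʳ_(nᵣ) vac` span the space; for mutually local, translation covariant fields it exists
by the reconstruction theorem. -/
def LinearOPE.vertex {G : Type} [Fintype G] (D : LinearOPE G) : VertexSuperData D.Space where
  vac := D.vac
  part p := Submodule.span ℂ {v | ∃ l, D.wordParity l = p ∧ v = D.state l}
  Y := if h : ∃ Y : D.Space →ₗ[ℂ] VertexOperator ℂ D.Space, ∀ l, Y (D.state l) = D.wordField l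
    then h.choose else 0

/-! ### The Weyl vertex algebra `M` -/

/-- Generators of `M`: the fields `a(z) = ∑ a(n) z^(-n-1)` and `a*(z) = ∑ a*(n) z^(-n)`, so that
`a_(n) = a(n)` and `a*_(n) = a*(n+1)`. -/
inductive WeylGen : Type
  | a
  | aStar
  deriving DecidableEq

instance : Fintype WeylGen where
  elems := {.a, .aStar}
  complete x := by cases x <;> simp

/-- `[a(n), a*(m)] = δ_{n+m,0}`, that is `[a_(n), a*_(m)] = δ_{n+m+1,0}`. -/
def weylOPE : LinearOPE WeylGen where
  parity _ := 0
  bracket _ _ _ := 0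
  form₀
    | .a, .aStar => 1
    | .aStar, .a => -1
    | _, _ => 0
  form₁ _ _ := 0

/-- The underlying space of the Weyl vertex algebra. -/
abbrev M : Type := weylOPE.Space

/-- The Weyl vertex algebra. -/
def weyl : VertexSuperData M := weylOPE.vertex

/-- `a = a(-1) 1`. -/
def aVec : M := weylOPE.state [(.a, -1)]

/-- `a* = a*(0) 1`. -/
def aStarVec : M := weylOPE.state [(.aStar, -1)]

/-- `β = a(-1) a*(0) 1`. -/
def betaVec : M := weylOPE.state [(.a, -1), (.aStar, -1)]

/-- `ω = a(-1) a*(-1) 1`. -/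
def omegaVec : M := weylOPE.state [(.a, -1), (.aStar, -2)]

/-- A weight module: `β(0) = β_(0)` and `L(0) = ω_(1)` act semisimply. -/
def IsWeight {W : Type u} [AddCommGroup W] [Module ℂ W] (YW : M →ₗ[ℂ] VertexOperator ℂ W) : Prop :=
  ActsSemisimply ((YW betaVec)[[0]]) ∧ ActsSemisimply ((YW omegaVec)[[1]])

/-! ### The Clifford vertex algebra `F` -/

/-- Generators of `F`: `ψ(z) = ∑ ψ(n+1/2) z^(-n-1)` and `ψ*(z) = ∑ ψ*(n+1/2) z^(-n-1)`. -/
inductive CliffordGen : Type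
  | psi
  | psiStar
  deriving DecidableEq

instance : Fintype CliffordGen where
  elems := {.psi, .psiStar}
  complete x := by cases x <;> simp

/-- `{ψ(r), ψ*(s)} = δ_{r+s,0}`, that is `{ψ_(n), ψ*_(m)} = δ_{n+m+1,0}`. -/
def cliffordOPE : LinearOPE CliffordGen where
  parity _ := 1
  bracket _ _ _ := 0
  form₀
    | .psi, .psiStar => 1
    | .psiStar, .psi => 1
    | _, _ => 0
  form₁ _ _ := 0

/-- The underlying space of the Clifford vertex algebra. -/
abbrev F : Type := cliffordOPE.Space

/-- The Clifford vertex algebra. -/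
def clifford : VertexSuperData F := cliffordOPE.vertex

/-- `ψ = ψ(-1/2) 1`. -/
def psiVec : F := cliffordOPE.state [(.psi, -1)]

/-- `ψ* = ψ*(-1/2) 1`. -/
def psiStarVec : F := cliffordOPE.state [(.psiStar, -1)]

/-- `γ = ψ(-1/2) ψ*(-1/2) 1`, the Heisenberg vector of the boson-fermion correspondence
`ψ = e^γ`, `ψ* = e^(-γ)`. -/
def gammaVec : F := cliffordOPE.state [(.psi, -1), (.psiStar, -1)]

/-! ### The simple affine vertex superalgebra `V₁(gl(1|1))` -/

/-- The basis `E, N, Ψ⁺, Ψ⁻` of `gl(1|1)`. -/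
inductive GlGen : Type
  | E
  | N
  | psiPlus
  | psiMinus
  deriving DecidableEq

instance : Fintype GlGen where
  elems := {.E, .N, .psiPlus, .psiMinus}
  complete x := by cases x <;> simp

/-- `[x(n), y(m)] = [x, y](n+m) + n (x, y) δ_{n+m,0}` with `[Ψ⁺, Ψ⁻] = E`, `[N, Ψ^±] = ± Ψ^±`,
`(N, E) = (E, N) = 1` and `(Ψ⁺, Ψ⁻) = -(Ψ⁻, Ψ⁺) = 1`: affine `gl(1|1)` with `K = 1`. -/
def glOPE : LinearOPE GlGen where
  parity
    | .E => 0
    | .N => 0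
    | .psiPlus => 1
    | .psiMinus => 1
  bracket
    | .psiPlus, .psiMinus, .E => 1
    | .psiMinus, .psiPlus, .E => 1
    | .N, .psiPlus, .psiPlus => 1
    | .psiPlus, .N, .psiPlus => -1
    | .N, .psiMinus, .psiMinus => -1
    | .psiMinus, .N, .psiMinus => 1
    | _, _, _ => 0
  form₀ _ _ := 0
  form₁
    | .N, .E => 1
    | .E, .N => 1
    | .psiPlus, .psiMinus => 1
    | .psiMinus, .psiPlus => -1
    | _, _ => 0

/-- The underlying space of `V₁(gl(1|1))`. -/
abbrev V1gl : Type := glOPE.Space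

/-- The simple affine vertex superalgebra `V₁(gl(1|1))`. -/
def affineGl : VertexSuperData V1gl := glOPE.vertex

/-- The vector `x(-1) 1` of `V₁(gl(1|1))`. -/
def glVec (x : GlGen) : V1gl := glOPE.state [(x, -1)]

/-- The vectors `E = γ + β`, `N = (γ - β)/2`, `Ψ⁺ = a(-1) ψ`, `Ψ⁻ = a*(0) ψ*` of `M ⊗ F`. -/
def glInMF : GlGen → M ⊗[ℂ] F
  | .E => weyl.vac ⊗ₜ gammaVec + betaVec ⊗ₜ clifford.vac
  | .N => (1 / 2 : ℂ) • (weyl.vac ⊗ₜ gammaVec - betaVec ⊗ₜ clifford.vac)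
  | .psiPlus => aVec ⊗ₜ psiVec
  | .psiMinus => aStarVec ⊗ₜ psiStarVec

/-- The action `Y(u ⊗ f, z) = Y_N(u, z) ⊗ Y_F(f, z)` of `M ⊗ F` on `N ⊗ F`. -/
def fockY {W : Type u} [AddCommGroup W] [Module ℂ W] (YW : M →ₗ[ℂ] VertexOperator ℂ W) :
    (M ⊗[ℂ] F) →ₗ[ℂ] VertexOperator ℂ (W ⊗[ℂ] F) :=
  tensorY YW clifford.Y

/-- The operator `E(0)` on `N ⊗ F`. -/
def opE0 {W : Type u} [AddCommGroup W] [Module ℂ W] (YW : M →ₗ[ℂ] VertexOperator ℂ W) :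
    Module.End ℂ (W ⊗[ℂ] F) :=
  (fockY YW (glInMF .E))[[0]]

end VertexTheory

end

open scoped TensorProduct VertexOperator

noncomputable section

namespace VertexTheory

open Filter

set_option linter.unusedSectionVars false

/-! On `𝒩 ⊗ F` the fields of `gl(1|1)` are normally ordered products of Weyl fields acting on `𝒩`
and Clifford fields acting on `F`. Wick-type expansions (`OPE.normal`) give the affine relations at
level one (`glField_realizes`).

Passing from relations to a module is reconstruction. The commutator formula `nthProd_comm` sends
words in the modes to iterated products of fields compatibly with the relations
(`exists_stateField`). Dong's lemma `Local.nthProd` keeps all these fields local. `stateField_mode`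
shows that products of states go to products of fields, so `Local.jacobi` yields the Jacobi
identity. Uniqueness holds because the generating fields determine all others.

This argument produces an action of the universal vacuum module, so that module has to be simple
already, for all three algebras. In a nonzero submodule take a vector of least degree: it is killed
by every mode of negative degree, and it suffices that its degree is `0` (`IsVacuum.inf_ne_bot`).
For the Weyl and Clifford algebras the degree operator visibly kills such a vector. For `gl(1|1)` it
acts as `Ψ⁻_(0) Ψ⁺_(0)`, which squares to zero because `E_(0) = 0` on the vacuum module
(`gl_maxIdeal`).

For irreducibility, let `T ≠ 0` be a submodule of an eigenspace of `E(0)`. The modes of `Ψ⁺` are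
infinite sums of operators `a_(i) ψ_(j)`. Since `γ = N + E/2`, the space `T` is stable under the
mode `(γ_(-1)γ)_(1)`, which commutes with the Weyl modes and has the `ψ_(j)` as eigenvectors with
distinct eigenvalues. A Vandermonde argument separates the summands, so `T` is stable under every
single `a_(i) ψ_(j)` and `a*_(i) ψ*_(j)` (`weyl_clifford_mem`), and then under every product of a
charge-raising mode (`a*`, `ψ`) and a charge-lowering one (`a`, `ψ*`).

Hence the vectors reached from `T` by raising modes alone or by lowering modes alone span a space
stable under all Weyl and Clifford modes. These act irreducibly (`fock_eq_top`), so this span is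
everything. Its part of the charge of `T` is `T` itself, so `T` is the full eigenspace
(`eq_charge_space`).

The eigenspaces for `ℤ + Δ` span because Clifford modes change the charge by `±1`
(`fock_iSup_eigenspace`), and none vanishes because `{ψ_(n), ψ*_(-1-n)} = 1`
(`charge_space_ne_bot`). -/

/-! ### Finitely supported sums with binomial coefficients -/

/-- The sequence `f` vanishes from some index on. -/
def EvZero {W : Type*} [AddCommGroup W] (f : ℕ → W) : Prop := ∃ K, ∀ j, K ≤ j → f j = 0

/-- The double sequence `F` is supported in a finite square. -/
def EvZero₂ {W : Type*} [AddCommGroup W] (F : ℕ → ℕ → W) : Prop :=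
  ∃ K, ∀ i j, K ≤ i ∨ K ≤ j → F i j = 0

section Sums

variable {W : Type*} [AddCommGroup W] [Module ℂ W]

/-- `finsum` takes the value `0` on infinite support, so every manipulation of the infinite sums
below rests on such a truncation. -/
theorem EvZero.finsum_eq {f : ℕ → W} {K : ℕ} (h : ∀ j, K ≤ j → f j = 0) :
    ∑ᶠ j, f j = ∑ j ∈ Finset.range K, f j := by
  refine finsum_eq_sum_of_support_subset f fun j hj => ?_
  by_contra hlt
  exact hj (h j (by simpa using hlt))

theorem EvZero.finite {f : ℕ → W} (h : EvZero f) : (Function.support f).Finite := by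
  obtain ⟨K, hK⟩ := h
  refine (Set.finite_lt_nat K).subset fun j hj => ?_
  by_contra hlt
  exact hj (hK j (not_lt.mp hlt))

theorem EvZero.smul {f : ℕ → W} (h : EvZero f) (c : ℕ → ℂ) : EvZero fun j => c j • f j := by
  obtain ⟨K, hK⟩ := h
  exact ⟨K, fun j hj => by simp only [hK j hj, smul_zero]⟩

theorem EvZero.sub {f g : ℕ → W} (hf : EvZero f) (hg : EvZero g) : EvZero fun j => f j - g j := by
  obtain ⟨K, hK⟩ := hf
  obtain ⟨L, hL⟩ := hg
  refine ⟨max K L, fun j hj => ?_⟩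
  simp only [hK j ((le_max_left _ _).trans hj), hL j ((le_max_right _ _).trans hj), sub_zero]

theorem EvZero.shift {f : ℕ → W} (h : EvZero f) (s : ℕ) : EvZero fun j => f (j + s) := by
  obtain ⟨K, hK⟩ := h
  exact ⟨K, fun j hj => hK _ (by omega)⟩

theorem EvZero.map {f : ℕ → W} (h : EvZero f) {W' : Type*} [AddCommGroup W'] [Module ℂ W']
    (T : ℕ → W →ₗ[ℂ] W') : EvZero fun j => T j (f j) := by
  obtain ⟨K, hK⟩ := h
  exact ⟨K, fun j hj => by simp only [hK j hj, map_zero]⟩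

theorem EvZero.map_finsum {f : ℕ → W} (h : EvZero f) {W' : Type*} [AddCommGroup W'] [Module ℂ W']
    (T : W →ₗ[ℂ] W') : T (∑ᶠ j, f j) = ∑ᶠ j, T (f j) :=
  T.toAddMonoidHom.map_finsum h.finite

theorem EvZero.finsum_add {f g : ℕ → W} (hf : EvZero f) (hg : EvZero g) :
    ∑ᶠ j, (f j + g j) = ∑ᶠ j, f j + ∑ᶠ j, g j :=
  finsum_add_distrib hf.finite hg.finite

theorem EvZero.finsum_sub {f g : ℕ → W} (hf : EvZero f) (hg : EvZero g) :
    ∑ᶠ j, (f j - g j) = ∑ᶠ j, f j - ∑ᶠ j, g j :=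
  finsum_sub_distrib hf.finite hg.finite

theorem EvZero.finsum_succ {f : ℕ → W} (h : EvZero f) : ∑ᶠ j, f j = f 0 + ∑ᶠ j, f (j + 1) := by
  obtain ⟨K, hK⟩ := h
  rw [EvZero.finsum_eq (f := f) (K := K + 1) fun j hj => hK j (by omega),
    EvZero.finsum_eq (f := fun j => f (j + 1)) (K := K) fun j hj => hK _ (by omega),
    Finset.sum_range_succ', add_comm]

theorem EvZero.finsum_shift {f : ℕ → W} (h : EvZero f) {s : ℕ} (hs : ∀ j < s, f j = 0) :
    ∑ᶠ j, f j = ∑ᶠ j, f (j + s) := by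
  induction s with
  | zero => simp
  | succ s ih =>
    rw [ih fun j hj => hs j (by omega), (h.shift s).finsum_succ]
    simp only [zero_add, hs s (by omega)]
    exact finsum_congr fun j => by rw [add_assoc, add_comm 1 s]

theorem finsum_single_zero {f : ℕ → W} (h : ∀ j, j ≠ 0 → f j = 0) : ∑ᶠ j, f j = f 0 :=
  finsum_eq_single f 0 h

/-- Stated for all large `K`, so that several double sums can be truncated to one common square and
compared as finite sums. -/
theorem EvZero₂.eventually {F : ℕ → ℕ → W} (h : EvZero₂ F) :
    ∀ᶠ K in atTop, ∑ᶠ i, ∑ᶠ j, F i j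
      = ∑ i ∈ Finset.range K, ∑ j ∈ Finset.range K, F i j := by
  obtain ⟨K, hK⟩ := h
  filter_upwards [eventually_ge_atTop K] with L hL
  rw [EvZero.finsum_eq (K := L) fun i hi => ?_]
  · exact Finset.sum_congr rfl fun i _ =>
      EvZero.finsum_eq fun j hj => hK i j (Or.inr (hL.trans hj))
  · exact finsum_eq_zero_of_forall_eq_zero fun j => hK i j (Or.inl (hL.trans hi))

/-- A uniform bound on the rows leaves finitely many rows, whose separate bounds then have a common
upper bound. -/
theorem EvZero₂.of_left {F : ℕ → ℕ → W} (h₁ : ∃ K, ∀ i j, K ≤ i → F i j = 0)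
    (h₂ : ∀ i, EvZero (F i)) : EvZero₂ F := by
  obtain ⟨K, hK⟩ := h₁
  choose L hL using h₂
  refine ⟨max K (∑ i ∈ Finset.range K, L i), fun i j hij => ?_⟩
  by_cases hi : K ≤ i
  · exact hK i j hi
  · refine hL i j ?_
    have h1 : L i ≤ ∑ i ∈ Finset.range K, L i :=
      Finset.single_le_sum (f := L) (fun _ _ => Nat.zero_le _) (Finset.mem_range.2 (by omega))
    rcases hij with h | h
    · exact absurd ((le_max_left _ _).trans h) hi
    · exact h1.trans ((le_max_right _ _).trans h)

theorem EvZero₂.swap {F : ℕ → ℕ → W} (h : EvZero₂ F) : EvZero₂ fun j i => F i j := by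
  obtain ⟨K, hK⟩ := h
  exact ⟨K, fun i j hij => hK j i hij.symm⟩

theorem EvZero₂.of_right {F : ℕ → ℕ → W} (h₁ : ∃ K, ∀ i j, K ≤ j → F i j = 0)
    (h₂ : ∀ j, EvZero fun i => F i j) : EvZero₂ F :=
  (EvZero₂.of_left (F := fun j i => F i j)
    (h₁.imp fun _ h i j => h j i) h₂).swap

theorem EvZero₂.of_add {F : ℕ → ℕ → W} {g : ℕ → W} (hg : EvZero g)
    (h : ∀ i j, g (i + j) = 0 → F i j = 0) : EvZero₂ F := by
  obtain ⟨K, hK⟩ := hg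
  exact ⟨K, fun i j hij => h i j (hK _ (by omega))⟩

theorem EvZero₂.smul {F : ℕ → ℕ → W} (h : EvZero₂ F) (c : ℕ → ℕ → ℂ) :
    EvZero₂ fun i j => c i j • F i j := by
  obtain ⟨K, hK⟩ := h
  exact ⟨K, fun i j hij => by simp only [hK i j hij, smul_zero]⟩

theorem EvZero₂.comm {F : ℕ → ℕ → W} (h : EvZero₂ F) :
    ∑ᶠ i, ∑ᶠ j, F i j = ∑ᶠ j, ∑ᶠ i, F i j := by
  obtain ⟨K, h1, h2⟩ := (h.eventually.and h.swap.eventually).exists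
  rw [h1, h2, Finset.sum_comm]

theorem EvZero₂.finsum_add {F G : ℕ → ℕ → W} (hF : EvZero₂ F) (hG : EvZero₂ G) :
    ∑ᶠ i, ∑ᶠ j, (F i j + G i j) = ∑ᶠ i, ∑ᶠ j, F i j + ∑ᶠ i, ∑ᶠ j, G i j := by
  have hFG : EvZero₂ fun i j => F i j + G i j := by
    obtain ⟨K, hK⟩ := hF
    obtain ⟨L, hL⟩ := hG
    refine ⟨max K L, fun i j hij => ?_⟩
    simp only [hK i j (by omega), hL i j (by omega), add_zero]
  obtain ⟨K, ⟨h1, h2⟩, h3⟩ := ((hF.eventually.and hG.eventually).and hFG.eventually).exists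
  rw [h1, h2, h3]
  simp only [Finset.sum_add_distrib]

theorem EvZero₂.finsum_smul {F : ℕ → ℕ → W} (hF : EvZero₂ F) (c : ℂ) :
    ∑ᶠ i, ∑ᶠ j, c • F i j = c • ∑ᶠ i, ∑ᶠ j, F i j := by
  obtain ⟨K, h1, h2⟩ := (hF.eventually.and (hF.smul fun _ _ => c).eventually).exists
  rw [h1, h2]
  simp only [Finset.smul_sum]

theorem EvZero₂.finsum_sum {ι : Type*} (s : Finset ι) {F : ι → ℕ → ℕ → W}
    (hF : ∀ t, EvZero₂ (F t)) :
    ∑ᶠ i, ∑ᶠ j, ∑ t ∈ s, F t i j = ∑ t ∈ s, ∑ᶠ i, ∑ᶠ j, F t i j := by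
  classical
  induction s using Finset.induction_on with
  | empty => simp
  | insert a s ha ih =>
    have hs : EvZero₂ fun i j => ∑ t ∈ s, F t i j := by
      choose K hK using hF
      refine ⟨∑ t ∈ s, K t, fun i j hij => Finset.sum_eq_zero fun t ht => hK t i j ?_⟩
      have : K t ≤ ∑ t ∈ s, K t := Finset.single_le_sum (fun _ _ => Nat.zero_le _) ht
      omega
    simp only [Finset.sum_insert ha]
    rw [EvZero₂.finsum_add (hF a) hs, ih]

end Sums

/-! ### Binomial coefficients -/

/-- `binom(n, j)` for an integer `n`. -/
def intChoose (n : ℤ) (j : ℕ) : ℂ := ((Ring.choose n j : ℤ) : ℂ)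

theorem sgnChoose_eq (n : ℤ) (j : ℕ) : sgnChoose n j = (-1 : ℂ) ^ j * intChoose n j := rfl

@[simp] theorem intChoose_zero_right (n : ℤ) : intChoose n 0 = 1 := by simp [intChoose]

@[simp] theorem intChoose_one_right (n : ℤ) : intChoose n 1 = n := by simp [intChoose]

theorem intChoose_zero_left (j : ℕ) : intChoose 0 j = if j = 0 then 1 else 0 := by
  rw [intChoose, Ring.choose_zero_ite]
  split_ifs <;> simp

theorem intChoose_succ (n : ℤ) (j : ℕ) :
    intChoose (n + 1) (j + 1) = intChoose n j + intChoose n (j + 1) := by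
  simp [intChoose, Ring.choose_succ_succ]

theorem intChoose_natCast (n j : ℕ) : intChoose n j = (n.choose j : ℂ) := by
  have h := Ring.choose_natCast (R := ℤ) n j
  simp only [intChoose]
  rw [h]
  simp

theorem intChoose_add (n m : ℤ) (k : ℕ) :
    intChoose (n + m) k = ∑ p ∈ Finset.HasAntidiagonal.antidiagonal k, intChoose n p.1 * intChoose m p.2 := by
  simp [intChoose, Ring.add_choose_eq k (Commute.all n m)]

/-- `(j + 1) binom(n, j + 1) = n binom(n - 1, j)`. -/
theorem succ_mul_intChoose (n : ℤ) (j : ℕ) :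
    ((j : ℂ) + 1) * intChoose n (j + 1) = n * intChoose (n - 1) j := by
  have h := Ring.choose_smul_choose n (n := j + 1) (k := 1) (by omega)
  simp only [Nat.choose_one_right, Ring.choose_one_right, nsmul_eq_mul, Nat.cast_one,
    Nat.add_sub_cancel] at h
  simp only [intChoose]
  exact_mod_cast h

theorem sub_mul_intChoose (n : ℤ) (j : ℕ) :
    ((n : ℂ) - j) * intChoose n j = n * intChoose (n - 1) j := by
  cases j with
  | zero => simp
  | succ j =>
    have h1 := succ_mul_intChoose n j
    have h2 := intChoose_succ (n - 1) j
    rw [sub_add_cancel] at h2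
    push_cast
    rw [sub_mul, h1, h2]
    ring

/-- The subset-of-a-subset identity. It is what separates the index `s` of the commutator in
`nthProd_comm` from the summation index `i`. -/
theorem intChoose_mul (n : ℤ) (i s : ℕ) :
    intChoose n (i + s) * intChoose (i + s : ℕ) s = intChoose n s * intChoose (n - s) i := by
  have h := Ring.choose_smul_choose n (n := i + s) (k := s) (by omega)
  rw [Nat.add_sub_cancel, nsmul_eq_mul] at h
  rw [intChoose_natCast, mul_comm]
  simp only [intChoose]
  exact_mod_cast h

theorem intChoose_mul_sub (n : ℤ) (i s : ℕ) :
    intChoose n i * intChoose (n - i) s = intChoose n s * intChoose (n - s) i := by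
  rw [← intChoose_mul n s i, ← intChoose_mul n i s, add_comm s i]
  congr 1
  rw [intChoose_natCast, intChoose_natCast, Nat.choose_symm_add]

@[simp] theorem sgnChoose_zero_right (n : ℤ) : sgnChoose n 0 = 1 := by simp [sgnChoose_eq]

theorem sgnChoose_zero_left (j : ℕ) : sgnChoose 0 j = if j = 0 then 1 else 0 := by
  rw [sgnChoose_eq, intChoose_zero_left]
  split_ifs with h <;> simp [h]

theorem sgnChoose_succ (n : ℤ) (j : ℕ) :
    sgnChoose (n + 1) (j + 1) = sgnChoose n (j + 1) - sgnChoose n j := by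
  simp only [sgnChoose_eq, intChoose_succ]
  ring

/-- The expansion of `(1 - x)⁻¹`; this is why normally ordered products carry no binomial weights.
-/
theorem sgnChoose_neg_one (j : ℕ) : sgnChoose (-1) j = 1 := by
  induction j with
  | zero => simp
  | succ j ih =>
    have h := sgnChoose_succ (-1) j
    rw [neg_add_cancel, sgnChoose_zero_left, if_neg (by omega), ih] at h
    linear_combination -h

section Pascal

variable {W : Type*} [AddCommGroup W] [Module ℂ W]

/-- Pascal's rule under the summation sign, used for induction on the exponent. -/
theorem EvZero.finsum_intChoose_succ {f : ℕ → W} (h : EvZero f) (n : ℤ) :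
    ∑ᶠ j, intChoose (n + 1) j • f j
      = ∑ᶠ j, intChoose n j • f j + ∑ᶠ j, intChoose n j • f (j + 1) := by
  rw [(h.smul _).finsum_succ, (h.smul fun j => intChoose n j).finsum_succ]
  simp only [intChoose_succ, add_smul, intChoose_zero_right, one_smul]
  rw [EvZero.finsum_add ((h.shift 1).smul _) ((h.shift 1).smul fun j => intChoose n (j + 1))]
  abel

theorem EvZero.finsum_sgnChoose_succ {f : ℕ → W} (h : EvZero f) (n : ℤ) :
    ∑ᶠ j, sgnChoose (n + 1) j • f j
      = ∑ᶠ j, sgnChoose n j • f j - ∑ᶠ j, sgnChoose n j • f (j + 1) := by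
  rw [(h.smul _).finsum_succ, (h.smul fun j => sgnChoose n j).finsum_succ]
  simp only [sgnChoose_succ, sub_smul, sgnChoose_zero_right, one_smul]
  rw [EvZero.finsum_sub ((h.shift 1).smul fun j => sgnChoose n (j + 1)) ((h.shift 1).smul _)]
  abel

theorem finsum_intChoose_zero (f : ℕ → W) : ∑ᶠ j, intChoose 0 j • f j = f 0 := by
  rw [finsum_single_zero fun j hj => by rw [intChoose_zero_left, if_neg hj, zero_smul] ]
  simp

theorem finsum_sgnChoose_zero (f : ℕ → W) : ∑ᶠ j, sgnChoose 0 j • f j = f 0 := by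
  rw [finsum_single_zero fun j hj => by rw [sgnChoose_zero_left, if_neg hj, zero_smul] ]
  simp

/-- The Vandermonde convolution. -/
theorem EvZero.finsum_vandermonde {g : ℕ → W} (h : EvZero g) (n m : ℤ) :
    ∑ᶠ i, ∑ᶠ j, (sgnChoose n i * sgnChoose m j) • g (i + j)
      = ∑ᶠ r, sgnChoose (n + m) r • g r := by
  have h₂ : EvZero₂ fun i j => (sgnChoose n i * sgnChoose m j) • g (i + j) :=
    EvZero₂.of_add h fun i j h => by rw [h, smul_zero]
  obtain ⟨L, hL⟩ := h
  obtain ⟨K, hK, hLK⟩ := (h₂.eventually.and (eventually_ge_atTop L)).exists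
  have h0 : ∀ r, K ≤ r → sgnChoose (n + m) r • g r = 0 := fun r hr => by
    rw [hL r (hLK.trans hr), smul_zero]
  rw [hK, EvZero.finsum_eq h0]
  have h1 : ∀ r, sgnChoose (n + m) r • g r
      = ∑ p ∈ Finset.HasAntidiagonal.antidiagonal r, (sgnChoose n p.1 * sgnChoose m p.2) • g (p.1 + p.2) := by
    intro r
    rw [sgnChoose_eq, intChoose_add, Finset.mul_sum, Finset.sum_smul]
    refine Finset.sum_congr rfl fun p hp => ?_
    rw [Finset.HasAntidiagonal.mem_antidiagonal] at hp
    rw [hp, sgnChoose_eq, sgnChoose_eq, ← hp, pow_add]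
    congr 1
    ring
  simp only [h1]
  rw [← Finset.sum_product', Finset.sum_sigma']
  -- Only the triangle `i + j < K` of the square matters: beyond it `g (i + j)` vanishes. The
  -- triangle is then fibred by `r = i + j`.
  rw [← Finset.sum_filter_add_sum_filter_not _ (fun p : ℕ × ℕ => p.1 + p.2 < K),
    Finset.sum_eq_zero (s := (Finset.range K ×ˢ Finset.range K).filter (fun p => ¬ p.1 + p.2 < K))
      (fun p hp => ?_),
    add_zero]
  · symm
    refine Finset.sum_bij' (fun x _ => x.2) (fun p _ => ⟨p.1 + p.2, p⟩) ?_ ?_ ?_ ?_ ?_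
    · rintro ⟨r, p⟩ h
      simp only [Finset.mem_sigma, Finset.mem_range, Finset.HasAntidiagonal.mem_antidiagonal] at h
      simp only [Finset.mem_filter, Finset.mem_product, Finset.mem_range]
      omega
    · rintro p h
      simp only [Finset.mem_filter, Finset.mem_product, Finset.mem_range] at h
      simp only [Finset.mem_sigma, Finset.mem_range, Finset.HasAntidiagonal.mem_antidiagonal]
      exact ⟨h.2, trivial⟩
    · rintro ⟨r, p⟩ h
      simp only [Finset.mem_sigma, Finset.mem_range, Finset.HasAntidiagonal.mem_antidiagonal] at h
      obtain ⟨-, rfl⟩ := h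
      rfl
    · intros
      rfl
    · intros
      rfl
  · rw [Finset.mem_filter, not_lt] at hp
    rw [hL _ (hLK.trans hp.2), smul_zero]

end Pascal

/-! ### The right-hand side of the Jacobi identity, locality -/

section Fields

variable {W : Type*} [AddCommGroup W] [Module ℂ W]

@[simp] theorem mode_add (A B : VertexOperator ℂ W) (n : ℤ) (w : W) :
    ((A + B)[[n]]) w = (A[[n]]) w + (B[[n]]) w := by
  rw [map_add]
  rfl

@[simp] theorem mode_sub (A B : VertexOperator ℂ W) (n : ℤ) (w : W) :
    ((A - B)[[n]]) w = (A[[n]]) w - (B[[n]]) w := by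
  rw [map_sub]
  rfl

@[simp] theorem mode_neg (A : VertexOperator ℂ W) (n : ℤ) (w : W) :
    ((-A)[[n]]) w = -(A[[n]]) w := by
  rw [map_neg]
  rfl

@[simp] theorem mode_smul (c : ℂ) (A : VertexOperator ℂ W) (n : ℤ) (w : W) :
    ((c • A)[[n]]) w = c • (A[[n]]) w := by
  rw [map_smul]
  rfl

@[simp] theorem mode_zero (n : ℤ) (w : W) : ((0 : VertexOperator ℂ W)[[n]]) w = 0 := by
  rw [map_zero]
  rfl

theorem mode_sum {ι : Type*} (s : Finset ι) (A : ι → VertexOperator ℂ W) (n : ℤ) (w : W) :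
    ((∑ i ∈ s, A i)[[n]]) w = ∑ i ∈ s, ((A i)[[n]]) w := by
  classical
  induction s using Finset.induction_on with
  | empty => simp
  | insert a s ha ih => rw [Finset.sum_insert ha, Finset.sum_insert ha, mode_add, ih]

theorem idField_mode (n : ℤ) (w : W) : ((idField W)[[n]]) w = if n = -1 then w else 0 := by
  rw [idField, mkField_mode]
  split_ifs <;> rfl

theorem mode_evZero (A : VertexOperator ℂ W) (w : W) (k : ℤ) :
    EvZero fun j : ℕ => (A[[k + j]]) w := by
  obtain ⟨N, hN⟩ := field_trunc A w
  exact ⟨(N - k).toNat, fun j hj => hN _ (by omega)⟩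

theorem mode_evZero' (A : VertexOperator ℂ W) (w : W) : EvZero fun j : ℕ => (A[[(j : ℤ)]]) w := by
  simpa using mode_evZero A w 0

theorem mode_comp_evZero (A B : VertexOperator ℂ W) (w : W) (k : ℤ) (f : ℕ → ℤ) :
    EvZero fun j : ℕ => (A[[f j]]) ((B[[k + j]]) w) :=
  (mode_evZero B w k).map fun j => A[[f j]]

/-- The right-hand side of the Jacobi identity for the fields `A`, `B` with sign `ε`: the
coefficient of `z₁^(-m-1) z₂^(-k-1)` in
`(z₁ - z₂)^n A(z₁) B(z₂) - ε (-z₂ + z₁)^n B(z₂) A(z₁)`. -/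
def jac (ε : ℂ) (A B : VertexOperator ℂ W) (n m k : ℤ) (w : W) : W :=
  (∑ᶠ j : ℕ, sgnChoose n j • (A[[m + n - j]]) ((B[[k + j]]) w))
    - (ε * (-1 : ℂ) ^ n) • ∑ᶠ j : ℕ, sgnChoose n j • (B[[n + k - j]]) ((A[[m + j]]) w)

theorem nthProd_mode (ε : ℂ) (A B : VertexOperator ℂ W) (n m : ℤ) (w : W) :
    ((nthProd ε A n B)[[m]]) w
      = (∑ᶠ j : ℕ, sgnChoose n j • (A[[n - j]]) ((B[[m + j]]) w))
        - (ε * (-1 : ℂ) ^ n) • ∑ᶠ j : ℕ, sgnChoose n j • (B[[n + m - j]]) ((A[[(j : ℤ)]]) w) := by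
  rw [nthProd, mkField_mode]
  rfl

theorem nthProd_mode_eq_jac (ε : ℂ) (A B : VertexOperator ℂ W) (n m : ℤ) (w : W) :
    ((nthProd ε A n B)[[m]]) w = jac ε A B n 0 m w := by
  rw [nthProd_mode, jac]
  simp only [zero_add]

/-- Raising `n` by one multiplies the generating series by `z₁ - z₂`, a difference of two index
shifts. All later inductions on `n` use this recursion. -/
theorem jac_succ (ε : ℂ) (A B : VertexOperator ℂ W) (n m k : ℤ) (w : W) :
    jac ε A B (n + 1) m k w = jac ε A B n (m + 1) k w - jac ε A B n m (k + 1) w := by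
  simp only [jac]
  rw [(mode_comp_evZero A B w k fun j => m + (n + 1) - j).finsum_sgnChoose_succ n,
    (mode_comp_evZero B A w m fun j => n + 1 + k - j).finsum_sgnChoose_succ n,
    zpow_add_one₀ (by norm_num : (-1 : ℂ) ≠ 0)]
  have e1 : ∀ j : ℕ, m + (n + 1) - ((j + 1 : ℕ) : ℤ) = m + n - j := fun j => by push_cast; ring
  have e2 : ∀ j : ℕ, k + ((j + 1 : ℕ) : ℤ) = k + 1 + j := fun j => by push_cast; ring
  have e3 : ∀ j : ℕ, m + (n + 1) - (j : ℤ) = m + 1 + n - j := fun j => by ring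
  have e4 : ∀ j : ℕ, n + 1 + k - ((j + 1 : ℕ) : ℤ) = n + k - j := fun j => by push_cast; ring
  have e5 : ∀ j : ℕ, m + ((j + 1 : ℕ) : ℤ) = m + 1 + j := fun j => by push_cast; ring
  have e6 : ∀ j : ℕ, n + 1 + k - (j : ℤ) = n + (k + 1) - j := fun j => by ring
  simp only [e1, e2, e3, e4, e5, e6]
  module

theorem jac_zero (ε : ℂ) (A B : VertexOperator ℂ W) (m k : ℤ) (w : W) :
    jac ε A B 0 m k w = (A[[m]]) ((B[[k]]) w) - ε • (B[[k]]) ((A[[m]]) w) := by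
  simp only [jac]
  rw [finsum_sgnChoose_zero, finsum_sgnChoose_zero]
  simp

/-- Mutual locality of two fields with sign `ε`. -/
def Local (ε : ℂ) (A B : VertexOperator ℂ W) : Prop :=
  ∃ N : ℕ, ∀ m k w, jac ε A B N m k w = 0

theorem jac_eq_zero_of_le {ε : ℂ} {A B : VertexOperator ℂ W} {N : ℤ}
    (h : ∀ m k w, jac ε A B N m k w = 0) {n : ℤ} (hn : N ≤ n) (m k : ℤ) (w : W) :
    jac ε A B n m k w = 0 := by
  induction n, hn using Int.leInduction generalizing m k with
  | base => exact h m k w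
  | succ n _ ih => rw [jac_succ, ih, ih, sub_zero]

/-- The Jacobi identity for two local fields and their products. -/
theorem Local.jacobi {ε : ℂ} {A B : VertexOperator ℂ W} (h : Local ε A B) (m n k : ℤ) (w : W) :
    ∑ᶠ j : ℕ, intChoose m j • ((nthProd ε A (n + j) B)[[m + k - j]]) w = jac ε A B n m k w := by
  obtain ⟨N, hN⟩ := h
  have hz : ∀ n : ℤ, N ≤ n → ∀ m k, jac ε A B n m k w = 0 := fun n hn m k =>
    jac_eq_zero_of_le hN hn m k w
  have hev : ∀ m n k : ℤ, EvZero fun j : ℕ => ((nthProd ε A (n + j) B)[[m + k - j]]) w :=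
    fun m n k => ⟨(N - n).toNat, fun j hj => by
      simp only [nthProd_mode_eq_jac]
      exact hz _ (by omega) _ _⟩
  -- The left-hand side obeys the Pascal recursion in `m`; by `jac_succ` the right-hand side obeys
  -- the same one. At `m = 0` the identity is the definition of the `n`-th product.
  have hstep : ∀ m n k : ℤ,
      ∑ᶠ j : ℕ, intChoose (m + 1) j • ((nthProd ε A (n + j) B)[[m + 1 + k - j]]) w
        = ∑ᶠ j : ℕ, intChoose m j • ((nthProd ε A (n + j) B)[[m + (k + 1) - j]]) w
        + ∑ᶠ j : ℕ, intChoose m j • ((nthProd ε A (n + 1 + j) B)[[m + k - j]]) w := by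
    intro m n k
    rw [(hev (m + 1) n k).finsum_intChoose_succ m]
    have e1 : ∀ j : ℕ, m + 1 + k - (j : ℤ) = m + (k + 1) - j := fun j => by ring
    have e2 : ∀ j : ℕ, n + ((j + 1 : ℕ) : ℤ) = n + 1 + j := fun j => by push_cast; ring
    have e3 : ∀ j : ℕ, m + 1 + k - ((j + 1 : ℕ) : ℤ) = m + k - j := fun j => by push_cast; ring
    simp only [e2, e3]
    simp only [e1]
  induction m using Int.induction_on generalizing n k with
  | zero =>
    rw [finsum_intChoose_zero]
    simp [nthProd_mode_eq_jac]
  | succ m ih => rw [hstep, ih, ih, jac_succ]; abel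
  | pred m ih =>
    -- For negative `m` the recursion has to be run backwards, which needs a starting value: for `n
    -- ≥ N` both sides vanish by locality.
    have hlarge : ∀ n : ℤ, N ≤ n → ∀ k, ∑ᶠ j : ℕ, intChoose (-m - 1) j •
        ((nthProd ε A (n + j) B)[[-m - 1 + k - j]]) w = jac ε A B n (-m - 1) k w := by
      intro n hn k
      rw [hz n hn, finsum_eq_zero_of_forall_eq_zero]
      intro j
      rw [nthProd_mode_eq_jac, hz _ (by omega), smul_zero]
    by_cases hn : (N : ℤ) ≤ n
    · exact hlarge n hn k
    -- Descending from `n = N`, the recursion expresses the value at `(-m-1, n-1)` through those at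
    -- `(-m, n-1)` and `(-m-1, n)`.
    · have key : ∀ n : ℤ, n ≤ N → ∀ k, ∑ᶠ j : ℕ, intChoose (-m - 1) j •
          ((nthProd ε A (n + j) B)[[-m - 1 + k - j]]) w = jac ε A B n (-m - 1) k w := by
        intro n hn
        induction n, hn using Int.leInductionDown with
        | base => exact hlarge N le_rfl
        | pred n _ ihn =>
          intro k
          have h1 := hstep (-m - 1) (n - 1) (k - 1)
          have h2 := jac_succ ε A B (n - 1) (-m - 1) (k - 1) w
          simp only [sub_add_cancel] at h1 h2
          rw [ih, ihn] at h1
          rw [h2] at h1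
          rw [← sub_eq_iff_eq_add] at h1
          rw [← h1]
          abel
      exact key n (by omega) k

/-- The commutator formula for local fields. -/
theorem Local.commutator {ε : ℂ} {A B : VertexOperator ℂ W} (h : Local ε A B) (m k : ℤ) (w : W) :
    (A[[m]]) ((B[[k]]) w) - ε • (B[[k]]) ((A[[m]]) w)
      = ∑ᶠ j : ℕ, intChoose m j • ((nthProd ε A j B)[[m + k - j]]) w := by
  rw [← jac_zero, ← h.jacobi]
  simp only [zero_add]

/-! ### Locality in terms of shift operators -/

/-- The operator `z₁ - z₂` on coefficient functions. -/
def delta₁₂ (W : Type*) [AddCommGroup W] [Module ℂ W] : Module.End ℂ (ℤ → ℤ → W) where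
  toFun f m k := f (m + 1) k - f m (k + 1)
  map_add' f g := by funext m k; simp only [Pi.add_apply]; abel
  map_smul' c f := by funext m k; simp only [Pi.smul_apply, smul_sub, RingHom.id_apply]

theorem jac_natCast (ε : ℂ) (A B : VertexOperator ℂ W) (N : ℕ) (w : W) :
    (fun m k => jac ε A B N m k w) = (delta₁₂ W ^ N) fun m k => jac ε A B 0 m k w := by
  induction N with
  | zero => simp
  | succ N ih =>
    rw [pow_succ', Module.End.mul_apply, ← ih]
    funext m k
    rw [Nat.cast_succ, jac_succ]
    rfl

/-- For natural exponents the Jacobi expression is a power of `delta₁₂` applied to the commutator.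
Locality thus becomes nilpotency, and Dong's lemma becomes algebra of commuting operators. -/
theorem local_iff {ε : ℂ} {A B : VertexOperator ℂ W} : Local ε A B ↔ ∃ N : ℕ, ∀ w,
    (delta₁₂ W ^ N) (fun m k => (A[[m]]) ((B[[k]]) w) - ε • (B[[k]]) ((A[[m]]) w)) = 0 := by
  have h : ∀ (N : ℕ) w, (delta₁₂ W ^ N)
      (fun m k => (A[[m]]) ((B[[k]]) w) - ε • (B[[k]]) ((A[[m]]) w))
        = fun m k => jac ε A B N m k w := by
    intro N w
    rw [jac_natCast]
    simp only [jac_zero]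
  simp only [h, Local]
  refine exists_congr fun N => ⟨fun h w => ?_, fun h m k w => ?_⟩
  · funext m k
    exact h m k w
  · exact congrFun (congrFun (h w) m) k

end Fields

/-! ### Dong's lemma -/

section Dong

variable {W : Type*} [AddCommGroup W] [Module ℂ W]

/-- Every term of the binomial expansion has exponent at least `a` in `u` or at least `b` in `v`. -/
theorem add_pow_apply_eq_zero {X : Type*} [AddCommGroup X] [Module ℂ X] {u v : Module.End ℂ X}
    (huv : Commute u v) {a b : ℕ} {x : X} (hu : (u ^ a) x = 0) (hv : (v ^ b) x = 0) :
    ((u + v) ^ (a + b)) x = 0 := by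
  rw [huv.add_pow, LinearMap.sum_apply]
  refine Finset.sum_eq_zero fun i _ => ?_
  rw [(Nat.cast_commute _ _).symm.eq, Module.End.mul_apply]
  by_cases hi : a ≤ i
  · rw [(huv.pow_pow _ _).eq, Module.End.mul_apply, ← Nat.sub_add_cancel hi, pow_add u,
      Module.End.mul_apply, hu, map_zero, map_zero, map_zero]
  · have h : a + b - i = a + b - i - b + b := by omega
    rw [Module.End.mul_apply, h, pow_add v, Module.End.mul_apply, hv, map_zero, map_zero, map_zero]

/-- Multiplication by `z₁ - z₂` on coefficient functions in three variables. -/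
def shift₁₂ (W : Type*) [AddCommGroup W] [Module ℂ W] : Module.End ℂ (ℤ → ℤ → ℤ → W) where
  toFun f i m k := f (i + 1) m k - f i (m + 1) k
  map_add' f g := by funext i m k; simp only [Pi.add_apply]; abel
  map_smul' c f := by funext i m k; simp only [Pi.smul_apply, smul_sub, RingHom.id_apply]

/-- Multiplication by `z₁ - z₃`. -/
def shift₁₃ (W : Type*) [AddCommGroup W] [Module ℂ W] : Module.End ℂ (ℤ → ℤ → ℤ → W) where
  toFun f i m k := f (i + 1) m k - f i m (k + 1)
  map_add' f g := by funext i m k; simp only [Pi.add_apply]; abel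
  map_smul' c f := by funext i m k; simp only [Pi.smul_apply, smul_sub, RingHom.id_apply]

/-- Multiplication by `z₂ - z₃`. -/
def shift₂₃ (W : Type*) [AddCommGroup W] [Module ℂ W] : Module.End ℂ (ℤ → ℤ → ℤ → W) where
  toFun f i m k := f i (m + 1) k - f i m (k + 1)
  map_add' f g := by funext i m k; simp only [Pi.add_apply]; abel
  map_smul' c f := by funext i m k; simp only [Pi.smul_apply, smul_sub, RingHom.id_apply]

theorem shift₁₃_eq : shift₁₃ W = shift₁₂ W + shift₂₃ W := by
  ext f i m k
  change f (i + 1) m k - f i m (k + 1)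
    = (f (i + 1) m k - f i (m + 1) k) + (f i (m + 1) k - f i m (k + 1))
  abel

theorem commute_shift₁₂_shift₂₃ : Commute (shift₁₂ W) (shift₂₃ W) := by
  ext f i m k
  change (f (i + 1) (m + 1) k - f (i + 1) m (k + 1)) - (f i (m + 1 + 1) k - f i (m + 1) (k + 1))
    = (f (i + 1) (m + 1) k - f i (m + 1 + 1) k) - (f (i + 1) m (k + 1) - f i (m + 1) (k + 1))
  abel

theorem commute_shift₁₂_shift₁₃ : Commute (shift₁₂ W) (shift₁₃ W) := by
  rw [shift₁₃_eq]
  exact (Commute.refl _).add_right commute_shift₁₂_shift₂₃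

theorem commute_shift₂₃_shift₁₃ : Commute (shift₂₃ W) (shift₁₃ W) := by
  rw [shift₁₃_eq]
  exact commute_shift₁₂_shift₂₃.symm.add_right (Commute.refl _)

theorem shift₁₂_pow (N : ℕ) (f : ℤ → ℤ → ℤ → W) (i m k : ℤ) :
    (shift₁₂ W ^ N) f i m k = (delta₁₂ W ^ N) (fun i m => f i m k) i m := by
  induction N generalizing f with
  | zero => rfl
  | succ N ih =>
    rw [pow_succ, pow_succ, Module.End.mul_apply, Module.End.mul_apply, ih]
    rfl

theorem shift₁₃_pow (N : ℕ) (f : ℤ → ℤ → ℤ → W) (i m k : ℤ) :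
    (shift₁₃ W ^ N) f i m k = (delta₁₂ W ^ N) (fun i k => f i m k) i k := by
  induction N generalizing f with
  | zero => rfl
  | succ N ih =>
    rw [pow_succ, pow_succ, Module.End.mul_apply, Module.End.mul_apply, ih]
    rfl

theorem delta₁₂_pow_comp (N : ℕ) (T : W →ₗ[ℂ] W) (f : ℤ → ℤ → W) (m k : ℤ) :
    (delta₁₂ W ^ N) (fun m k => T (f m k)) m k = T ((delta₁₂ W ^ N) f m k) := by
  induction N generalizing f with
  | zero => rfl
  | succ N ih =>
    have h : delta₁₂ W (fun m k => T (f m k)) = fun m k => T (delta₁₂ W f m k) := by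
      funext m k
      exact (map_sub T _ _).symm
    rw [pow_succ, Module.End.mul_apply, Module.End.mul_apply, ← ih, h]

/-- A weighted sum along a path in the second and third variables. -/
def pathSum (c : ℕ → ℂ) (α β : ℕ → ℤ) (f : ℤ → ℤ → ℤ → W) : ℤ → ℤ → ℤ → W :=
  fun i m k => ∑ᶠ j, c j • f i (m + α j) (k + β j)

/-- Translation of the last two indices commutes with index shifts; the vanishing hypothesis is
there so that the sum of a difference splits. -/
theorem pathSum_shift {α β : ℕ → ℤ} {f : ℤ → ℤ → ℤ → W}
    (hf : ∀ i m k, EvZero fun j => f i (m + α j) (k + β j)) (c : ℕ → ℂ) :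
    ((∀ i m k, EvZero fun j => shift₁₂ W f i (m + α j) (k + β j)) ∧
      pathSum c α β (shift₁₂ W f) = shift₁₂ W (pathSum c α β f)) ∧
    ((∀ i m k, EvZero fun j => shift₁₃ W f i (m + α j) (k + β j)) ∧
      pathSum c α β (shift₁₃ W f) = shift₁₃ W (pathSum c α β f)) := by
  have e : ∀ (m : ℤ) a, m + 1 + a = m + a + 1 := fun m a => by ring
  have h2 : ∀ i m k, EvZero fun j => f i (m + α j + 1) (k + β j) := fun i m k => by
    simpa only [e] using hf i (m + 1) k
  have h3 : ∀ i m k, EvZero fun j => f i (m + α j) (k + β j + 1) := fun i m k => by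
    simpa only [e] using hf i m (k + 1)
  refine ⟨⟨fun i m k => (hf (i + 1) m k).sub (h2 i m k), ?_⟩,
    ⟨fun i m k => (hf (i + 1) m k).sub (h3 i m k), ?_⟩⟩
  · funext i m k
    change ∑ᶠ j, c j • (f (i + 1) (m + α j) (k + β j) - f i (m + α j + 1) (k + β j))
      = ∑ᶠ j, c j • f (i + 1) (m + α j) (k + β j) - ∑ᶠ j, c j • f i (m + 1 + α j) (k + β j)
    simp only [e, smul_sub]
    exact EvZero.finsum_sub ((hf (i + 1) m k).smul c) ((h2 i m k).smul c)
  · funext i m k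
    change ∑ᶠ j, c j • (f (i + 1) (m + α j) (k + β j) - f i (m + α j) (k + β j + 1))
      = ∑ᶠ j, c j • f (i + 1) (m + α j) (k + β j) - ∑ᶠ j, c j • f i (m + α j) (k + 1 + β j)
    simp only [e, smul_sub]
    exact EvZero.finsum_sub ((hf (i + 1) m k).smul c) ((h3 i m k).smul c)

theorem pathSum_eq_zero {α β : ℕ → ℤ} {f : ℤ → ℤ → ℤ → W}
    (hf : ∀ i m k, EvZero fun j => f i (m + α j) (k + β j)) (c : ℕ → ℂ) (a b : ℕ)
    (h : (shift₁₂ W ^ a) ((shift₁₃ W ^ b) f) = 0) :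
    (shift₁₂ W ^ a) ((shift₁₃ W ^ b) (pathSum c α β f)) = 0 := by
  have h₁₃ : ∀ b : ℕ, (∀ i m k, EvZero fun j => (shift₁₃ W ^ b) f i (m + α j) (k + β j)) ∧
      pathSum c α β ((shift₁₃ W ^ b) f) = (shift₁₃ W ^ b) (pathSum c α β f) := by
    intro b
    induction b with
    | zero => exact ⟨hf, rfl⟩
    | succ b ih =>
      have := (pathSum_shift ih.1 c).2
      rw [pow_succ', Module.End.mul_apply, Module.End.mul_apply, ← ih.2]
      exact this
  have h₁₂ : ∀ a : ℕ, (∀ i m k, EvZero fun j =>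
      (shift₁₂ W ^ a) ((shift₁₃ W ^ b) f) i (m + α j) (k + β j)) ∧
      pathSum c α β ((shift₁₂ W ^ a) ((shift₁₃ W ^ b) f))
        = (shift₁₂ W ^ a) ((shift₁₃ W ^ b) (pathSum c α β f)) := by
    intro a
    induction a with
    | zero => exact h₁₃ b
    | succ a ih =>
      have := (pathSum_shift ih.1 c).1
      rw [pow_succ', Module.End.mul_apply, Module.End.mul_apply, ← ih.2]
      exact this
  rw [← (h₁₂ a).2, h]
  funext i m k
  simp [pathSum]

/-- Dong's lemma. -/
theorem Local.nthProd {ε η θ : ℂ} {A B C : VertexOperator ℂ W} (hAB : Local ε A B)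
    (hAC : Local η A C) (hBC : Local θ B C) (n : ℤ) :
    Local (ε * η) A (nthProd θ B n C) := by
  obtain ⟨N₁, h₁⟩ := local_iff.1 hAB
  obtain ⟨N₂, h₂⟩ := local_iff.1 hAC
  obtain ⟨N₃, h₃⟩ := hBC
  rw [local_iff]
  -- Multiplication by `(z₂ - z₃)^r` lifts the exponent `n` to at least the locality order `N₃` of
  -- `B` and `C`.
  set r : ℕ := (N₃ - n).toNat with hr
  refine ⟨N₁ + r + N₂, fun w => ?_⟩
  -- The commutator of `A` with the whole Jacobi expression of `B` and `C`. Keeping the extra index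
  -- `m` makes `shift₂₃` act by `n ↦ n + 1`; the product field is the slice `m = 0`.
  let P : ℤ → ℤ → ℤ → ℤ → W := fun n i m k =>
    (A[[i]]) (jac θ B C n m k w) - (ε * η) • jac θ B C n m k ((A[[i]]) w)
  have hP : (fun m k => (A[[m]]) (((VertexTheory.nthProd θ B n C)[[k]]) w)
      - (ε * η) • ((VertexTheory.nthProd θ B n C)[[k]]) ((A[[m]]) w)) = fun i k => P n i 0 k := by
    funext i k
    rw [nthProd_mode_eq_jac, nthProd_mode_eq_jac]
  have hzero : (shift₁₃ W ^ (N₁ + r + N₂)) (P n) = 0 := by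
    have hsucc : ∀ n, shift₂₃ W (P n) = P (n + 1) := by
      intro n
      funext i m k
      change P n i (m + 1) k - P n i m (k + 1) = P (n + 1) i m k
      simp only [P, jac_succ, map_sub, smul_sub]
      abel
    have hpow : ∀ s : ℕ, (shift₂₃ W ^ s) (P n) = P (n + s) := by
      intro s
      induction s with
      | zero => simp
      | succ s ih => rw [pow_succ', Module.End.mul_apply, ih, hsucc, Nat.cast_succ, add_assoc]
    have h23 : (shift₂₃ W ^ r) (P n) = 0 := by
      rw [hpow]
      funext i m k
      have hz : ∀ w, jac θ B C (n + r) m k w = 0 := fun w =>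
        jac_eq_zero_of_le h₃ (by omega) m k w
      simp only [P, hz, map_zero, smul_zero, sub_zero, Pi.zero_apply]
    -- `F` and `G` are the commutators of `A` with `B C` and `C B`. Each is a sum of one term
    -- containing `[A, B]` and one containing `[A, C]`, hence killed by `shift₁₂ ^ N₁ * shift₁₃ ^
    -- N₂`.
    let F : ℤ → ℤ → ℤ → W := fun i m k =>
      (A[[i]]) ((B[[m]]) ((C[[k]]) w)) - (ε * η) • (B[[m]]) ((C[[k]]) ((A[[i]]) w))
    let G : ℤ → ℤ → ℤ → W := fun i m k =>
      (A[[i]]) ((C[[k]]) ((B[[m]]) w)) - (ε * η) • (C[[k]]) ((B[[m]]) ((A[[i]]) w))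
    have k12 : ∀ f : ℤ → ℤ → ℤ → W, (∀ k, (delta₁₂ W ^ N₁) (fun i m => f i m k) = 0) →
        (shift₁₂ W ^ N₁) ((shift₁₃ W ^ N₂) f) = 0 := by
      intro f hf
      rw [← Module.End.mul_apply, (commute_shift₁₂_shift₁₃.pow_pow _ _).eq, Module.End.mul_apply]
      have h0 : (shift₁₂ W ^ N₁) f = 0 := by
        funext i m k
        rw [shift₁₂_pow, hf]
        rfl
      rw [h0, map_zero]
    have k13 : ∀ f : ℤ → ℤ → ℤ → W, (∀ m, (delta₁₂ W ^ N₂) (fun i k => f i m k) = 0) →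
        (shift₁₂ W ^ N₁) ((shift₁₃ W ^ N₂) f) = 0 := by
      intro f hf
      have h0 : (shift₁₃ W ^ N₂) f = 0 := by
        funext i m k
        rw [shift₁₃_pow, hf]
        rfl
      rw [h0, map_zero]
    have hcomp : ∀ (N : ℕ) (T : W →ₗ[ℂ] W) (f : ℤ → ℤ → W), (delta₁₂ W ^ N) f = 0 →
        (delta₁₂ W ^ N) (fun m k => T (f m k)) = 0 := by
      intro N T f hf
      funext m k
      rw [delta₁₂_pow_comp, hf]
      exact map_zero T
    have hF : (shift₁₂ W ^ N₁) ((shift₁₃ W ^ N₂) F) = 0 := by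
      have hsplit : F = (fun i m k => (A[[i]]) ((B[[m]]) ((C[[k]]) w))
            - ε • (B[[m]]) ((A[[i]]) ((C[[k]]) w)))
          + fun i m k => (ε • (B[[m]])) ((A[[i]]) ((C[[k]]) w) - η • (C[[k]]) ((A[[i]]) w)) := by
        funext i m k
        simp only [F, Pi.add_apply, LinearMap.smul_apply, map_sub, map_smul]
        module
      rw [hsplit, map_add, map_add, k12 _ fun k => h₁ _, k13 _ fun m => hcomp _ _ _ (h₂ w),
        add_zero]
    have hG : (shift₁₂ W ^ N₁) ((shift₁₃ W ^ N₂) G) = 0 := by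
      have hsplit : G = (fun i m k => (A[[i]]) ((C[[k]]) ((B[[m]]) w))
            - η • (C[[k]]) ((A[[i]]) ((B[[m]]) w)))
          + fun i m k => (η • (C[[k]])) ((A[[i]]) ((B[[m]]) w) - ε • (B[[m]]) ((A[[i]]) w)) := by
        funext i m k
        simp only [G, Pi.add_apply, LinearMap.smul_apply, map_sub, map_smul]
        module
      rw [hsplit, map_add, map_add, k13 _ fun k => h₂ _, k12 _ fun m => hcomp _ _ _ (h₁ w),
        add_zero]
    have evF : ∀ i m k : ℤ, EvZero fun j : ℕ => F i (m + (n - j)) (k + j) := fun i m k =>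
      ((mode_comp_evZero B C w k fun j => m + (n - j)).map fun _ => A[[i]]).sub
        ((mode_comp_evZero B C ((A[[i]]) w) k fun j => m + (n - j)).smul _)
    have evG : ∀ i m k : ℤ, EvZero fun j : ℕ => G i (m + j) (k + (n - j)) := fun i m k =>
      ((mode_comp_evZero C B w m fun j => k + (n - j)).map fun _ => A[[i]]).sub
        ((mode_comp_evZero C B ((A[[i]]) w) m fun j => k + (n - j)).smul _)
    -- `P n` is a sum of translates of `F` and `G` in the last two indices, so it is killed by the
    -- same powers.
    have hPn : P n = pathSum (sgnChoose n) (fun j => n - j) (fun j => j) F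
        - (θ * (-1 : ℂ) ^ n) • pathSum (sgnChoose n) (fun j => j) (fun j => n - j) G := by
      funext i m k
      have e1 : ∀ j : ℕ, m + n - (j : ℤ) = m + (n - j) := fun j => by ring
      have e2 : ∀ j : ℕ, n + k - (j : ℤ) = k + (n - j) := fun j => by ring
      simp only [P, jac, pathSum, Pi.sub_apply, Pi.smul_apply, e1, e2, map_sub, map_smul]
      rw [((mode_comp_evZero B C w k fun j => m + (n - j)).smul _).map_finsum,
        ((mode_comp_evZero C B w m fun j => k + (n - j)).smul _).map_finsum]
      simp only [F, G, smul_sub, map_smul]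
      rw [EvZero.finsum_sub, EvZero.finsum_sub]
      · simp only [smul_comm _ (ε * η)]
        rw [← smul_finsum, ← smul_finsum]
        module
      · exact ((mode_comp_evZero C B w m fun j => k + (n - j)).map fun _ => A[[i]]).smul _
      · exact ((mode_comp_evZero C B ((A[[i]]) w) m fun j => k + (n - j)).smul _).smul _
      · exact ((mode_comp_evZero B C w k fun j => m + (n - j)).map fun _ => A[[i]]).smul _
      · exact ((mode_comp_evZero B C ((A[[i]]) w) k fun j => m + (n - j)).smul _).smul _
    have hq : (shift₁₂ W ^ N₁) ((shift₁₃ W ^ N₂) (P n)) = 0 := by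
      rw [hPn, map_sub, map_sub, map_smul, map_smul, pathSum_eq_zero evF _ _ _ hF,
        pathSum_eq_zero evG _ _ _ hG, smul_zero, sub_zero]
    have h23' : (shift₂₃ W ^ r) ((shift₁₃ W ^ N₂) (P n)) = 0 := by
      rw [← Module.End.mul_apply, (commute_shift₂₃_shift₁₃.pow_pow _ _).eq, Module.End.mul_apply,
        h23, map_zero]
    -- Here `z₁ - z₃ = (z₁ - z₂) + (z₂ - z₃)`: after `shift₁₃ ^ N₂` both summands are nilpotent on
    -- `P n`, so `N₁ + r` further factors suffice.
    rw [pow_add, Module.End.mul_apply]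
    nth_rewrite 1 [shift₁₃_eq]
    exact add_pow_apply_eq_zero commute_shift₁₂_shift₂₃ hq h23'
  rw [hP]
  funext i k
  rw [← shift₁₃_pow, hzero]
  rfl

end Dong

/-! ### The commutator formula for products with a third field -/

section Comm

variable {W : Type*} [AddCommGroup W] [Module ℂ W]

theorem EvZero₂.evZero {F : ℕ → ℕ → W} (h : EvZero₂ F) : EvZero fun i => ∑ᶠ j, F i j := by
  obtain ⟨K, hK⟩ := h
  exact ⟨K, fun i hi => finsum_eq_zero_of_forall_eq_zero fun j => hK i j (Or.inl hi)⟩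

theorem evZero₂_inner (A B C : VertexOperator ℂ W) (n m k : ℤ) (w : W) :
    EvZero₂ fun i j : ℕ => (A[[n - i]]) ((B[[m - j]]) ((C[[k + (i + j)]]) w)) := by
  refine EvZero₂.of_add (mode_evZero C w k) fun i j h => ?_
  rw [Nat.cast_add] at h
  rw [h, map_zero, map_zero]

theorem evZero₂_mixed (A B C : VertexOperator ℂ W) (n k : ℤ) (w : W) :
    EvZero₂ fun i j : ℕ => (A[[n - i]]) ((C[[k + i - j]]) ((B[[(j : ℤ)]]) w)) := by
  obtain ⟨K, hK⟩ := mode_evZero' B w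
  refine EvZero₂.of_right ⟨K, fun i j hj => ?_⟩ fun j => ?_
  · have := hK j hj
    simp only at this
    rw [this, map_zero, map_zero]
  · have e : ∀ i : ℕ, k + (i : ℤ) - j = k - j + i := fun i => by ring
    simp only [e]
    exact mode_comp_evZero A C _ _ _

theorem evZero₂_outer (A B C : VertexOperator ℂ W) (k : ℤ) (w : W) :
    EvZero₂ fun i j : ℕ => (C[[k - (i + j)]]) ((B[[(j : ℤ)]]) ((A[[(i : ℤ)]]) w)) := by
  obtain ⟨K, hK⟩ := mode_evZero' A w
  refine EvZero₂.of_left ⟨K, fun i j hi => ?_⟩ fun i => ?_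
  · have := hK i hi
    simp only at this
    rw [this, map_zero, map_zero]
  · exact (mode_evZero' B _).map fun j : ℕ => C[[k - (i + j)]]

/-- The four double sums are the orderings `ABC`, `ACB`, `BCA`, `CBA`. In the commutator of two such
products the mixed ones cancel. -/
theorem nthProd_nthProd_mode (α θ : ℂ) (A B C : VertexOperator ℂ W) (n m k : ℤ) (w : W) :
    ((nthProd α A n (nthProd θ B m C))[[k]]) w
      = ∑ᶠ i : ℕ, ∑ᶠ j : ℕ, (sgnChoose n i * sgnChoose m j) •
          (A[[n - i]]) ((B[[m - j]]) ((C[[k + (i + j)]]) w))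
      - (θ * (-1 : ℂ) ^ m) • ∑ᶠ i : ℕ, ∑ᶠ j : ℕ, (sgnChoose n i * sgnChoose m j) •
          (A[[n - i]]) ((C[[m + k + i - j]]) ((B[[(j : ℤ)]]) w))
      - (α * (-1 : ℂ) ^ n) • ∑ᶠ i : ℕ, ∑ᶠ j : ℕ, (sgnChoose n i * sgnChoose m j) •
          (B[[m - j]]) ((C[[n + k + j - i]]) ((A[[(i : ℤ)]]) w))
      + (α * θ * (-1 : ℂ) ^ n * (-1 : ℂ) ^ m) • ∑ᶠ i : ℕ, ∑ᶠ j : ℕ,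
          (sgnChoose n i * sgnChoose m j) •
          (C[[n + m + k - (i + j)]]) ((B[[(j : ℤ)]]) ((A[[(i : ℤ)]]) w)) := by
  have h1 := evZero₂_inner A B C n m k w
  have h2 := evZero₂_mixed A B C n (m + k) w
  have h3 := (evZero₂_mixed B A C m (n + k) w).swap
  have h4 := evZero₂_outer A B C (n + m + k) w
  rw [nthProd_mode]
  have e1 : ∀ i : ℕ, sgnChoose n i • (A[[n - i]]) (((nthProd θ B m C)[[k + i]]) w)
      = (∑ᶠ j : ℕ, (sgnChoose n i * sgnChoose m j) •
          (A[[n - i]]) ((B[[m - j]]) ((C[[k + (i + j)]]) w)))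
      - (θ * (-1 : ℂ) ^ m) • (∑ᶠ j : ℕ, (sgnChoose n i * sgnChoose m j) •
          (A[[n - i]]) ((C[[m + k + i - j]]) ((B[[(j : ℤ)]]) w))) := by
    intro i
    rw [nthProd_mode, map_sub, map_smul,
      ((mode_comp_evZero B C w (k + i) fun j => m - j).smul _).map_finsum,
      (((mode_evZero' B w).map fun j : ℕ => C[[m + (k + i) - j]]).smul _).map_finsum, smul_sub,
      smul_comm, smul_finsum, smul_finsum]
    simp only [map_smul, smul_smul, add_assoc]
  have e2 : ∀ i : ℕ, sgnChoose n i • ((nthProd θ B m C)[[n + k - i]]) ((A[[(i : ℤ)]]) w)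
      = (∑ᶠ j : ℕ, (sgnChoose n i * sgnChoose m j) •
          (B[[m - j]]) ((C[[n + k + j - i]]) ((A[[(i : ℤ)]]) w)))
      - (θ * (-1 : ℂ) ^ m) • (∑ᶠ j : ℕ, (sgnChoose n i * sgnChoose m j) •
          (C[[n + m + k - (i + j)]]) ((B[[(j : ℤ)]]) ((A[[(i : ℤ)]]) w))) := by
    intro i
    have f1 : ∀ j : ℕ, n + k - i + (j : ℤ) = n + k + j - i := fun j => by ring
    have f2 : ∀ j : ℕ, m + (n + k - i) - (j : ℤ) = n + m + k - (i + j) := fun j => by ring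
    rw [nthProd_mode, smul_sub, smul_comm, smul_finsum, smul_finsum]
    simp only [smul_smul, f1, f2]
  rw [finsum_congr e1, finsum_congr e2,
    EvZero.finsum_sub (h1.smul _).evZero ((h2.smul _).evZero.smul fun _ => _),
    EvZero.finsum_sub (h3.smul _).evZero ((h4.smul _).evZero.smul fun _ => _),
    ← smul_finsum, ← smul_finsum]
  module

/-- The Borcherds commutator formula at the level of fields. `Z` is any finite family describing the
mode commutators of `A` and `B`, which spares identifying it with the products `A_(s) B`. -/
theorem nthProd_comm {ε η θ : ℂ} (hε : ε * ε = 1) {A B : VertexOperator ℂ W}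
    {Z : ℕ → VertexOperator ℂ W} {S : ℕ}
    (hZ : ∀ (i j : ℤ) (w : W), (A[[i]]) ((B[[j]]) w) - ε • (B[[j]]) ((A[[i]]) w)
      = ∑ s ∈ Finset.range S, intChoose i s • ((Z s)[[i + j - s]]) w)
    (C : VertexOperator ℂ W) (n m : ℤ) :
    nthProd (ε * η) A n (nthProd θ B m C) - ε • nthProd (ε * θ) B m (nthProd η A n C)
      = ∑ s ∈ Finset.range S, intChoose n s • nthProd (η * θ) (Z s) (n + m - s) C := by
  refine field_ext fun k w => ?_
  rw [mode_sub, mode_smul, mode_sum, nthProd_nthProd_mode, nthProd_nthProd_mode]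
  rw [((evZero₂_inner B A C m n k w).smul fun i j => sgnChoose m i * sgnChoose n j).comm,
    ((evZero₂_mixed B A C m (n + k) w).smul fun i j => sgnChoose m i * sgnChoose n j).comm,
    ((evZero₂_mixed A B C n (m + k) w).swap.smul fun i j => sgnChoose m i * sgnChoose n j).comm,
    ((evZero₂_outer B A C (m + n + k) w).smul fun i j => sgnChoose m i * sgnChoose n j).comm]
  -- Terms with `C` innermost: the commutator of `A_(n-i)` and `B_(m-j)` contributes `binom(n - i,
  -- s)`, and the Vandermonde convolution collapses `i` and `j` into `r = i + j`.
  have c1 : ∑ᶠ i : ℕ, ∑ᶠ j : ℕ, (sgnChoose n i * sgnChoose m j) •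
        (A[[n - i]]) ((B[[m - j]]) ((C[[k + (i + j)]]) w))
      - ε • ∑ᶠ j : ℕ, ∑ᶠ i : ℕ, (sgnChoose m i * sgnChoose n j) •
        (B[[m - i]]) ((A[[n - j]]) ((C[[k + (i + j)]]) w))
      = ∑ s ∈ Finset.range S, intChoose n s • ∑ᶠ r : ℕ, sgnChoose (n + m - s) r •
        ((Z s)[[n + m - s - r]]) ((C[[k + r]]) w) := by
    have hsw : ∀ i j : ℕ, (sgnChoose m j * sgnChoose n i) •
        (B[[m - j]]) ((A[[n - i]]) ((C[[k + (j + i)]]) w)) = (sgnChoose n i * sgnChoose m j) •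
        (B[[m - j]]) ((A[[n - i]]) ((C[[k + (i + j)]]) w)) := fun i j => by
      rw [mul_comm, add_comm (j : ℤ)]
    have hBA : EvZero₂ fun i j : ℕ => (sgnChoose n i * sgnChoose m j) •
        (B[[m - j]]) ((A[[n - i]]) ((C[[k + (i + j)]]) w)) := by
      simp only [← hsw]
      exact ((evZero₂_inner B A C m n k w).smul _).swap
    rw [sub_eq_add_neg, ← neg_smul, finsum_congr fun i => finsum_congr fun j => hsw i j,
      ← hBA.finsum_smul, ← ((evZero₂_inner A B C n m k w).smul _).finsum_add
        (hBA.smul fun _ _ => -ε)]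
    have hterm : ∀ i j : ℕ, (sgnChoose n i * sgnChoose m j) •
          (A[[n - i]]) ((B[[m - j]]) ((C[[k + (i + j)]]) w))
        + -ε • (sgnChoose n i * sgnChoose m j) •
          (B[[m - j]]) ((A[[n - i]]) ((C[[k + (i + j)]]) w))
        = ∑ s ∈ Finset.range S, intChoose n s • (sgnChoose (n - s) i * sgnChoose m j) •
          ((Z s)[[n + m - s - (i + j : ℕ)]]) ((C[[k + (i + j : ℕ)]]) w) := by
      intro i j
      rw [neg_smul, smul_comm ε, ← sub_eq_add_neg, ← smul_sub, hZ, Finset.smul_sum]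
      refine Finset.sum_congr rfl fun s _ => ?_
      have e : n - i + (m - j) - s = n + m - s - ((i + j : ℕ) : ℤ) := by push_cast; ring
      rw [e, smul_smul, smul_smul, Nat.cast_add]
      congr 1
      simp only [sgnChoose_eq]
      linear_combination ((-1) ^ i * (-1) ^ j * intChoose m j) * intChoose_mul_sub n i s
    rw [finsum_congr fun i => finsum_congr fun j => hterm i j]
    have hZC : ∀ s : ℕ, EvZero fun r : ℕ => ((Z s)[[n + m - s - r]]) ((C[[k + r]]) w) := fun s =>
      mode_comp_evZero (Z s) C w k fun r => n + m - s - r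
    have hZC₂ : ∀ s : ℕ, EvZero₂ fun i j : ℕ => (sgnChoose (n - s) i * sgnChoose m j) •
        ((Z s)[[n + m - s - (i + j : ℕ)]]) ((C[[k + (i + j : ℕ)]]) w) := fun s =>
      EvZero₂.smul (EvZero₂.of_add (hZC s) fun i j h => h) _
    rw [EvZero₂.finsum_sum _ fun s => (hZC₂ s).smul fun _ _ => _]
    refine Finset.sum_congr rfl fun s _ => ?_
    rw [(hZC₂ s).finsum_smul]
    have := (hZC s).finsum_vandermonde (n - s) m
    rw [this]
    have e : n - (s : ℤ) + m = n + m - s := by ring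
    rw [e]
  -- Terms with `C` outermost. The commutator now is of `A_(i)` and `B_(j)`, giving `binom(i, s)`.
  have c2 : ∑ᶠ i : ℕ, ∑ᶠ j : ℕ, (sgnChoose n i * sgnChoose m j) •
        (C[[n + m + k - (i + j)]]) ((A[[(i : ℤ)]]) ((B[[(j : ℤ)]]) w))
      - ε • ∑ᶠ i : ℕ, ∑ᶠ j : ℕ, (sgnChoose n i * sgnChoose m j) •
        (C[[n + m + k - (i + j)]]) ((B[[(j : ℤ)]]) ((A[[(i : ℤ)]]) w))
      = ∑ s ∈ Finset.range S, (intChoose n s * (-1) ^ s) • ∑ᶠ r : ℕ, sgnChoose (n + m - s) r •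
        (C[[n + m - s + k - r]]) (((Z s)[[(r : ℤ)]]) w) := by
    have hAB : EvZero₂ fun i j : ℕ =>
        (C[[n + m + k - (i + j)]]) ((A[[(i : ℤ)]]) ((B[[(j : ℤ)]]) w)) := by
      have := (evZero₂_outer B A C (n + m + k) w).swap
      simpa only [add_comm] using this
    have hBA := evZero₂_outer A B C (n + m + k) w
    rw [sub_eq_add_neg, ← neg_smul, ← (hBA.smul _).finsum_smul, ← (hAB.smul _).finsum_add
        ((hBA.smul _).smul fun _ _ => -ε)]
    let g : ℕ → ℕ → W := fun s r => (C[[n + m + k - r]]) (((Z s)[[-s + r]]) w)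
    have hg : ∀ s, EvZero (g s) := fun s =>
      (mode_evZero (Z s) w (-s)).map fun r : ℕ => C[[n + m + k - r]]
    have hG : ∀ s : ℕ, EvZero₂ fun i j : ℕ =>
        (sgnChoose n i * intChoose i s * sgnChoose m j) • g s (i + j) := fun s =>
      EvZero₂.smul (EvZero₂.of_add (hg s) fun i j h => h) _
    have hterm : ∀ i j : ℕ, (sgnChoose n i * sgnChoose m j) •
          (C[[n + m + k - (i + j)]]) ((A[[(i : ℤ)]]) ((B[[(j : ℤ)]]) w))
        + -ε • (sgnChoose n i * sgnChoose m j) •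
          (C[[n + m + k - (i + j)]]) ((B[[(j : ℤ)]]) ((A[[(i : ℤ)]]) w))
        = ∑ s ∈ Finset.range S,
          (sgnChoose n i * intChoose i s * sgnChoose m j) • g s (i + j) := by
      intro i j
      rw [neg_smul, smul_comm ε, ← sub_eq_add_neg, ← smul_sub, ← map_smul, ← map_sub, hZ, map_sum,
        Finset.smul_sum]
      refine Finset.sum_congr rfl fun s _ => ?_
      have e : (i : ℤ) + j - s = -s + (i + j : ℕ) := by push_cast; ring
      rw [map_smul, smul_smul, e, ← Nat.cast_add]
      congr 1
      ring
    rw [finsum_congr fun i => finsum_congr fun j => hterm i j, EvZero₂.finsum_sum _ hG]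
    refine Finset.sum_congr rfl fun s _ => ?_
    -- As `binom(i, s) = 0` for `i < s`, the index `i` can be shifted by `s`; the shift produces the
    -- sign `(-1)^s`.
    rw [(hG s).evZero.finsum_shift (s := s) fun i hi => finsum_eq_zero_of_forall_eq_zero fun j => by
      rw [intChoose_natCast, Nat.choose_eq_zero_of_lt hi, Nat.cast_zero, mul_zero, zero_mul,
        zero_smul] ]
    have hterm' : ∀ i j : ℕ,
        (sgnChoose n (i + s) * intChoose (i + s : ℕ) s * sgnChoose m j) • g s (i + s + j)
        = (intChoose n s * (-1) ^ s) • (sgnChoose (n - s) i * sgnChoose m j) •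
          g s (s + (i + j)) := by
      intro i j
      have e : i + s + j = s + (i + j) := by omega
      rw [smul_smul, e]
      congr 1
      simp only [sgnChoose_eq, pow_add]
      linear_combination ((-1) ^ i * (-1) ^ s * (-1) ^ j * intChoose m j) * intChoose_mul n i s
    rw [finsum_congr fun i => finsum_congr fun j => hterm' i j]
    have hgs : EvZero fun r => g s (s + r) := by simpa only [add_comm] using (hg s).shift s
    rw [(EvZero₂.smul (EvZero₂.of_add hgs fun i j h => h) _).finsum_smul]
    congr 1
    rw [hgs.finsum_vandermonde (n - s) m]
    refine finsum_congr fun r => ?_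
    have e1 : n - (s : ℤ) + m = n + m - s := by ring
    have e2 : n + m + k - ((s + r : ℕ) : ℤ) = n + m - s + k - r := by push_cast; ring
    have e3 : -(s : ℤ) + ((s + r : ℕ) : ℤ) = r := by push_cast; ring
    simp only [g, e1, e2, e3]
  have c3 : ∀ s : ℕ, ((nthProd (η * θ) (Z s) (n + m - s) C)[[k]]) w
      = ∑ᶠ r : ℕ, sgnChoose (n + m - s) r • ((Z s)[[n + m - s - r]]) ((C[[k + r]]) w)
        - (η * θ * (-1 : ℂ) ^ n * (-1 : ℂ) ^ m * (-1) ^ s) • ∑ᶠ r : ℕ, sgnChoose (n + m - s) r •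
          (C[[n + m - s + k - r]]) (((Z s)[[(r : ℤ)]]) w) := by
    intro s
    have hs : (-1 : ℂ) ^ (n + m - s) = (-1 : ℂ) ^ n * (-1 : ℂ) ^ m * (-1) ^ s := by
      rw [zpow_sub₀ (by norm_num), zpow_add₀ (by norm_num), zpow_natCast, div_eq_mul_inv, ← inv_pow]
      norm_num
    rw [nthProd_mode, hs]
    simp only [mul_assoc]
  simp only [mode_smul, c3, smul_sub, Finset.sum_sub_distrib]
  rw [← c1]
  have c2' := congrArg (fun x => (η * θ * (-1 : ℂ) ^ n * (-1 : ℂ) ^ m) • x) c2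
  simp only [Finset.smul_sum, smul_smul] at c2'
  simp only [smul_smul]
  have c2'' : ∑ s ∈ Finset.range S, (intChoose n s * (η * θ * (-1 : ℂ) ^ n * (-1 : ℂ) ^ m * (-1) ^ s)) •
      ∑ᶠ r : ℕ, sgnChoose (n + m - s) r • (C[[n + m - s + k - r]]) (((Z s)[[(r : ℤ)]]) w)
      = (η * θ * (-1 : ℂ) ^ n * (-1 : ℂ) ^ m) • (∑ᶠ i : ℕ, ∑ᶠ j : ℕ, (sgnChoose n i * sgnChoose m j) •
        (C[[n + m + k - (i + j)]]) ((A[[(i : ℤ)]]) ((B[[(j : ℤ)]]) w))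
      - ε • ∑ᶠ i : ℕ, ∑ᶠ j : ℕ, (sgnChoose n i * sgnChoose m j) •
        (C[[n + m + k - (i + j)]]) ((B[[(j : ℤ)]]) ((A[[(i : ℤ)]]) w))) := by
    rw [c2']
    refine Finset.sum_congr rfl fun s _ => ?_
    congr 1
    ring
  rw [c2'']
  have s1 : ∀ i j : ℕ, (sgnChoose m j * sgnChoose n i) •
      (A[[n - i]]) ((C[[m + k + i - j]]) ((B[[(j : ℤ)]]) w))
      = (sgnChoose n i * sgnChoose m j) •
      (A[[n - i]]) ((C[[m + k + i - j]]) ((B[[(j : ℤ)]]) w)) := fun i j => by rw [mul_comm]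
  have s2 : ∀ i j : ℕ, (sgnChoose m j * sgnChoose n i) •
      (B[[m - j]]) ((C[[n + k + j - i]]) ((A[[(i : ℤ)]]) w))
      = (sgnChoose n i * sgnChoose m j) •
      (B[[m - j]]) ((C[[n + k + j - i]]) ((A[[(i : ℤ)]]) w)) := fun i j => by rw [mul_comm]
  have s3 : ∀ i j : ℕ, (sgnChoose m j * sgnChoose n i) •
      (C[[m + n + k - (j + i)]]) ((A[[(i : ℤ)]]) ((B[[(j : ℤ)]]) w))
      = (sgnChoose n i * sgnChoose m j) •
      (C[[n + m + k - (i + j)]]) ((A[[(i : ℤ)]]) ((B[[(j : ℤ)]]) w)) := fun i j => by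
    rw [mul_comm, add_comm (j : ℤ), add_comm m]
  rw [finsum_congr fun i => finsum_congr fun j => s1 i j,
    finsum_congr fun i => finsum_congr fun j => s2 i j,
    finsum_congr fun i => finsum_congr fun j => s3 i j]
  generalize (∑ᶠ i : ℕ, ∑ᶠ j : ℕ, (sgnChoose n i * sgnChoose m j) •
      (C[[n + m + k - (i + j)]]) ((A[[(i : ℤ)]]) ((B[[(j : ℤ)]]) w))) = X1
  generalize (∑ᶠ i : ℕ, ∑ᶠ j : ℕ, (sgnChoose n i * sgnChoose m j) •
      (C[[n + m + k - (i + j)]]) ((B[[(j : ℤ)]]) ((A[[(i : ℤ)]]) w))) = X2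
  generalize (∑ᶠ i : ℕ, ∑ᶠ j : ℕ, (sgnChoose n i * sgnChoose m j) •
      (A[[n - i]]) ((C[[m + k + i - j]]) ((B[[(j : ℤ)]]) w))) = X3
  generalize (∑ᶠ i : ℕ, ∑ᶠ j : ℕ, (sgnChoose n i * sgnChoose m j) •
      (B[[m - j]]) ((C[[n + k + j - i]]) ((A[[(i : ℤ)]]) w))) = X4
  match_scalars <;> try ring1
  -- The coefficients of the mixed terms `ACB` and `BCA`, which cancel because `ε² = 1`.
  · linear_combination (θ * (-1) ^ m) * hε
  · linear_combination -(θ * η * (-1) ^ m * (-1) ^ n) * hε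

end Comm

/-! ### Signs -/

theorem koszul_mul_self (p q : ZMod 2) : koszul p q * koszul p q = 1 := by
  unfold koszul
  split_ifs <;> norm_num

theorem koszul_comm (p q : ZMod 2) : koszul p q = koszul q p := by
  unfold koszul
  simp only [and_comm]

theorem koszul_add_right (p q r : ZMod 2) : koszul p (q + r) = koszul p q * koszul p r := by
  have h : ∀ x : ZMod 2, x = 0 ∨ x = 1 := by decide
  have h2 : (1 : ZMod 2) + 1 = 0 := by decide
  unfold koszul
  rcases h p with rfl | rfl <;> rcases h q with rfl | rfl <;> rcases h r with rfl | rfl <;>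
    simp [h2]

theorem koszul_add_left (p q r : ZMod 2) : koszul (p + q) r = koszul p r * koszul q r := by
  rw [koszul_comm, koszul_add_right, koszul_comm r, koszul_comm r]

@[simp] theorem koszul_zero_right (p : ZMod 2) : koszul p 0 = 1 := by simp [koszul]

@[simp] theorem koszul_zero_left (p : ZMod 2) : koszul 0 p = 1 := by simp [koszul]

@[simp] theorem koszul_one_one : koszul 1 1 = -1 := by simp [koszul]

/-! ### Linearity of the products -/

section Linearity

variable {W : Type*} [AddCommGroup W] [Module ℂ W]

theorem nthProd_add_right (ε : ℂ) (A B C : VertexOperator ℂ W) (n : ℤ) :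
    nthProd ε A n (B + C) = nthProd ε A n B + nthProd ε A n C := by
  refine field_ext fun k w => ?_
  simp only [mode_add, nthProd_mode]
  simp only [map_add, smul_add]
  rw [EvZero.finsum_add ((mode_comp_evZero A B w k _).smul _)
      ((mode_comp_evZero A C w k _).smul _),
    EvZero.finsum_add (((mode_evZero' A w).map fun j : ℕ => B[[n + k - j]]).smul _)
      (((mode_evZero' A w).map fun j : ℕ => C[[n + k - j]]).smul _)]
  module

theorem nthProd_smul_right (ε c : ℂ) (A B : VertexOperator ℂ W) (n : ℤ) :
    nthProd ε A n (c • B) = c • nthProd ε A n B := by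
  refine field_ext fun k w => ?_
  simp only [mode_smul, nthProd_mode]
  simp only [map_smul, smul_comm _ c]
  rw [← smul_finsum, ← smul_finsum]
  module

theorem nthProd_add_left (ε : ℂ) (A B C : VertexOperator ℂ W) (n : ℤ) :
    nthProd ε (A + B) n C = nthProd ε A n C + nthProd ε B n C := by
  refine field_ext fun k w => ?_
  simp only [mode_add, nthProd_mode]
  simp only [map_add, smul_add]
  rw [EvZero.finsum_add ((mode_comp_evZero A C w k _).smul _)
      ((mode_comp_evZero B C w k _).smul _),
    EvZero.finsum_add (((mode_evZero' A w).map fun j : ℕ => C[[n + k - j]]).smul _)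
      (((mode_evZero' B w).map fun j : ℕ => C[[n + k - j]]).smul _)]
  module

theorem nthProd_smul_left (ε c : ℂ) (A B : VertexOperator ℂ W) (n : ℤ) :
    nthProd ε (c • A) n B = c • nthProd ε A n B := by
  refine field_ext fun k w => ?_
  simp only [mode_smul, nthProd_mode]
  simp only [map_smul, smul_comm _ c]
  rw [← smul_finsum, ← smul_finsum]
  module

/-- The linear map `B ↦ A_(n) B`. -/
def nthProdRight (ε : ℂ) (A : VertexOperator ℂ W) (n : ℤ) :
    VertexOperator ℂ W →ₗ[ℂ] VertexOperator ℂ W where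
  toFun := nthProd ε A n
  map_add' B C := nthProd_add_right ε A B C n
  map_smul' c B := nthProd_smul_right ε c A B n

/-- The linear map `A ↦ A_(n) B`. -/
def nthProdLeft (ε : ℂ) (n : ℤ) (B : VertexOperator ℂ W) :
    VertexOperator ℂ W →ₗ[ℂ] VertexOperator ℂ W where
  toFun A := nthProd ε A n B
  map_add' A A' := nthProd_add_left ε A A' B n
  map_smul' c A := nthProd_smul_left ε c A B n

theorem nthProd_zero_right (ε : ℂ) (A : VertexOperator ℂ W) (n : ℤ) : nthProd ε A n 0 = 0 :=
  map_zero (nthProdRight ε A n)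

theorem nthProd_zero_left (ε : ℂ) (A : VertexOperator ℂ W) (n : ℤ) : nthProd ε 0 n A = 0 :=
  map_zero (nthProdLeft ε n A)

theorem nthProd_neg_right (ε : ℂ) (A B : VertexOperator ℂ W) (n : ℤ) :
    nthProd ε A n (-B) = -nthProd ε A n B := map_neg (nthProdRight ε A n) B

theorem nthProd_neg_left (ε : ℂ) (A B : VertexOperator ℂ W) (n : ℤ) :
    nthProd ε (-A) n B = -nthProd ε A n B := map_neg (nthProdLeft ε n B) A

theorem nthProd_sum_left {ι : Type*} (s : Finset ι) (ε : ℂ) (A : ι → VertexOperator ℂ W)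
    (B : VertexOperator ℂ W) (n : ℤ) :
    nthProd ε (∑ i ∈ s, A i) n B = ∑ i ∈ s, nthProd ε (A i) n B :=
  map_sum (nthProdLeft ε n B) A s

/-- A subspace stable under the modes of two fields is stable under the modes of their products. -/
theorem nthProd_mem {ε : ℂ} {A B : VertexOperator ℂ W} {S : Submodule ℂ W}
    (hA : ∀ n, ∀ w ∈ S, (A[[n]]) w ∈ S) (hB : ∀ n, ∀ w ∈ S, (B[[n]]) w ∈ S) (m n : ℤ) {w : W}
    (hw : w ∈ S) : ((nthProd ε A m B)[[n]]) w ∈ S := by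
  rw [nthProd_mode]
  refine S.sub_mem ?_ (S.smul_mem _ ?_)
  · exact finsum_induction (· ∈ S) S.zero_mem (fun _ _ => S.add_mem) fun j =>
      S.smul_mem _ (hA _ _ (hB _ _ hw))
  · exact finsum_induction (· ∈ S) S.zero_mem (fun _ _ => S.add_mem) fun j =>
      S.smul_mem _ (hB _ _ (hA _ _ hw))

end Linearity

/-! ### Closure properties of locality -/

section LocalClosure

variable {W : Type*} [AddCommGroup W] [Module ℂ W]

theorem delta₁₂_pow_eq_zero_of_le {f : ℤ → ℤ → W} {N M : ℕ} (h : (delta₁₂ W ^ N) f = 0)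
    (hNM : N ≤ M) : (delta₁₂ W ^ M) f = 0 := by
  rw [← Nat.sub_add_cancel hNM, pow_add, Module.End.mul_apply, h, map_zero]

theorem local_zero_left (ε : ℂ) (B : VertexOperator ℂ W) : Local ε 0 B :=
  ⟨0, fun m k w => by rw [Nat.cast_zero, jac_zero]; simp⟩

theorem Local.add_left {ε : ℂ} {A A' B : VertexOperator ℂ W} (h : Local ε A B)
    (h' : Local ε A' B) : Local ε (A + A') B := by
  obtain ⟨N, hN⟩ := local_iff.1 h
  obtain ⟨N', hN'⟩ := local_iff.1 h'
  refine local_iff.2 ⟨max N N', fun w => ?_⟩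
  have e : (fun m k => ((A + A')[[m]]) ((B[[k]]) w) - ε • (B[[k]]) (((A + A')[[m]]) w))
      = (fun m k => (A[[m]]) ((B[[k]]) w) - ε • (B[[k]]) ((A[[m]]) w))
        + fun m k => (A'[[m]]) ((B[[k]]) w) - ε • (B[[k]]) ((A'[[m]]) w) := by
    funext m k
    simp only [mode_add, Pi.add_apply]
    simp only [map_add]
    module
  rw [e, map_add, delta₁₂_pow_eq_zero_of_le (hN w) (le_max_left _ _),
    delta₁₂_pow_eq_zero_of_le (hN' w) (le_max_right _ _), add_zero]

theorem Local.smul_left {ε : ℂ} {A B : VertexOperator ℂ W} (h : Local ε A B) (c : ℂ) :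
    Local ε (c • A) B := by
  obtain ⟨N, hN⟩ := local_iff.1 h
  refine local_iff.2 ⟨N, fun w => ?_⟩
  have e : (fun m k => ((c • A)[[m]]) ((B[[k]]) w) - ε • (B[[k]]) (((c • A)[[m]]) w))
      = c • fun m k => (A[[m]]) ((B[[k]]) w) - ε • (B[[k]]) ((A[[m]]) w) := by
    funext m k
    simp only [mode_smul, Pi.smul_apply]
    simp only [map_smul]
    module
  rw [e, map_smul, hN, smul_zero]

theorem delta₁₂_pow_swap (N : ℕ) (f : ℤ → ℤ → W) (m k : ℤ) :
    (delta₁₂ W ^ N) (fun m k => f k m) m k = (-1 : ℂ) ^ N • (delta₁₂ W ^ N) f k m := by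
  induction N generalizing f with
  | zero => simp
  | succ N ih =>
    have h : delta₁₂ W (fun m k => f k m) = -fun m k => delta₁₂ W f k m := by
      funext m k
      exact (neg_sub _ _).symm
    rw [pow_succ, Module.End.mul_apply, Module.End.mul_apply, h, map_neg, Pi.neg_apply,
      Pi.neg_apply, ih, pow_succ]
    module

theorem Local.symm {ε : ℂ} (hε : ε * ε = 1) {A B : VertexOperator ℂ W} (h : Local ε A B) :
    Local ε B A := by
  obtain ⟨N, hN⟩ := local_iff.1 h
  refine local_iff.2 ⟨N, fun w => ?_⟩
  have e : (fun m k => (B[[m]]) ((A[[k]]) w) - ε • (A[[k]]) ((B[[m]]) w))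
      = (-ε) • fun m k => (fun k m => (A[[k]]) ((B[[m]]) w) - ε • (B[[m]]) ((A[[k]]) w)) k m := by
    funext m k
    simp only [Pi.smul_apply, smul_sub, smul_smul, neg_mul, hε]
    module
  rw [e, map_smul]
  funext m k
  rw [Pi.smul_apply, Pi.smul_apply, delta₁₂_pow_swap, hN]
  simp

theorem local_id_right (A : VertexOperator ℂ W) : Local 1 A (idField W) :=
  ⟨0, fun m k w => by
    rw [Nat.cast_zero, jac_zero, idField_mode, idField_mode]
    split_ifs <;> simp⟩

end LocalClosure

/-! ### Products with the identity field and derivatives -/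

section Derivative

variable {W : Type*} [AddCommGroup W] [Module ℂ W]

theorem nthProd_id_of_nonneg (A : VertexOperator ℂ W) {n : ℤ} (hn : 0 ≤ n) :
    nthProd 1 A n (idField W) = 0 := by
  refine field_ext fun k w => ?_
  rw [nthProd_mode_eq_jac, mode_zero]
  refine jac_eq_zero_of_le (N := 0) (fun m k w => ?_) hn _ _ _
  rw [jac_zero, idField_mode, idField_mode]
  split_ifs <;> simp

theorem nthProd_neg_one_mode (ε : ℂ) (A B : VertexOperator ℂ W) (k : ℤ) (w : W) :
    ((nthProd ε A (-1) B)[[k]]) w = ∑ᶠ j : ℕ, (A[[-1 - j]]) ((B[[k + j]]) w)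
      + ε • ∑ᶠ j : ℕ, (B[[k - 1 - j]]) ((A[[(j : ℤ)]]) w) := by
  have e : ∀ j : ℕ, -1 + k - (j : ℤ) = k - 1 - j := fun j => by ring
  rw [nthProd_mode]
  simp only [sgnChoose_neg_one, one_smul, e]
  rw [zpow_neg_one, sub_eq_add_neg, ← neg_smul]
  norm_num

/-- Exactly one of the two half-infinite sums sees the only nonzero mode of the identity field,
depending on the sign of `k`. -/
theorem nthProd_neg_one_id (A : VertexOperator ℂ W) : nthProd 1 A (-1) (idField W) = A := by
  refine field_ext fun k w => ?_
  rw [nthProd_neg_one_mode, one_smul]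
  simp only [idField_mode]
  by_cases hk : 0 ≤ k
  · rw [finsum_eq_zero_of_forall_eq_zero fun j : ℕ => by rw [if_neg (by omega), map_zero],
      finsum_eq_single _ k.toNat fun j hj => if_neg (by omega), if_pos (by omega), zero_add,
      Int.toNat_of_nonneg hk]
  · rw [finsum_eq_single _ (-1 - k).toNat fun j hj => by rw [if_neg (by omega), map_zero],
      finsum_eq_zero_of_forall_eq_zero fun j : ℕ => if_neg (by omega), if_pos (by omega), add_zero]
    have e : -1 - ((-1 - k).toNat : ℤ) = k := by omega
    rw [e]

theorem id_nthProd (B : VertexOperator ℂ W) (n : ℤ) :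
    nthProd 1 (idField W) n B = if n = -1 then B else 0 := by
  refine field_ext fun k w => ?_
  split_ifs with hn
  · subst hn
    rw [nthProd_neg_one_mode]
    simp only [idField_mode]
    rw [finsum_single_zero fun j hj => if_neg (by omega),
      finsum_eq_zero_of_forall_eq_zero fun j : ℕ => by rw [if_neg (by omega), map_zero] ]
    simp
  · rw [nthProd_mode_eq_jac, mode_zero]
    by_cases h : 0 ≤ n
    · refine jac_eq_zero_of_le (N := 0) (fun m k w => ?_) h _ _ _
      rw [jac_zero, idField_mode, idField_mode]
      split_ifs <;> simp
    · rw [jac]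
      simp only [idField_mode]
      rw [finsum_eq_zero_of_forall_eq_zero fun j : ℕ => by rw [if_neg (by omega), smul_zero],
        finsum_eq_zero_of_forall_eq_zero fun j : ℕ => by
          rw [if_neg (by omega), map_zero, smul_zero] ]
      simp

/-- The derivative of a field. -/
def derivField (A : VertexOperator ℂ W) : VertexOperator ℂ W :=
  mkField (fun n => (-n : ℂ) • A[[n - 1]]) fun w => by
    obtain ⟨N, hN⟩ := field_trunc A w
    exact ⟨N + 1, fun n hn => by rw [LinearMap.smul_apply, hN _ (by omega), smul_zero]⟩

theorem derivField_mode (A : VertexOperator ℂ W) (n : ℤ) (w : W) :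
    ((derivField A)[[n]]) w = (-n : ℂ) • (A[[n - 1]]) w := by
  rw [derivField, mkField_mode]
  rfl

theorem derivField_id : derivField (idField W) = 0 := by
  refine field_ext fun k w => ?_
  rw [derivField_mode, idField_mode, mode_zero]
  split_ifs with h
  · have : k = 0 := by omega
    simp [this]
  · simp

theorem sub_mul_sgnChoose (n : ℤ) (j : ℕ) :
    ((n : ℂ) - j) * sgnChoose n j = n * sgnChoose (n - 1) j := by
  simp only [sgnChoose_eq]
  linear_combination (-1) ^ j * sub_mul_intChoose n j

theorem succ_mul_sgnChoose (n : ℤ) (j : ℕ) :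
    ((j : ℂ) + 1) * sgnChoose n (j + 1) = -n * sgnChoose (n - 1) j := by
  simp only [sgnChoose_eq, pow_succ]
  linear_combination -(-1) ^ j * succ_mul_intChoose n j

/-- `∑_j j (-1)^j binom(n, j) f j = -n ∑_j (-1)^j binom(n - 1, j) f (j + 1)`. -/
theorem EvZero.finsum_mul_sgnChoose {f : ℕ → W} (h : EvZero f) (n : ℤ) :
    ∑ᶠ j : ℕ, ((j : ℂ) * sgnChoose n j) • f j
      = (-n : ℂ) • ∑ᶠ j : ℕ, sgnChoose (n - 1) j • f (j + 1) := by
  rw [(h.smul _).finsum_succ, smul_finsum]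
  simp only [Nat.cast_zero, zero_mul, zero_smul, zero_add, Nat.cast_succ, succ_mul_sgnChoose,
    mul_smul]

/-- Both halves reduce to absorption identities for binomial coefficients: `(n - j) binom(n, j)` in
the first, `j binom(n, j)` in the second. -/
theorem nthProd_derivField_left (ε : ℂ) (A B : VertexOperator ℂ W) (n : ℤ) :
    nthProd ε (derivField A) n B = (-n : ℂ) • nthProd ε A (n - 1) B := by
  refine field_ext fun k w => ?_
  rw [mode_smul, nthProd_mode, nthProd_mode]
  simp only [derivField_mode]
  have e1 : ∀ j : ℕ, sgnChoose n j • (-((n - j : ℤ) : ℂ)) • (A[[n - j - 1]]) ((B[[k + j]]) w)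
      = (-n : ℂ) • sgnChoose (n - 1) j • (A[[n - 1 - j]]) ((B[[k + j]]) w) := by
    intro j
    have h := sub_mul_sgnChoose n j
    have e : n - j - 1 = n - 1 - (j : ℤ) := by ring
    rw [smul_smul, smul_smul, e]
    congr 1
    push_cast
    linear_combination -h
  have e2 : ∀ j : ℕ, sgnChoose n j • (B[[n + k - j]]) ((-((j : ℤ) : ℂ)) • (A[[(j : ℤ) - 1]]) w)
      = (-1 : ℂ) • ((j : ℂ) * sgnChoose n j) • (B[[n + k - j]]) ((A[[-1 + (j : ℤ)]]) w) := by
    intro j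
    rw [map_smul, smul_smul, smul_smul, sub_eq_neg_add]
    congr 1
    push_cast
    ring
  rw [finsum_congr e1, finsum_congr e2, ← smul_finsum, ← smul_finsum,
    ((mode_evZero A w (-1)).map fun j : ℕ => B[[n + k - j]]).finsum_mul_sgnChoose n]
  have e3 : ∀ j : ℕ, n + k - ((j + 1 : ℕ) : ℤ) = n - 1 + k - j := fun j => by push_cast; ring
  have e4 : ∀ j : ℕ, -1 + ((j + 1 : ℕ) : ℤ) = j := fun j => by push_cast; ring
  simp only [e3, e4]
  rw [zpow_sub_one₀ (by norm_num : (-1 : ℂ) ≠ 0)]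
  module

theorem derivField_nthProd (ε : ℂ) (A B : VertexOperator ℂ W) (n : ℤ) :
    derivField (nthProd ε A n B)
      = nthProd ε (derivField A) n B + nthProd ε A n (derivField B) := by
  rw [nthProd_derivField_left]
  refine field_ext fun k w => ?_
  rw [mode_add, mode_smul, derivField_mode, nthProd_mode, nthProd_mode, nthProd_mode]
  simp only [derivField_mode]
  have e1 : ∀ j : ℕ, sgnChoose n j • (A[[n - j]]) ((-((k + j : ℤ) : ℂ)) • (B[[k + j - 1]]) w)
      = (-k : ℂ) • sgnChoose n j • (A[[n - j]]) ((B[[k - 1 + j]]) w)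
        - ((j : ℂ) * sgnChoose n j) • (A[[n - j]]) ((B[[k - 1 + j]]) w) := by
    intro j
    have e : k + j - 1 = k - 1 + (j : ℤ) := by ring
    rw [map_smul, e]
    push_cast
    module
  have e2 : ∀ j : ℕ, sgnChoose n j • (-((n + k - j : ℤ) : ℂ)) •
        (B[[n + k - j - 1]]) ((A[[(j : ℤ)]]) w)
      = (-k : ℂ) • sgnChoose n j • (B[[n + (k - 1) - j]]) ((A[[(j : ℤ)]]) w)
        - (n : ℂ) • sgnChoose (n - 1) j • (B[[n - 1 + k - j]]) ((A[[(j : ℤ)]]) w) := by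
    intro j
    have h := sub_mul_sgnChoose n j
    have e : n + k - j - 1 = n + (k - 1) - (j : ℤ) := by ring
    have e' : n - 1 + k - (j : ℤ) = n + (k - 1) - (j : ℤ) := by ring
    rw [e, e', smul_smul, smul_smul, smul_smul, ← sub_smul]
    congr 1
    push_cast
    linear_combination -h
  have v1 := mode_comp_evZero A B w (k - 1) fun j => n - j
  have v2 := (mode_evZero' A w).map fun j : ℕ => B[[n + (k - 1) - j]]
  have v3 := (mode_evZero' A w).map fun j : ℕ => B[[n - 1 + k - j]]
  rw [finsum_congr e1, finsum_congr e2,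
    EvZero.finsum_sub ((v1.smul _).smul fun _ => _) (v1.smul _),
    EvZero.finsum_sub ((v2.smul _).smul fun _ => _) ((v3.smul _).smul fun _ => _),
    ← smul_finsum, ← smul_finsum, ← smul_finsum, v1.finsum_mul_sgnChoose n]
  have e3 : ∀ j : ℕ, n - ((j + 1 : ℕ) : ℤ) = n - 1 - j := fun j => by push_cast; ring
  have e4 : ∀ j : ℕ, k - 1 + ((j + 1 : ℕ) : ℤ) = k + j := fun j => by push_cast; ring
  simp only [e3, e4]
  rw [zpow_sub_one₀ (by norm_num : (-1 : ℂ) ≠ 0)]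
  module

end Derivative

/-! ### Operator product expansions with poles of order at most three -/

section OPE

variable {W : Type*} [AddCommGroup W] [Module ℂ W]

/-- The commutator `[A_(i), B_(j)] = P_(i+j) + i Q_(i+j-1) + binom(i, 2) R_(i+j-2)`. -/
def OPE (ε : ℂ) (A B P Q R : VertexOperator ℂ W) : Prop :=
  ∀ (i j : ℤ) (w : W), (A[[i]]) ((B[[j]]) w) - ε • (B[[j]]) ((A[[i]]) w)
    = (P[[i + j]]) w + (i : ℂ) • (Q[[i + j - 1]]) w + intChoose i 2 • (R[[i + j - 2]]) w

variable {ε η θ : ℂ} {A B C P Q R P' Q' R' : VertexOperator ℂ W}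

/-- Each multiplication by `z₁ - z₂` lowers the pole order by one: first `P` disappears, then `Q`,
then `R`. This identifies the products of order `0`, `1`, `2` and gives locality of order three. -/
theorem OPE.jac_one (h : OPE ε A B P Q R) (m k : ℤ) (w : W) :
    jac ε A B 1 m k w = (Q[[m + k]]) w + (m : ℂ) • (R[[m + k - 1]]) w := by
  have h1 := jac_succ ε A B 0 m k w
  rw [zero_add, jac_zero, jac_zero, h, h] at h1
  have e1 : m + 1 + k = m + k + 1 := by ring
  have e2 : m + (k + 1) = m + k + 1 := by ring
  have e3 : m + k + 1 - 2 = m + k - 1 := by ring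
  rw [h1, e1, e2, e3, add_sub_cancel_right, intChoose_succ m 1]
  push_cast
  rw [intChoose_one_right]
  module

theorem OPE.jac_two (h : OPE ε A B P Q R) (m k : ℤ) (w : W) :
    jac ε A B 2 m k w = (R[[m + k]]) w := by
  have h1 := jac_succ ε A B 1 m k w
  rw [h.jac_one, h.jac_one] at h1
  have e1 : m + 1 + k = m + k + 1 := by ring
  have e2 : m + (k + 1) = m + k + 1 := by ring
  have e3 : (1 : ℤ) + 1 = 2 := rfl
  rw [← e3, h1, e1, e2, add_sub_cancel_right]
  push_cast
  module

theorem OPE.jac_three (h : OPE ε A B P Q R) (m k : ℤ) (w : W) : jac ε A B 3 m k w = 0 := by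
  have h1 := jac_succ ε A B 2 m k w
  rw [h.jac_two, h.jac_two] at h1
  have e1 : m + 1 + k = m + k + 1 := by ring
  have e2 : m + (k + 1) = m + k + 1 := by ring
  have e3 : (2 : ℤ) + 1 = 3 := rfl
  rw [← e3, h1, e1, e2, sub_self]

theorem OPE.isLocal (h : OPE ε A B P Q R) : Local ε A B := ⟨3, h.jac_three⟩

theorem OPE.prod_zero (h : OPE ε A B P Q R) : nthProd ε A 0 B = P := by
  refine field_ext fun k w => ?_
  rw [nthProd_mode_eq_jac, jac_zero, h]
  simp [intChoose]

theorem OPE.prod_one (h : OPE ε A B P Q R) : nthProd ε A 1 B = Q := by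
  refine field_ext fun k w => ?_
  rw [nthProd_mode_eq_jac, h.jac_one]
  simp

theorem OPE.prod_two (h : OPE ε A B P Q R) : nthProd ε A 2 B = R := by
  refine field_ext fun k w => ?_
  rw [nthProd_mode_eq_jac, h.jac_two, zero_add]

theorem OPE.prod_eq_zero (h : OPE ε A B P Q R) {n : ℤ} (hn : 3 ≤ n) : nthProd ε A n B = 0 := by
  refine field_ext fun k w => ?_
  rw [nthProd_mode_eq_jac, jac_eq_zero_of_le h.jac_three hn, mode_zero]

/-- The converse passage: for local fields the commutator formula needs only the nonnegative
products. -/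
theorem OPE.of_local (h : Local ε A B) (h0 : nthProd ε A 0 B = P) (h1 : nthProd ε A 1 B = Q)
    (h2 : nthProd ε A 2 B = R) (h3 : ∀ n : ℕ, 3 ≤ n → nthProd ε A n B = 0) :
    OPE ε A B P Q R := by
  intro i j w
  rw [h.commutator, EvZero.finsum_eq (K := 3) fun n hn => by rw [h3 n hn, mode_zero, smul_zero],
    Finset.sum_range_succ, Finset.sum_range_succ, Finset.sum_range_one]
  simp only [Nat.cast_zero, Nat.cast_one, Nat.cast_ofNat, h0, h1, h2, intChoose_zero_right,
    intChoose_one_right, one_smul, sub_zero]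

theorem OPE.comm (hε : ε * ε = 1) (h : OPE ε A B P Q R) (C : VertexOperator ℂ W) (n m : ℤ) :
    nthProd (ε * η) A n (nthProd θ B m C) = ε • nthProd (ε * θ) B m (nthProd η A n C)
      + (nthProd (η * θ) P (n + m) C + (n : ℂ) • nthProd (η * θ) Q (n + m - 1) C
        + intChoose n 2 • nthProd (η * θ) R (n + m - 2) C) := by
  have := nthProd_comm (η := η) (θ := θ) hε (A := A) (B := B)
    (Z := fun s => if s = 0 then P else if s = 1 then Q else R) (S := 3) (fun i j w => ?_) C n m
  · rw [← sub_eq_iff_eq_add', this, Finset.sum_range_succ, Finset.sum_range_succ,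
      Finset.sum_range_one]
    simp
  · rw [h, Finset.sum_range_succ, Finset.sum_range_succ, Finset.sum_range_one]
    simp

theorem OPE.add_right (h : OPE ε A B P Q R) {B' : VertexOperator ℂ W}
    (h' : OPE ε A B' P' Q' R') : OPE ε A (B + B') (P + P') (Q + Q') (R + R') := by
  intro i j w
  simp only [mode_add]
  simp only [map_add]
  linear_combination (norm := module) h i j w + h' i j w

theorem OPE.smul_right (h : OPE ε A B P Q R) (c : ℂ) :
    OPE ε A (c • B) (c • P) (c • Q) (c • R) := by
  intro i j w
  simp only [mode_smul]
  simp only [map_smul]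
  linear_combination (norm := module) c • h i j w

theorem OPE.add_left (h : OPE ε A B P Q R) {A' : VertexOperator ℂ W}
    (h' : OPE ε A' B P' Q' R') : OPE ε (A + A') B (P + P') (Q + Q') (R + R') := by
  intro i j w
  simp only [mode_add]
  simp only [map_add]
  linear_combination (norm := module) h i j w + h' i j w

theorem OPE.smul_left (h : OPE ε A B P Q R) (c : ℂ) :
    OPE ε (c • A) B (c • P) (c • Q) (c • R) := by
  intro i j w
  simp only [mode_smul]
  simp only [map_smul]
  linear_combination (norm := module) c • h i j w

/-- Skew-symmetry in general involves the derivative of `Q`. Here `Q` is a multiple of the identity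
field, so it contributes only for `i + j = 0`, where `j = -i`. -/
theorem OPE.symm (hε : ε * ε = 1) {c : ℂ} (h : OPE ε A B P (c • idField W) 0) :
    OPE ε B A (-(ε • P)) ((ε * c) • idField W) 0 := by
  intro i j w
  have e := congrArg (-ε • ·) (h j i w)
  simp only [smul_sub, smul_smul, neg_mul, hε] at e
  have e2 : (B[[i]]) ((A[[j]]) w) - ε • (A[[j]]) ((B[[i]]) w)
      = -ε • ((P[[j + i]]) w + (j : ℂ) • ((c • idField W)[[j + i - 1]]) w
        + intChoose j 2 • ((0 : VertexOperator ℂ W)[[j + i - 2]]) w) := by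
    rw [← e]
    module
  rw [e2]
  simp only [mode_smul, mode_neg, mode_zero, idField_mode, smul_zero, add_zero, add_comm j i]
  split_ifs with hij
  · have : (j : ℂ) = -i := by
      rw [eq_neg_iff_add_eq_zero]
      exact_mod_cast (by omega : j + i = 0)
    rw [this]
    module
  · module

theorem OPE.symm_zero (hε : ε * ε = 1) (h : OPE ε A B P 0 0) : OPE ε B A (-(ε • P)) 0 0 := by
  have := OPE.symm hε (c := 0) (P := P) (by rwa [zero_smul])
  rwa [mul_zero, zero_smul] at this

/-- The operator product expansion of a field with a normally ordered product. -/
theorem OPE.normal (hε : ε * ε = 1) {P₁ Q₁ P₂ Q₂ : VertexOperator ℂ W}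
    (hB : OPE ε A B P₁ Q₁ 0) (hC : OPE η A C P₂ Q₂ 0) (hBC : Local θ B C)
    (hP : ∀ s : ℤ, 2 ≤ s → nthProd (η * θ) P₁ s C = 0)
    (hQ : ∀ s : ℤ, 1 ≤ s → nthProd (η * θ) Q₁ s C = 0) :
    OPE (ε * η) A (nthProd θ B (-1) C)
      (ε • nthProd (ε * θ) B (-1) P₂ + nthProd (η * θ) P₁ (-1) C)
      (ε • nthProd (ε * θ) B (-1) Q₂ + nthProd (η * θ) P₁ 0 C + nthProd (η * θ) Q₁ (-1) C)
      (nthProd (η * θ) P₁ 1 C + (2 : ℂ) • nthProd (η * θ) Q₁ 0 C) := by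
  -- The noncommutative Wick formula: `A_(n)` is moved past `B_(-1)`, for each `n ≥ 0`.
  have key := fun n => hB.comm hε (η := η) (θ := θ) C n (-1)
  refine OPE.of_local (hB.isLocal.nthProd hC.isLocal hBC (-1)) ?_ ?_ ?_ fun n hn => ?_
  · rw [key, hC.prod_zero]
    simp [nthProd_zero_left]
  · rw [key, hC.prod_one]
    simp [nthProd_zero_left]
    abel
  · rw [key, hC.prod_two]
    simp [nthProd_zero_left, nthProd_zero_right]
  -- For `n ≥ 3` the remaining products have orders `n - 1 ≥ 2` and `n - 2 ≥ 1`, which is what `hP`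
  -- and `hQ` exclude.
  · have hC0 : nthProd η A n C = 0 := hC.prod_eq_zero (by omega)
    rw [key, hC0, hP _ (by omega), hQ _ (by omega)]
    simp [nthProd_zero_left, nthProd_zero_right]

theorem ope_zero_iff : OPE ε A B 0 0 0 ↔
    ∀ (i j : ℤ) (w : W), (A[[i]]) ((B[[j]]) w) = ε • (B[[j]]) ((A[[i]]) w) := by
  simp [OPE, sub_eq_zero]

theorem OPE.congr {P₁ Q₁ R₁ P₂ Q₂ R₂ : VertexOperator ℂ W} (h : OPE ε A B P₁ Q₁ R₁)
    (hP : P₁ = P₂) (hQ : Q₁ = Q₂) (hR : R₁ = R₂) : OPE ε A B P₂ Q₂ R₂ := by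
  subst hP hQ hR
  exact h

end OPE

/-! ### Families of fields satisfying prescribed commutation relations -/

section Realization

variable {W : Type*} [AddCommGroup W] [Module ℂ W] {G : Type} [Fintype G]

/-- The fields `X x` satisfy the commutation relations of `D`. -/
def LinearOPE.Realizes (D : LinearOPE G) (X : G → VertexOperator ℂ W) : Prop :=
  ∀ x y, OPE (koszul (D.parity x) (D.parity y)) (X x) (X y)
    (∑ z, D.bracket x y z • X z + D.form₀ x y • idField W) (D.form₁ x y • idField W) 0

theorem LinearOPE.realizes_iff {D : LinearOPE G} {X : G → VertexOperator ℂ W} :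
    D.Realizes X ↔ ∀ x y (n m : ℤ) (w : W), ((X x)[[n]]) (((X y)[[m]]) w)
      = koszul (D.parity x) (D.parity y) • ((X y)[[m]]) (((X x)[[n]]) w)
        + ∑ z, D.bracket x y z • ((X z)[[n + m]]) w
        + (if n + m + 1 = 0 then D.form₀ x y else 0) • w
        + (if n + m = 0 then (n : ℂ) * D.form₁ x y else 0) • w := by
  refine forall_congr' fun x => forall_congr' fun y => forall_congr' fun n => forall_congr' fun m =>
    forall_congr' fun w => ?_
  have h1 : n + m = -1 ↔ n + m + 1 = 0 := by omega
  have h2 : n + m - 1 = -1 ↔ n + m = 0 := by omega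
  rw [sub_eq_iff_eq_add']
  simp only [mode_add, mode_sum, mode_smul, mode_zero, idField_mode, h1, h2, smul_zero, add_zero,
    smul_ite, ite_smul, zero_smul, mul_smul, add_assoc]

end Realization

/-! ### Words in the modes -/

namespace LinearOPE

variable {G : Type} [Fintype G]

/-- The monomial `x¹_(n₁) ⋯ xʳ_(nᵣ)` in the free algebra. -/
def word : List (G × ℤ) → FreeModes G
  | [] => 1
  | p :: l => sym p.1 p.2 * word l

theorem basisFreeMonoid_ofList (l : List (G × ℤ)) :
    FreeAlgebra.basisFreeMonoid ℂ (G × ℤ) (FreeMonoid.ofList l) = word l := by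
  have h : ∀ l : List (G × ℤ), FreeMonoid.lift (FreeAlgebra.ι ℂ) (FreeMonoid.ofList l)
      = word l := by
    intro l
    induction l with
    | nil => simp [word]
    | cons p l ih => rw [FreeMonoid.ofList_cons, map_mul, ih, FreeMonoid.lift_eval_of]; rfl
  rw [← h]
  simp [FreeAlgebra.basisFreeMonoid, FreeAlgebra.equivMonoidAlgebraFreeMonoid]

/-- The linear span of the monomials of parity `q`. -/
def wordSpan (D : LinearOPE G) (q : ZMod 2) : Submodule ℂ (FreeModes G) :=
  Submodule.span ℂ {b | ∃ l, D.wordParity l = q ∧ b = word l}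

theorem word_mem_wordSpan (D : LinearOPE G) (l : List (G × ℤ)) :
    word l ∈ D.wordSpan (D.wordParity l) := Submodule.subset_span ⟨l, rfl, rfl⟩

theorem span_word : Submodule.span ℂ (Set.range (word : List (G × ℤ) → FreeModes G)) = ⊤ := by
  rw [← (FreeAlgebra.basisFreeMonoid ℂ (G × ℤ)).span_eq]
  congr 1
  ext b
  constructor
  · rintro ⟨l, rfl⟩
    exact ⟨FreeMonoid.ofList l, basisFreeMonoid_ofList l⟩
  · rintro ⟨l, rfl⟩
    exact ⟨FreeMonoid.toList l, (basisFreeMonoid_ofList _).symm⟩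

theorem sym_mul_mem_wordSpan (D : LinearOPE G) (x : G) (n : ℤ) {q : ZMod 2} {b : FreeModes G}
    (hb : b ∈ D.wordSpan q) : sym x n * b ∈ D.wordSpan (D.parity x + q) := by
  induction hb using Submodule.span_induction with
  | mem b hb =>
    obtain ⟨l, rfl, rfl⟩ := hb
    exact D.word_mem_wordSpan ((x, n) :: l)
  | zero => rw [mul_zero]; exact Submodule.zero_mem _
  | add a b _ _ ha hb => rw [mul_add]; exact Submodule.add_mem _ ha hb
  | smul c b _ hb => rw [mul_smul_comm]; exact Submodule.smul_mem _ _ hb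

variable {W : Type*} [AddCommGroup W] [Module ℂ W]

/-- The iterated product `X¹_(n₁) (X²_(n₂) (⋯ (Xʳ_(nᵣ) id)))` of fields on `W`. -/
def fieldWord (D : LinearOPE G) (X : G → VertexOperator ℂ W) : List (G × ℤ) → VertexOperator ℂ W
  | [] => idField W
  | (x, n) :: l => nthProd (koszul (D.parity x) (D.wordParity l)) (X x) n (D.fieldWord X l)

theorem wordField_eq (D : LinearOPE G) (l : List (G × ℤ)) :
    D.wordField l = D.fieldWord D.genField l := by
  induction l with
  | nil => rfl
  | cons p l ih => rw [wordField, fieldWord, ih]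

/-- The linear map from the free algebra to fields on `W` with `word l ↦ fieldWord l`. -/
def toFields (D : LinearOPE G) (X : G → VertexOperator ℂ W) :
    FreeModes G →ₗ[ℂ] VertexOperator ℂ W :=
  (FreeAlgebra.basisFreeMonoid ℂ (G × ℤ)).constr ℂ fun l => D.fieldWord X (FreeMonoid.toList l)

theorem toFields_word (D : LinearOPE G) (X : G → VertexOperator ℂ W) (l : List (G × ℤ)) :
    D.toFields X (word l) = D.fieldWord X l := by
  rw [toFields, ← basisFreeMonoid_ofList, Module.Basis.constr_basis]
  rfl

/-- The sign in a product of fields depends on the parity of the right factor, so `toFields` turns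
left multiplication into a product only on homogeneous elements. -/
theorem toFields_sym_mul (D : LinearOPE G) (X : G → VertexOperator ℂ W) (x : G) (n : ℤ)
    {q : ZMod 2} {b : FreeModes G} (hb : b ∈ D.wordSpan q) :
    D.toFields X (sym x n * b) = nthProd (koszul (D.parity x) q) (X x) n (D.toFields X b) := by
  induction hb using Submodule.span_induction with
  | mem b hb =>
    obtain ⟨l, rfl, rfl⟩ := hb
    rw [toFields_word]
    exact D.toFields_word X ((x, n) :: l)
  | zero => rw [mul_zero, map_zero, nthProd_zero_right]
  | add a b _ _ ha hb => rw [mul_add, map_add, map_add, ha, hb, nthProd_add_right]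
  | smul c b _ hb => rw [mul_smul_comm, map_smul, map_smul, hb, nthProd_smul_right]

/-- The commutation relations respect the parity. -/
structure IsHomogeneous (D : LinearOPE G) : Prop where
  bracket : ∀ x y z, D.bracket x y z ≠ 0 → D.parity z = D.parity x + D.parity y
  form₀ : ∀ x y, D.form₀ x y ≠ 0 → D.parity x = D.parity y
  form₁ : ∀ x y, D.form₁ x y ≠ 0 → D.parity x = D.parity y

theorem zmod_two_add_self (p : ZMod 2) : p + p = 0 := by
  revert p
  decide

theorem relator_mul_word (D : LinearOPE G) (x y : G) (n m : ℤ) (b : FreeModes G) :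
    D.relator x y n m * b = sym x n * (sym y m * b)
      - koszul (D.parity x) (D.parity y) • (sym y m * (sym x n * b))
      - ∑ z, D.bracket x y z • (sym z (n + m) * b)
      - (if n + m + 1 = 0 then D.form₀ x y else 0) • b
      - (if n + m = 0 then (n : ℂ) * D.form₁ x y else 0) • b := by
  simp only [relator, sub_mul, mul_assoc, Finset.sum_mul, Algebra.smul_def]

theorem relator_mul_mem (D : LinearOPE G) (hD : D.IsHomogeneous) (x y : G) (n m : ℤ)
    (l : List (G × ℤ)) : D.relator x y n m * word l
      ∈ D.wordSpan (D.parity x + (D.parity y + D.wordParity l)) := by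
  have hl := D.word_mem_wordSpan l
  have hself : D.parity x = D.parity y →
      word l ∈ D.wordSpan (D.parity x + (D.parity y + D.wordParity l)) := fun h => by
    rw [h, ← add_assoc, zmod_two_add_self, zero_add]
    exact hl
  rw [relator_mul_word]
  refine Submodule.sub_mem _ (Submodule.sub_mem _ (Submodule.sub_mem _ (Submodule.sub_mem _ ?_ ?_)
    ?_) ?_) ?_
  · exact D.sym_mul_mem_wordSpan x n (D.sym_mul_mem_wordSpan y m hl)
  · rw [add_left_comm]
    exact Submodule.smul_mem _ _ (D.sym_mul_mem_wordSpan y m (D.sym_mul_mem_wordSpan x n hl))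
  · refine Submodule.sum_mem _ fun z _ => ?_
    by_cases hz : D.bracket x y z = 0
    · rw [hz, zero_smul]
      exact Submodule.zero_mem _
    · rw [← add_assoc, ← hD.bracket x y z hz]
      exact Submodule.smul_mem _ _ (D.sym_mul_mem_wordSpan z (n + m) hl)
  · by_cases h : D.form₀ x y = 0
    · simp [h]
    · exact Submodule.smul_mem _ _ (hself (hD.form₀ x y h))
  · by_cases h : D.form₁ x y = 0
    · simp [h]
    · exact Submodule.smul_mem _ _ (hself (hD.form₁ x y h))

/-- A relator in front of a word becomes the difference of the two sides of `OPE.comm` for iterated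
products. -/
theorem toFields_relator_mul (D : LinearOPE G) (hD : D.IsHomogeneous)
    {X : G → VertexOperator ℂ W} (hX : D.Realizes X) (x y : G) (n m : ℤ) (l : List (G × ℤ)) :
    D.toFields X (D.relator x y n m * word l) = 0 := by
  have hl := D.word_mem_wordSpan l
  have key := (hX x y).comm (η := koszul (D.parity x) (D.wordParity l))
    (θ := koszul (D.parity y) (D.wordParity l)) (koszul_mul_self _ _) (D.fieldWord X l) n m
  rw [relator_mul_word]
  simp only [map_sub, map_smul, map_sum]
  rw [D.toFields_sym_mul X x n (D.sym_mul_mem_wordSpan y m hl), D.toFields_sym_mul X y m hl,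
    D.toFields_sym_mul X y m (D.sym_mul_mem_wordSpan x n hl), D.toFields_sym_mul X x n hl,
    toFields_word, koszul_add_right, koszul_add_right, koszul_comm (D.parity y) (D.parity x), key]
  have hsign : koszul (D.parity x) (D.wordParity l) * koszul (D.parity y) (D.wordParity l)
      = koszul (D.parity x + D.parity y) (D.wordParity l) := (koszul_add_left _ _ _).symm
  have h1 : ∀ z, D.bracket x y z • D.toFields X (sym z (n + m) * word l)
      = nthProd (koszul (D.parity x) (D.wordParity l) * koszul (D.parity y) (D.wordParity l))
          (D.bracket x y z • X z) (n + m) (D.fieldWord X l) := by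
    intro z
    rw [D.toFields_sym_mul X z _ hl, toFields_word, nthProd_smul_left]
    by_cases hz : D.bracket x y z = 0
    · simp [hz]
    · rw [hsign, ← hD.bracket x y z hz]
  -- Central terms: a product with the identity field is nonzero only at order `-1`. Homogeneity
  -- makes the total sign trivial whenever the central coefficient is nonzero.
  have h2 : ∀ (c : ℂ) (k : ℤ), (c ≠ 0 → D.parity x = D.parity y) →
      nthProd (koszul (D.parity x) (D.wordParity l) * koszul (D.parity y) (D.wordParity l))
        (c • idField W) k (D.fieldWord X l) = (if k = -1 then c else 0) • D.fieldWord X l := by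
    intro c k hc
    rw [nthProd_smul_left]
    by_cases hc0 : c = 0
    · simp [hc0]
    · rw [hsign, hc hc0, zmod_two_add_self, koszul_zero_left, id_nthProd]
      split_ifs <;> simp
  rw [nthProd_add_left, nthProd_sum_left, Finset.sum_congr rfl fun z _ => h1 z,
    h2 _ _ (hD.form₀ x y), h2 _ _ (hD.form₁ x y), nthProd_zero_left, smul_zero]
  have e1 : n + m = -1 ↔ n + m + 1 = 0 := by omega
  have e2 : n + m - 1 = -1 ↔ n + m = 0 := by omega
  simp only [e1, e2]
  split_ifs <;> module

/-- The left ideal of combinations of monomials whose homogeneous parts map to zero fields. -/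
def fieldsKer (D : LinearOPE G) (X : G → VertexOperator ℂ W) : Submodule ℂ (FreeModes G) :=
  ⨆ q, D.wordSpan q ⊓ LinearMap.ker (D.toFields X)

theorem mem_fieldsKer {D : LinearOPE G} {X : G → VertexOperator ℂ W} {q : ZMod 2}
    {b : FreeModes G} (hb : b ∈ D.wordSpan q) (h : D.toFields X b = 0) : b ∈ D.fieldsKer X :=
  Submodule.mem_iSup_of_mem q ⟨hb, h⟩

/-- The kernel of `toFields` alone need not be a left ideal, since the signs differ on the two
parities; the homogeneous version is one. -/
theorem mul_mem_fieldsKer (D : LinearOPE G) (X : G → VertexOperator ℂ W) (u : FreeModes G) :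
    ∀ b ∈ D.fieldsKer X, u * b ∈ D.fieldsKer X := by
  induction u using FreeAlgebra.induction with
  | grade0 r =>
    intro b hb
    rw [← Algebra.smul_def]
    exact Submodule.smul_mem _ _ hb
  | grade1 p =>
    intro b hb
    induction hb using Submodule.iSup_induction' with
    | mem q b hb =>
      refine mem_fieldsKer (D.sym_mul_mem_wordSpan p.1 p.2 hb.1) ?_
      exact (D.toFields_sym_mul X p.1 p.2 hb.1).trans
        (by rw [LinearMap.mem_ker.1 hb.2, nthProd_zero_right])
    | zero => rw [mul_zero]; exact Submodule.zero_mem _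
    | add a b _ _ ha hb => rw [mul_add]; exact Submodule.add_mem _ ha hb
  | mul u v hu hv =>
    intro b hb
    rw [mul_assoc]
    exact hu _ (hv b hb)
  | add u v hu hv =>
    intro b hb
    rw [add_mul]
    exact Submodule.add_mem _ (hu b hb) (hv b hb)

theorem vacIdeal_le_fieldsKer (D : LinearOPE G) (hD : D.IsHomogeneous)
    {X : G → VertexOperator ℂ W} (hX : D.Realizes X) :
    ∀ b ∈ D.vacIdeal, b ∈ D.fieldsKer X := by
  intro b hb
  induction hb using Submodule.span_induction with
  | mem b hb =>
    rcases hb with ⟨x, y, n, m, b, rfl⟩ | ⟨x, n, hn, rfl⟩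
    · have hb : b ∈ Submodule.span ℂ (Set.range (word : List (G × ℤ) → FreeModes G)) := by
        rw [span_word]
        trivial
      induction hb using Submodule.span_induction with
      | mem b hb =>
        obtain ⟨l, rfl⟩ := hb
        exact mem_fieldsKer (D.relator_mul_mem hD x y n m l) (D.toFields_relator_mul hD hX x y n m l)
      | zero => rw [mul_zero]; exact Submodule.zero_mem _
      | add a b _ _ ha hb => rw [mul_add]; exact Submodule.add_mem _ ha hb
      | smul c b _ hb => rw [mul_smul_comm]; exact Submodule.smul_mem _ _ hb
    -- The remaining generators `x_(n)` with `n ≥ 0` go to `X_(n) id`, which vanishes.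
    · have h1 := D.word_mem_wordSpan []
      have h2 := D.sym_mul_mem_wordSpan x n h1
      have h3 := D.toFields_sym_mul X x n h1
      rw [toFields_word] at h3
      simp only [word, mul_one] at h2 h3
      refine mem_fieldsKer h2 ?_
      rw [h3]
      simpa [wordParity, fieldWord] using nthProd_id_of_nonneg (X x) hn
  | zero => exact Submodule.zero_mem _
  | add a b _ _ ha hb => exact Submodule.add_mem _ ha hb
  | smul u b _ hb => exact D.mul_mem_fieldsKer X u b hb

theorem state_eq (D : LinearOPE G) (l : List (G × ℤ)) : D.state l = D.proj (word l) := by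
  induction l with
  | nil => rfl
  | cons p l ih => rw [state, ih, ← map_smul]; rfl

theorem span_state (D : LinearOPE G) : Submodule.span ℂ (Set.range D.state) = ⊤ := by
  have h := congrArg (Submodule.map (D.proj.restrictScalars ℂ)) (span_word (G := G))
  rw [Submodule.map_span, Submodule.map_top,
    LinearMap.range_eq_top.2 (by exact D.proj_surjective), ← Set.range_comp] at h
  rw [← h]
  congr 1
  ext v
  simp [state_eq]

/-- The universal vacuum module acts on every space with fields satisfying the relations. -/
theorem exists_stateField (D : LinearOPE G) (hD : D.IsHomogeneous)
    (hs : D.maxIdeal = D.vacIdeal) {X : G → VertexOperator ℂ W} (hX : D.Realizes X) :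
    ∃ Y : D.Space →ₗ[ℂ] VertexOperator ℂ W, ∀ l, Y (D.state l) = D.fieldWord X l := by
  -- A linear section of the projection. The choice is harmless because `toFields` vanishes on the
  -- ideal divided out.
  obtain ⟨g, hg⟩ := LinearMap.exists_rightInverse_of_surjective (D.proj.restrictScalars ℂ)
    (LinearMap.range_eq_top.2 D.proj_surjective)
  refine ⟨D.toFields X ∘ₗ g, fun l => ?_⟩
  have h1 : D.proj (g (D.state l) - word l) = 0 := by
    have := LinearMap.congr_fun hg (D.state l)
    rw [map_sub, ← state_eq, sub_eq_zero]
    exact this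
  rw [D.proj_eq_zero, hs] at h1
  have h2 : ∀ b ∈ D.fieldsKer X, D.toFields X b = 0 := by
    intro b hb
    exact (iSup_le fun q => inf_le_right : D.fieldsKer X ≤ LinearMap.ker (D.toFields X)) hb
  have h3 := h2 _ (D.vacIdeal_le_fieldsKer hD hX _ h1)
  rw [map_sub, sub_eq_zero, toFields_word] at h3
  exact h3

theorem genField_mode (D : LinearOPE G) (x : G) (n : ℤ) (v : D.Space) :
    ((D.genField x)[[n]]) v = sym x n • v := by
  exact LinearMap.congr_fun (mkField_mode _ _ n) v

theorem genField_realizes (D : LinearOPE G) : D.Realizes D.genField := by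
  rw [realizes_iff]
  intro x y n m v
  simp only [genField_mode]
  exact D.sym_comm x y n m v

/-- The state-field correspondence of `vertex` falls back to `0` if no suitable map exists;
simplicity of the universal module rules this out. -/
theorem vertex_Y_state (D : LinearOPE G) (hD : D.IsHomogeneous)
    (hs : D.maxIdeal = D.vacIdeal) (l : List (G × ℤ)) :
    D.vertex.Y (D.state l) = D.fieldWord D.genField l := by
  have h : ∃ Y : D.Space →ₗ[ℂ] VertexOperator ℂ D.Space, ∀ l, Y (D.state l) = D.wordField l := by
    obtain ⟨Y, hY⟩ := D.exists_stateField hD hs D.genField_realizes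
    exact ⟨Y, fun l => by rw [hY, wordField_eq] ⟩
  rw [← wordField_eq]
  have := h.choose_spec l
  rw [vertex]
  simp only [dif_pos h]
  exact this

end LinearOPE

/-! ### Reconstruction -/

theorem nthProd_mem_of_comp_mem {W : Type*} [AddCommGroup W] [Module ℂ W] {ε : ℂ}
    {A B : VertexOperator ℂ W} {S : Submodule ℂ W} {w : W}
    (hAB : ∀ i j, (A[[i]]) ((B[[j]]) w) ∈ S) (hBA : ∀ i j, (B[[j]]) ((A[[i]]) w) ∈ S) (m n : ℤ) :
    ((nthProd ε A m B)[[n]]) w ∈ S := by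
  rw [nthProd_mode]
  refine Submodule.sub_mem _ ?_ (Submodule.smul_mem _ _ ?_)
  · exact finsum_induction (· ∈ S) (Submodule.zero_mem _) (fun _ _ => Submodule.add_mem _)
      fun j => Submodule.smul_mem _ _ (hAB _ _)
  · exact finsum_induction (· ∈ S) (Submodule.zero_mem _) (fun _ _ => Submodule.add_mem _)
      fun j => Submodule.smul_mem _ _ (hBA _ _)

namespace LinearOPE

variable {G : Type} [Fintype G] {D : LinearOPE G}

theorem state_mem_part (D : LinearOPE G) (l : List (G × ℤ)) :
    D.state l ∈ D.vertex.part (D.wordParity l) := Submodule.subset_span ⟨l, rfl, rfl⟩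

theorem sym_smul_mem_part (x : G) (n : ℤ) {q : ZMod 2} {v : D.Space}
    (hv : v ∈ D.vertex.part q) : sym x n • v ∈ D.vertex.part (D.parity x + q) := by
  induction hv using Submodule.span_induction with
  | mem v hv =>
    obtain ⟨l, rfl, rfl⟩ := hv
    exact D.state_mem_part ((x, n) :: l)
  | zero => rw [smul_zero]; exact Submodule.zero_mem _
  | add a b _ _ ha hb => rw [smul_add]; exact Submodule.add_mem _ ha hb
  | smul c b _ hb => rw [smul_comm]; exact Submodule.smul_mem _ _ hb

@[elab_as_elim]
theorem state_induction {P : D.Space → Prop} (v : D.Space) (h : ∀ l, P (D.state l))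
    (h0 : P 0) (ha : ∀ v w, P v → P w → P (v + w)) (hs : ∀ (c : ℂ) v, P v → P (c • v)) : P v := by
  have hv : v ∈ Submodule.span ℂ (Set.range D.state) := by rw [span_state]; trivial
  induction hv using Submodule.span_induction with
  | mem v hv => obtain ⟨l, rfl⟩ := hv; exact h l
  | zero => exact h0
  | add a b _ _ h1 h2 => exact ha a b h1 h2
  | smul c b _ hb => exact hs c b hb

/-! ### Locality of the fields attached to states -/

section Fields

variable {W : Type*} [AddCommGroup W] [Module ℂ W] {X : G → VertexOperator ℂ W}
  {Y : D.Space →ₗ[ℂ] VertexOperator ℂ W}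

theorem stateField_sym_smul (hY : ∀ l, Y (D.state l) = D.fieldWord X l) (x : G) (n : ℤ)
    {q : ZMod 2} {v : D.Space} (hv : v ∈ D.vertex.part q) :
    Y (sym x n • v) = nthProd (koszul (D.parity x) q) (X x) n (Y v) := by
  induction hv using Submodule.span_induction with
  | mem v hv =>
    obtain ⟨l, rfl, rfl⟩ := hv
    rw [hY l]
    exact hY ((x, n) :: l)
  | zero => rw [smul_zero, map_zero, nthProd_zero_right]
  | add a b _ _ ha hb => rw [smul_add, map_add, map_add, ha, hb, nthProd_add_right]
  | smul c b _ hb =>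
    rw [smul_comm, LinearMap.map_smul_of_tower Y c, LinearMap.map_smul_of_tower Y c, hb,
      nthProd_smul_right]

/-- Dong's lemma along the word; the signs multiply because `koszul` is bimultiplicative. -/
theorem local_fieldWord (hX : D.Realizes X) (x : G) (l : List (G × ℤ)) :
    Local (koszul (D.parity x) (D.wordParity l)) (X x) (D.fieldWord X l) := by
  induction l generalizing x with
  | nil => simpa [wordParity, fieldWord] using local_id_right (X x)
  | cons p l ih =>
    rw [fieldWord, wordParity, koszul_add_right]
    exact (hX x p.1).isLocal.nthProd (ih x) (ih p.1) p.2

theorem fieldWord_local_fieldWord (hX : D.Realizes X) (l l' : List (G × ℤ)) :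
    Local (koszul (D.wordParity l) (D.wordParity l')) (D.fieldWord X l) (D.fieldWord X l') := by
  induction l' with
  | nil => simpa [wordParity, fieldWord] using local_id_right (D.fieldWord X l)
  | cons p l' ih =>
    rw [fieldWord, wordParity, koszul_add_right, koszul_comm]
    exact ((local_fieldWord hX p.1 l).symm (koszul_mul_self _ _)).nthProd ih
      (local_fieldWord hX p.1 l') p.2

theorem stateField_local (hX : D.Realizes X) (hY : ∀ l, Y (D.state l) = D.fieldWord X l)
    {p q : ZMod 2} {a b : D.Space} (ha : a ∈ D.vertex.part p) (hb : b ∈ D.vertex.part q) :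
    Local (koszul p q) (Y a) (Y b) := by
  induction ha using Submodule.span_induction with
  | mem a ha =>
    obtain ⟨l, rfl, rfl⟩ := ha
    refine Local.symm (koszul_mul_self _ _) ?_
    induction hb using Submodule.span_induction with
    | mem b hb =>
      obtain ⟨l', rfl, rfl⟩ := hb
      rw [hY, hY, koszul_comm]
      exact fieldWord_local_fieldWord hX l' l
    | zero => rw [map_zero]; exact local_zero_left _ _
    | add a b _ _ ha hb => rw [map_add]; exact ha.add_left hb
    | smul c b _ hb => rw [map_smul]; exact hb.smul_left c
  | zero => rw [map_zero]; exact local_zero_left _ _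
  | add a b _ _ ha hb => rw [map_add]; exact ha.add_left hb
  | smul c b _ hb => rw [map_smul]; exact hb.smul_left c

end Fields

/-! ### Creation property and translation operator -/

section Vacuum

variable {YV : D.Space →ₗ[ℂ] VertexOperator ℂ D.Space}

theorem fieldWord_mode_mem (q : ZMod 2) (l : List (G × ℤ)) (n : ℤ) {v : D.Space}
    (hv : v ∈ D.vertex.part q) :
    ((D.fieldWord D.genField l)[[n]]) v ∈ D.vertex.part (D.wordParity l + q) := by
  induction l generalizing n q v with
  | nil =>
    rw [fieldWord, idField_mode, wordParity, zero_add]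
    split_ifs
    · exact hv
    · exact Submodule.zero_mem _
  | cons p l ih =>
    rw [fieldWord, wordParity]
    refine nthProd_mem_of_comp_mem (fun i j => ?_) (fun i j => ?_) _ _
    · rw [genField_mode, add_assoc]
      exact sym_smul_mem_part _ _ (ih q j hv)
    · rw [genField_mode, add_comm (D.parity _), add_assoc]
      exact ih _ j (sym_smul_mem_part _ _ hv)

theorem stateField_mode_mem (hY : ∀ l, YV (D.state l) = D.fieldWord D.genField l)
    {p q : ZMod 2} {a b : D.Space} (ha : a ∈ D.vertex.part p) (hb : b ∈ D.vertex.part q) (n : ℤ) :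
    ((YV a)[[n]]) b ∈ D.vertex.part (p + q) := by
  induction ha using Submodule.span_induction with
  | mem a ha =>
    obtain ⟨l, rfl, rfl⟩ := ha
    rw [hY]
    exact fieldWord_mode_mem q l n hb
  | zero => rw [map_zero, mode_zero]; exact Submodule.zero_mem _
  | add a b _ _ ha hb => rw [map_add, mode_add]; exact Submodule.add_mem _ ha hb
  | smul c b _ hb => rw [map_smul, mode_smul]; exact Submodule.smul_mem _ _ hb

/-- The part of the product with the generator acting first dies on the vacuum, so only the sum with
the generator on the left remains. -/
theorem fieldWord_creation (l : List (G × ℤ)) :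
    (∀ n : ℤ, 0 ≤ n → ((D.fieldWord D.genField l)[[n]]) D.vac = 0) ∧
      ((D.fieldWord D.genField l)[[-1]]) D.vac = D.state l := by
  induction l with
  | nil =>
    simp only [fieldWord, idField_mode, state, if_true, and_true]
    intro n hn
    rw [if_neg (by omega)]
  | cons p l ih =>
    have h2 : ∀ j : ℕ, ((D.genField p.1)[[(j : ℤ)]]) D.vac = 0 := fun j => by
      rw [genField_mode, D.sym_vac _ _ (by omega)]
    have h3 : ∀ n : ℤ, ((D.fieldWord D.genField (p :: l))[[n]]) D.vac = ∑ᶠ j : ℕ,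
        sgnChoose p.2 j • (sym p.1 (p.2 - j) • ((D.fieldWord D.genField l)[[n + j]]) D.vac) := by
      intro n
      rw [fieldWord, nthProd_mode]
      simp only [h2, map_zero, smul_zero, finsum_zero, sub_zero, genField_mode]
    constructor
    · intro n hn
      rw [h3]
      refine finsum_eq_zero_of_forall_eq_zero fun j => ?_
      rw [ih.1 _ (by omega), smul_zero, smul_zero]
    · rw [h3, finsum_single_zero]
      · simp [sgnChoose, ih.2, state]
      · intro j hj
        rw [ih.1 _ (by omega), smul_zero, smul_zero]

theorem stateField_vac_of_nonneg (hY : ∀ l, YV (D.state l) = D.fieldWord D.genField l)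
    (a : D.Space) {n : ℤ} (hn : 0 ≤ n) : ((YV a)[[n]]) D.vac = 0 := by
  refine state_induction a (fun l => ?_) ?_ ?_ ?_
  · rw [hY, (fieldWord_creation l).1 n hn]
  · rw [map_zero, mode_zero]
  · intro v w hv hw; rw [map_add, mode_add, hv, hw, add_zero]
  · intro c v hv; rw [map_smul, mode_smul, hv, smul_zero]

theorem stateField_vac_neg_one (hY : ∀ l, YV (D.state l) = D.fieldWord D.genField l)
    (a : D.Space) : ((YV a)[[-1]]) D.vac = a := by
  refine state_induction a (fun l => ?_) ?_ ?_ ?_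
  · rw [hY, (fieldWord_creation l).2]
  · rw [map_zero, mode_zero]
  · intro v w hv hw; rw [map_add, mode_add, hv, hw]
  · intro c v hv; rw [map_smul, mode_smul, hv]

/-- The translation operator `v ↦ v_(-2) vac`. -/
def translation (YV : D.Space →ₗ[ℂ] VertexOperator ℂ D.Space) : Module.End ℂ D.Space where
  toFun v := ((YV v)[[-2]]) D.vac
  map_add' v w := by rw [map_add, mode_add]
  map_smul' c v := by rw [map_smul, mode_smul]; rfl

theorem translation_apply (v : D.Space) : translation YV v = ((YV v)[[-2]]) D.vac := rfl

theorem translation_vac (hY : ∀ l, YV (D.state l) = D.fieldWord D.genField l) :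
    translation YV D.vac = 0 := by
  have : YV D.vac = idField D.Space := hY []
  rw [translation_apply, this, idField_mode, if_neg (by omega)]

theorem translation_mem (hY : ∀ l, YV (D.state l) = D.fieldWord D.genField l) {p : ZMod 2}
    {v : D.Space} (hv : v ∈ D.vertex.part p) : translation YV v ∈ D.vertex.part p := by
  have := stateField_mode_mem hY hv (D.state_mem_part []) (-2)
  rwa [wordParity, add_zero] at this

/-- Translation acts on the modes as the derivative acts on the generating fields; this makes
induction over words possible. -/
theorem translation_sym_smul (hY : ∀ l, YV (D.state l) = D.fieldWord D.genField l) (x : G)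
    (n : ℤ) (v : D.Space) : translation YV (sym x n • v)
      = sym x n • translation YV v + (-n : ℂ) • sym x (n - 1) • v := by
  refine state_induction v (fun l => ?_) ?_ ?_ ?_
  · have h2 : ∀ j : ℕ, ((D.genField x)[[(j : ℤ)]]) D.vac = 0 := fun j => by
      rw [genField_mode, D.sym_vac _ _ (by omega)]
    rw [translation_apply, translation_apply, stateField_sym_smul hY x n (D.state_mem_part l),
      nthProd_mode]
    simp only [h2, map_zero, smul_zero, finsum_zero, sub_zero, genField_mode]
    -- The modes `-2 + j` kill the vacuum for `j ≥ 2`; `j = 0` gives the translated state and `j =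
    -- 1` the state itself.
    rw [EvZero.finsum_eq (K := 2), Finset.sum_range_succ, Finset.sum_range_one]
    · simp [sgnChoose, stateField_vac_neg_one hY]
    · intro j hj
      rw [stateField_vac_of_nonneg hY _ (by omega), smul_zero, smul_zero]
  · simp
  · intro v w hv hw
    simp only [smul_add, map_add, hv, hw]
    abel
  · intro c v hv
    rw [smul_comm, map_smul, hv, map_smul, smul_add, smul_comm c (sym x n),
      smul_comm c (-n : ℂ), smul_comm c (sym x (n - 1))]

end Vacuum

/-! ### Jacobi identity for the reconstructed fields -/

section Reconstruction

variable {W : Type*} [AddCommGroup W] [Module ℂ W] {X : G → VertexOperator ℂ W}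
  {YV : D.Space →ₗ[ℂ] VertexOperator ℂ D.Space} {YW : D.Space →ₗ[ℂ] VertexOperator ℂ W}

theorem derivField_add (A B : VertexOperator ℂ W) :
    derivField (A + B) = derivField A + derivField B := by
  refine field_ext fun n w => ?_
  simp only [mode_add, derivField_mode, smul_add]

theorem derivField_smul (c : ℂ) (A : VertexOperator ℂ W) :
    derivField (c • A) = c • derivField A := by
  refine field_ext fun n w => ?_
  simp only [mode_smul, derivField_mode]
  rw [smul_comm]

/-- Both sides satisfy the Leibniz rule for products with a generating field, so induction over
words applies. -/
theorem stateField_translation (hYV : ∀ l, YV (D.state l) = D.fieldWord D.genField l)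
    (hYW : ∀ l, YW (D.state l) = D.fieldWord X l) (a : D.Space) :
    YW (translation YV a) = derivField (YW a) := by
  refine state_induction a (fun l => ?_) ?_ ?_ ?_
  · induction l with
    | nil =>
      have h : YW D.vac = idField W := hYW []
      rw [state, translation_vac hYV, map_zero, h, derivField_id]
    | cons p l ih =>
      have hl := D.state_mem_part l
      rw [state, translation_sym_smul hYV, map_add, LinearMap.map_smul YW,
        stateField_sym_smul hYW _ _ (translation_mem hYV hl), stateField_sym_smul hYW _ _ hl,
        stateField_sym_smul hYW _ _ hl, ih, derivField_nthProd, nthProd_derivField_left, add_comm]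
  · rw [map_zero, map_zero]
    exact (field_ext fun n w => by rw [derivField_mode, mode_zero, mode_zero, smul_zero])
  · intro v w hv hw; rw [map_add, map_add, map_add, hv, hw, derivField_add]
  · intro c v hv; rw [map_smul, map_smul, map_smul, hv, derivField_smul]

/-- The base case, for `b` the vacuum, of `Y_W(a_(n) b) = Y_W(a)_(n) Y_W(b)`. From `n = -1` one
descends by replacing `a` with its translate, which multiplies both sides by `-n`. -/
theorem stateField_mode_vac (hYV : ∀ l, YV (D.state l) = D.fieldWord D.genField l)
    (hYW : ∀ l, YW (D.state l) = D.fieldWord X l) (a : D.Space) (n : ℤ) :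
    YW (((YV a)[[n]]) D.vac) = nthProd 1 (YW a) n (idField W) := by
  rcases le_or_gt 0 n with hn | hn
  · rw [stateField_vac_of_nonneg hYV a hn, map_zero, nthProd_id_of_nonneg _ hn]
  · obtain ⟨k, rfl⟩ : ∃ k : ℕ, n = -1 - k := ⟨(-1 - n).toNat, by omega⟩
    clear hn
    induction k generalizing a with
    | zero => simp [stateField_vac_neg_one hYV, nthProd_neg_one_id]
    | succ k ih =>
      have h := ih (translation YV a)
      rw [stateField_translation hYV hYV, stateField_translation hYV hYW, derivField_mode,
        nthProd_derivField_left, map_smul] at h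
      -- The factor picked up in passing from `n` to `n - 1` is invertible because `n < 0`.
      have hk : (-((-1 - (k : ℤ) : ℤ) : ℂ)) ≠ 0 := by
        have : (-1 - (k : ℤ)) ≠ 0 := by omega
        exact neg_ne_zero.2 (by exact_mod_cast this)
      have e : (-1 : ℤ) - ((k + 1 : ℕ) : ℤ) = -1 - k - 1 := by push_cast; ring
      rw [e]
      exact smul_right_injective _ hk h

/-- Induction on the word of `b`, with `a` arbitrary. Moving `x_(m)` past `a_(n)` produces the
states `x_(s) a`, to which the inductive hypothesis applies; the same exchange is valid for fields
on `W`. -/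
theorem stateField_mode (hD : D.Realizes X) (hYV : ∀ l, YV (D.state l) = D.fieldWord D.genField l)
    (hYW : ∀ l, YW (D.state l) = D.fieldWord X l) {p : ZMod 2} {a : D.Space}
    (ha : a ∈ D.vertex.part p) (n : ℤ) (l : List (G × ℤ)) :
    YW (((YV a)[[n]]) (D.state l))
      = nthProd (koszul p (D.wordParity l)) (YW a) n (YW (D.state l)) := by
  induction l generalizing p a n with
  | nil =>
    have h : YW D.vac = idField W := hYW []
    rw [state, stateField_mode_vac hYV hYW, h, wordParity, koszul_zero_right]
  | cons y l ih =>
    obtain ⟨x, m⟩ := y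
    obtain ⟨N, hN⟩ := D.sym_trunc a x
    have hl := D.state_mem_part l
    have hgenV : ∀ s : ℕ, nthProd (koszul (D.parity x) p) (D.genField x) s (YV a)
        = YV (sym x s • a) := fun s => (stateField_sym_smul hYV x s ha).symm
    have hgenW : ∀ s : ℕ, nthProd (koszul (D.parity x) p) (X x) s (YW a)
        = YW (sym x s • a) := fun s => (stateField_sym_smul hYW x s ha).symm
    have hx : D.state [(x, -1)] ∈ D.vertex.part (D.parity x) := by
      simpa [wordParity] using D.state_mem_part [(x, -1)]
    have hVx : YV (D.state [(x, -1)]) = D.genField x := by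
      rw [hYV]; simp [fieldWord, wordParity, nthProd_neg_one_id]
    have hWx : YW (D.state [(x, -1)]) = X x := by
      rw [hYW]; simp [fieldWord, wordParity, nthProd_neg_one_id]
    have hlocV : Local (koszul (D.parity x) p) (D.genField x) (YV a) :=
      hVx ▸ stateField_local D.genField_realizes hYV hx ha
    have hlocW : Local (koszul (D.parity x) p) (X x) (YW a) :=
      hWx ▸ stateField_local hD hYW hx ha
    -- The exchange inside the vertex superalgebra, followed in `hW` by the same exchange for
    -- products of fields on `W`.
    have hV := hlocV.commutator m n (D.state l)
    simp only [hgenV, genField_mode] at hV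
    rw [EvZero.finsum_eq (K := N.toNat) fun s hs => by
      rw [hN s (by omega), map_zero, mode_zero, smul_zero] ] at hV
    have hW := nthProd_comm (η := koszul (D.parity x) (D.wordParity l))
      (θ := koszul p (D.wordParity l)) (koszul_mul_self (D.parity x) p) (A := X x) (B := YW a)
      (Z := fun s => YW (sym x s • a)) (S := N.toNat) (fun i j w => by
        rw [hlocW.commutator]
        simp only [hgenW]
        rw [EvZero.finsum_eq (K := N.toNat) fun s hs => by
          rw [hN s (by omega), map_zero, mode_zero, smul_zero] ]) (YW (D.state l)) m n
    have hV' := congrArg YW hV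
    rw [map_sub, LinearMap.map_smul YW, map_sum,
      stateField_sym_smul hYW x m (stateField_mode_mem hYV ha hl n), ih ha,
      Finset.sum_congr rfl fun s _ => by
        rw [LinearMap.map_smul YW, ih (sym_smul_mem_part x s ha), koszul_add_left], ← hW, koszul_add_right,
      sub_right_inj, koszul_comm (D.parity x) p] at hV'
    -- After subtracting the terms known by induction, the claim is left multiplied by a sign, which
    -- is cancelled.
    have hne : koszul p (D.parity x) ≠ 0 := by
      intro h0
      have := koszul_mul_self p (D.parity x)
      rw [h0, zero_mul] at this
      exact zero_ne_one this
    rw [state, stateField_sym_smul hYW x m hl, wordParity, koszul_add_right]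
    exact smul_right_injective _ hne hV'

/-- A vacuum module whose state-field correspondence is given by iterated products of fields is a
module over the vertex superalgebra. -/
theorem isModule_of_fieldWord (hD : D.Realizes X)
    (hYV : ∀ l, D.vertex.Y (D.state l) = D.fieldWord D.genField l)
    (hYW : ∀ l, YW (D.state l) = D.fieldWord X l) : IsModule D.vertex YW := by
  refine ⟨hYW [], fun p q a ha b hb m n k w => ?_⟩
  have h : ∀ n : ℤ, YW (((D.vertex.Y a)[[n]]) b) = nthProd (koszul p q) (YW a) n (YW b) := by
    intro n
    induction hb using Submodule.span_induction with
    | mem b hb =>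
      obtain ⟨l, rfl, rfl⟩ := hb
      exact stateField_mode hD hYV hYW ha n l
    | zero => rw [map_zero, map_zero, nthProd_zero_right]
    | add a b _ _ ha hb => rw [map_add, map_add, map_add, ha, hb, nthProd_add_right]
    | smul c b _ hb => rw [map_smul, map_smul, map_smul, hb, nthProd_smul_right]
  simp only [h]
  exact (stateField_local hD hYW ha hb).jacobi m n k w

end Reconstruction

/-! ### Modules are determined by their generating fields -/

section Modules

variable {W : Type*} [AddCommGroup W] [Module ℂ W] {YW : D.Space →ₗ[ℂ] VertexOperator ℂ W}

/-- The case `m = 0` of the Jacobi identity, where only `j = 0` survives on the left. -/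
theorem _root_.VertexTheory.IsModule.mode_apply {V : Type*} [AddCommGroup V] [Module ℂ V]
    {𝒱 : VertexSuperData V} {YW : V →ₗ[ℂ] VertexOperator ℂ W} (h : IsModule 𝒱 YW) {p q : ZMod 2}
    {a b : V} (ha : a ∈ 𝒱.part p) (hb : b ∈ 𝒱.part q) (n : ℤ) :
    YW (((𝒱.Y a)[[n]]) b) = nthProd (koszul p q) (YW a) n (YW b) := by
  refine field_ext fun k w => ?_
  have h1 := h.2 p q a ha b hb 0 n k w
  have h2 := finsum_intChoose_zero fun j : ℕ => ((YW (((𝒱.Y a)[[n + j]]) b))[[0 + k - j]]) w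
  rw [nthProd_mode_eq_jac]
  refine Eq.trans ?_ h1
  refine Eq.trans ?_ h2.symm
  simp

/-- The case `n = 0` of the Jacobi identity. -/
theorem _root_.VertexTheory.IsModule.commutator {V : Type*} [AddCommGroup V] [Module ℂ V]
    {𝒱 : VertexSuperData V} {YW : V →ₗ[ℂ] VertexOperator ℂ W} (h : IsModule 𝒱 YW) {p q : ZMod 2}
    {a b : V} (ha : a ∈ 𝒱.part p) (hb : b ∈ 𝒱.part q) (m k : ℤ) (w : W) :
    ((YW a)[[m]]) (((YW b)[[k]]) w) - koszul p q • ((YW b)[[k]]) (((YW a)[[m]]) w)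
      = ∑ᶠ j : ℕ, intChoose m j • ((YW (((𝒱.Y a)[[(j : ℤ)]]) b))[[m + k - j]]) w := by
  have h1 := h.2 p q a ha b hb m 0 k w
  simp only [zero_add] at h1
  rw [← jac_zero]
  exact (Eq.trans h1 (by simp [jac])).symm

theorem vertex_Y_gen (hYV : ∀ l, D.vertex.Y (D.state l) = D.fieldWord D.genField l) (x : G) :
    D.vertex.Y (D.state [(x, -1)]) = D.genField x := by
  rw [hYV]
  simp [fieldWord, wordParity, nthProd_neg_one_id]

theorem gen_mem_part (D : LinearOPE G) (x : G) :
    D.state [(x, -1)] ∈ D.vertex.part (D.parity x) := by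
  simpa [wordParity] using D.state_mem_part [(x, -1)]

theorem fieldWord_of_isModule (hYV : ∀ l, D.vertex.Y (D.state l) = D.fieldWord D.genField l)
    (h : IsModule D.vertex YW) (l : List (G × ℤ)) :
    YW (D.state l) = D.fieldWord (fun x => YW (D.state [(x, -1)])) l := by
  induction l with
  | nil => exact h.1
  | cons y l ih =>
    have := h.mode_apply (D.gen_mem_part y.1) (D.state_mem_part l) y.2
    rw [vertex_Y_gen hYV, genField_mode] at this
    rw [state, fieldWord, this, ih]

/-- The commutator involves only the states `x_(j) y_(-1) vac`, and these are read off from the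
defining relations. -/
theorem realizes_of_isModule (hYV : ∀ l, D.vertex.Y (D.state l) = D.fieldWord D.genField l)
    (h : IsModule D.vertex YW) : D.Realizes fun x => YW (D.state [(x, -1)]) := by
  rw [realizes_iff]
  intro x y n m w
  have h0 : YW D.vac = idField W := h.1
  have h1 := h.commutator (D.gen_mem_part x) (D.gen_mem_part y) n m w
  have h2 : ∀ j : ℕ, sym x (j : ℤ) • D.state [(y, -1)]
      = ∑ z, D.bracket x y z • sym z ((j : ℤ) - 1) • D.vac
        + (if j = 0 then D.form₀ x y else 0) • D.vac
        + (if j = 1 then D.form₁ x y else 0) • D.vac := by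
    intro j
    have e1 : (j : ℤ) + -1 + 1 = 0 ↔ j = 0 := by omega
    have e2 : (j : ℤ) + -1 = 0 ↔ j = 1 := by omega
    simp only [state]
    rw [D.sym_comm, D.sym_vac x j (by omega), smul_zero, smul_zero, zero_add]
    simp only [e1, e2]
    congr 2
    split_ifs with hj
    · simp [hj]
    · rfl
  -- For `j ≥ 2` the bracket term has mode `j - 1 ≥ 0`, which kills the vacuum, and both central
  -- terms are absent.
  have h3 : ∀ j : ℕ, 2 ≤ j → sym x (j : ℤ) • D.state [(y, -1)] = 0 := by
    intro j hj
    rw [h2, if_neg (by omega), if_neg (by omega), zero_smul, add_zero, add_zero]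
    refine Finset.sum_eq_zero fun z _ => ?_
    rw [D.sym_vac _ _ (by omega), smul_zero]
  rw [vertex_Y_gen hYV, EvZero.finsum_eq (K := 2) fun j hj => by
    rw [genField_mode, h3 j hj, map_zero, mode_zero, smul_zero], Finset.sum_range_succ,
    Finset.sum_range_one, genField_mode, genField_mode, h2, h2] at h1
  rw [sub_eq_iff_eq_add'] at h1
  rw [h1]
  have e1 : n + m = -1 ↔ n + m + 1 = 0 := by omega
  have e2 : n + m - 1 = -1 ↔ n + m = 0 := by omega
  have h4 : ∀ z, sym z 0 • D.vac = 0 := fun z => D.sym_vac z 0 le_rfl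
  have h5 : ∀ z, sym z (-1) • D.vac = D.state [(z, -1)] := fun z => rfl
  simp only [Nat.cast_zero, Nat.cast_one, zero_sub, sub_self, if_true, h4, h5, one_ne_zero,
    zero_ne_one, if_false, zero_smul, smul_zero, Finset.sum_const_zero, zero_add, add_zero]
  simp only [map_add YW, map_sum YW, LinearMap.map_smul YW, h0]
  simp only [mode_add, mode_sum, mode_smul, idField_mode, intChoose_zero_right,
    intChoose_one_right, one_smul, sub_zero, e1, e2]
  split_ifs <;> module

theorem isModule_unique (hYV : ∀ l, D.vertex.Y (D.state l) = D.fieldWord D.genField l)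
    {Y₁ Y₂ : D.Space →ₗ[ℂ] VertexOperator ℂ W} (h₁ : IsModule D.vertex Y₁)
    (h₂ : IsModule D.vertex Y₂)
    (h : ∀ x, Y₁ (D.state [(x, -1)]) = Y₂ (D.state [(x, -1)])) : Y₁ = Y₂ := by
  refine LinearMap.ext fun v => ?_
  refine state_induction v (fun l => ?_) ?_ ?_ ?_
  · rw [fieldWord_of_isModule hYV h₁, fieldWord_of_isModule hYV h₂, funext h]
  · rw [map_zero, map_zero]
  · intro v w hv hw; rw [map_add, map_add, hv, hw]
  · intro c v hv; rw [map_smul, map_smul, hv]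

/-- A subspace stable under the modes of the generating fields is a submodule. -/
theorem isStable_of_gen (hYV : ∀ l, D.vertex.Y (D.state l) = D.fieldWord D.genField l)
    (h : IsModule D.vertex YW) {S : Submodule ℂ W}
    (hS : ∀ x n, ∀ w ∈ S, ((YW (D.state [(x, -1)]))[[n]]) w ∈ S) : IsStable YW S := by
  intro a n w hw
  refine state_induction a (fun l => ?_) ?_ ?_ ?_
  · rw [fieldWord_of_isModule hYV h]
    induction l generalizing n w with
    | nil =>
      rw [fieldWord, idField_mode]
      split_ifs
      · exact hw
      · exact Submodule.zero_mem _
    | cons p l ih =>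
      exact nthProd_mem (hS p.1) (fun n w hw => ih n w hw) _ _ hw
  · rw [map_zero, mode_zero]; exact Submodule.zero_mem _
  · intro v w hv hw; rw [map_add, mode_add]; exact Submodule.add_mem _ hv hw
  · intro c v hv; rw [map_smul, mode_smul]; exact Submodule.smul_mem _ _ hv

end Modules

end LinearOPE

/-! ### Eigenvectors in stable subspaces -/

section Eigen

variable {U : Type*} [AddCommGroup U] [Module ℂ U]

/-- A Vandermonde argument by induction: subtracting `c j` times the `k`-th sum from the next one
eliminates the term `j` and rescales the others by nonzero factors. -/
theorem mem_of_sum_pow_smul_mem {ι : Type*} [DecidableEq ι] {T : Submodule ℂ U} {c : ι → ℂ}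
    (hc : Function.Injective c) (s : Finset ι) {u : ι → U}
    (h : ∀ k : ℕ, ∑ i ∈ s, c i ^ k • u i ∈ T) : ∀ i ∈ s, u i ∈ T := by
  induction s using Finset.induction_on generalizing u with
  | empty => simp
  | insert j s hj ih =>
    have h1 : ∀ i ∈ s, (c i - c j) • u i ∈ T := by
      refine ih (u := fun i => (c i - c j) • u i) fun k => ?_
      have h2 := Submodule.sub_mem _ (h (k + 1)) (Submodule.smul_mem _ (c j) (h k))
      rw [Finset.sum_insert hj, Finset.sum_insert hj, smul_add, Finset.smul_sum] at h2
      convert h2 using 1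
      have h3 : ∀ i, c i ^ k • (c i - c j) • u i = c i ^ (k + 1) • u i - c j • c i ^ k • u i := by
        intro i
        rw [pow_succ]
        module
      rw [Finset.sum_congr rfl fun i _ => h3 i, Finset.sum_sub_distrib, pow_succ]
      module
    have h2 : ∀ i ∈ s, u i ∈ T := fun i hi => by
      have hne : c i - c j ≠ 0 := sub_ne_zero.2 fun h => hj (hc h ▸ hi)
      have := Submodule.smul_mem _ (c i - c j)⁻¹ (h1 i hi)
      rwa [smul_smul, inv_mul_cancel₀ hne, one_smul] at this
    intro i hi
    rcases Finset.mem_insert.1 hi with rfl | hi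
    · have h3 := h 0
      rw [Finset.sum_insert hj] at h3
      have h4 : ∑ i ∈ s, c i ^ 0 • u i ∈ T :=
        Submodule.sum_mem _ fun i hi => Submodule.smul_mem _ _ (h2 i hi)
      simpa using Submodule.sub_mem _ h3 h4
    · exact h2 i hi

/-- Applying powers of `d` to a vector and separating eigenvalues puts all its eigencomponents into
`T`. -/
theorem exists_eigenvector_mem {d : Module.End ℂ U}
    (hd : ⨆ k : ℕ, d.eigenspace (k : ℂ) = ⊤) {T : Submodule ℂ U} (hT : ∀ v ∈ T, d v ∈ T)
    (hne : T ≠ ⊥) : ∃ k : ℕ, ∃ v ∈ T, v ≠ 0 ∧ d v = (k : ℂ) • v := by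
  obtain ⟨u, hu, hu0⟩ := Submodule.exists_mem_ne_zero_of_ne_bot hne
  have h1 : u ∈ ⨆ k : ℕ, d.eigenspace (k : ℂ) := by rw [hd]; trivial
  obtain ⟨f, hf, hsum⟩ := (Submodule.mem_iSup_iff_exists_finsupp _ _).1 h1
  have hf' : ∀ i, d (f i) = (i : ℂ) • f i := fun i => Module.End.mem_eigenspace_iff.1 (hf i)
  have h2 : ∀ k : ℕ, (d ^ k) u ∈ T := by
    intro k
    induction k with
    | zero => exact hu
    | succ k ih => rw [pow_succ']; exact hT _ ih
  have h3 : ∀ k i : ℕ, (d ^ k) (f i) = ((i : ℂ)) ^ k • f i := by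
    intro k i
    induction k with
    | zero => simp
    | succ k ih => rw [pow_succ', Module.End.mul_apply, ih, map_smul, hf', smul_smul, pow_succ]
  have h4 := mem_of_sum_pow_smul_mem (T := T) (c := fun i : ℕ => (i : ℂ)) Nat.cast_injective
    f.support (u := f) fun k => by
      have := h2 k
      rw [← hsum, Finsupp.sum, map_sum] at this
      simpa only [h3] using this
  have hne0 : f ≠ 0 := by
    rintro rfl
    exact hu0 (by rw [← hsum]; rfl)
  obtain ⟨i, hi⟩ := Finsupp.support_nonempty_iff.2 hne0
  exact ⟨i, f i, h4 i hi, Finsupp.mem_support_iff.1 hi, hf' i⟩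

/-- Eigenspaces are independent, and those with eigenvalue in `s` already fill the space. -/
theorem eigenspace_eq_bot_of_notMem {d : Module.End ℂ U} {s : Set ℂ}
    (hd : ⨆ μ ∈ s, d.eigenspace μ = ⊤) {μ : ℂ} (hμ : μ ∉ s) : d.eigenspace μ = ⊥ := by
  have h := d.eigenspaces_iSupIndep μ
  rw [disjoint_iff_inf_le] at h
  rw [eq_bot_iff]
  refine le_trans (le_inf le_rfl ?_) h
  refine le_trans le_top (hd ▸ ?_)
  exact iSup₂_le fun ν hν => le_iSup₂_of_le ν (fun h => hμ (h ▸ hν)) le_rfl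

end Eigen

/-! ### Vacuum modules -/

namespace LinearOPE

variable {G : Type} [Fintype G] {D : LinearOPE G}
variable {U : Type*} [AddCommGroup U] [Module ℂ U] {X : G → VertexOperator ℂ U}

/-- Fields satisfying the relations of `D` on a space generated by a subspace annihilated by all
modes with nonnegative index. -/
structure IsVacuum (D : LinearOPE G) (X : G → VertexOperator ℂ U) (U₀ : Submodule ℂ U) :
    Prop where
  realizes : D.Realizes X
  annihilates : ∀ x (n : ℤ), 0 ≤ n → ∀ v ∈ U₀, ((X x)[[n]]) v = 0
  generates : ∀ S : Submodule ℂ U, U₀ ≤ S → (∀ x n, ∀ v ∈ S, ((X x)[[n]]) v ∈ S) → S = ⊤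

/-- The result of applying a word in the modes to a vector. -/
def applyWord (X : G → VertexOperator ℂ U) (v : U) : List (G × ℤ) → U
  | [] => v
  | p :: l => ((X p.1)[[p.2]]) (applyWord X v l)

/-- The easy half of a Poincaré–Birkhoff–Witt theorem: modes with nonnegative index are commuted to
the right until they hit the vacuum subspace. -/
theorem IsVacuum.span_negative {U₀ : Submodule ℂ U} (h : D.IsVacuum X U₀) :
    Submodule.span ℂ {u | ∃ v ∈ U₀, ∃ l : List (G × ℤ), (∀ p ∈ l, p.2 < 0) ∧ u = applyWord X v l}
      = ⊤ := by
  set S := Submodule.span ℂ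
    {u | ∃ v ∈ U₀, ∃ l : List (G × ℤ), (∀ p ∈ l, p.2 < 0) ∧ u = applyWord X v l} with hS
  have hneg : ∀ x (n : ℤ), n < 0 → ∀ u ∈ S, ((X x)[[n]]) u ∈ S := by
    intro x n hn u hu
    induction hu using Submodule.span_induction with
    | mem u hu =>
      obtain ⟨v, hv, l, hl, rfl⟩ := hu
      refine Submodule.subset_span ⟨v, hv, (x, n) :: l, ?_, rfl⟩
      intro p hp
      rcases List.mem_cons.1 hp with rfl | hp
      · exact hn
      · exact hl p hp
    | zero => rw [map_zero]; exact Submodule.zero_mem _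
    | add a b _ _ ha hb => rw [map_add]; exact Submodule.add_mem _ ha hb
    | smul c b _ hb => rw [map_smul]; exact Submodule.smul_mem _ _ hb
  refine h.generates S ?_ ?_
  · exact fun v hv => Submodule.subset_span ⟨v, hv, [], by simp, rfl⟩
  intro x n u hu
  induction hu using Submodule.span_induction with
  | mem u hu =>
    obtain ⟨v, hv, l, hl, rfl⟩ := hu
    induction l generalizing x n with
    | nil =>
      rcases lt_or_ge n 0 with hn | hn
      · exact hneg x n hn v (Submodule.subset_span ⟨v, hv, [], by simp, rfl⟩)
      · rw [applyWord, h.annihilates x n hn v hv]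
        exact Submodule.zero_mem _
    | cons p l ih =>
      have hl' : ∀ p ∈ l, p.2 < 0 := fun q hq => hl q (List.mem_cons_of_mem _ hq)
      have hmem : applyWord X v l ∈ S := Submodule.subset_span ⟨v, hv, l, hl', rfl⟩
      rw [applyWord, realizes_iff.1 h.realizes]
      refine Submodule.add_mem _ (Submodule.add_mem _ (Submodule.add_mem _ ?_ ?_) ?_) ?_
      · exact Submodule.smul_mem _ _
          (hneg p.1 p.2 (hl p List.mem_cons_self) _ (ih x n hl'))
      · exact Submodule.sum_mem _ fun z _ => Submodule.smul_mem _ _ (ih z _ hl')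
      · exact Submodule.smul_mem _ _ hmem
      · exact Submodule.smul_mem _ _ hmem
  | zero => rw [map_zero]; exact Submodule.zero_mem _
  | add a b _ _ ha hb => rw [map_add]; exact Submodule.add_mem _ ha hb
  | smul c b _ hb => rw [map_smul]; exact Submodule.smul_mem _ _ hb

/-- `d` is a degree operator: it vanishes on the vacuum subspace and the mode with index `n` has
degree `wt n`, which is positive for `n < 0`. -/
structure IsDegree (X : G → VertexOperator ℂ U) (U₀ : Submodule ℂ U) (d : Module.End ℂ U)
    (wt : ℤ → ℤ) : Prop where
  pos : ∀ n, n < 0 → 0 < wt n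
  comm : ∀ x n w, d (((X x)[[n]]) w) = ((X x)[[n]]) (d w) + (wt n : ℂ) • ((X x)[[n]]) w
  vac : ∀ v ∈ U₀, d v = 0

theorem IsDegree.mode_mem {U₀ : Submodule ℂ U} {d : Module.End ℂ U} {wt : ℤ → ℤ}
    (hd : IsDegree X U₀ d wt) {μ : ℂ} {v : U} (hv : d v = μ • v) (x : G) (n : ℤ) :
    d (((X x)[[n]]) v) = (μ + wt n) • ((X x)[[n]]) v := by
  rw [hd.comm, hv, map_smul, add_smul]

theorem IsDegree.applyWord {U₀ : Submodule ℂ U} {d : Module.End ℂ U} {wt : ℤ → ℤ}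
    (hd : IsDegree X U₀ d wt) {v : U} (hv : v ∈ U₀) {l : List (G × ℤ)} (hl : ∀ p ∈ l, p.2 < 0)
    (hne : l ≠ []) : ∃ k : ℕ, d (applyWord X v l) = ((k + 1 : ℕ) : ℂ) • applyWord X v l := by
  induction l with
  | nil => exact absurd rfl hne
  | cons p l ih =>
    have hp := hd.pos p.2 (hl p List.mem_cons_self)
    by_cases h0 : l = []
    · subst h0
      have hd0 : d v = (0 : ℂ) • v := by rw [hd.vac v hv, zero_smul]
      refine ⟨(wt p.2).toNat - 1, ?_⟩
      rw [LinearOPE.applyWord, LinearOPE.applyWord, hd.mode_mem hd0, zero_add]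
      congr 1
      have : (((wt p.2).toNat - 1 + 1 : ℕ) : ℤ) = wt p.2 := by omega
      exact_mod_cast congrArg (Int.cast : ℤ → ℂ) this.symm
    · obtain ⟨k, hk⟩ := ih (fun q hq => hl q (List.mem_cons_of_mem _ hq)) h0
      refine ⟨k + (wt p.2).toNat, ?_⟩
      rw [LinearOPE.applyWord, hd.mode_mem hk]
      congr 1
      have : ((k + 1 : ℕ) : ℤ) + wt p.2 = ((k + (wt p.2).toNat + 1 : ℕ) : ℤ) := by
        push_cast
        omega
      exact_mod_cast congrArg (Int.cast : ℤ → ℂ) this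

theorem IsVacuum.sup_eigenspace {U₀ : Submodule ℂ U} (h : D.IsVacuum X U₀) {d : Module.End ℂ U}
    {wt : ℤ → ℤ} (hd : IsDegree X U₀ d wt) :
    U₀ ⊔ ⨆ k : ℕ, d.eigenspace ((k + 1 : ℕ) : ℂ) = ⊤ := by
  rw [eq_top_iff, ← h.span_negative, Submodule.span_le]
  rintro _ ⟨v, hv, l, hl, rfl⟩
  by_cases h0 : l = []
  · subst h0
    exact Submodule.mem_sup_left hv
  · obtain ⟨k, hk⟩ := hd.applyWord hv hl h0
    exact Submodule.mem_sup_right (Submodule.mem_iSup_of_mem k (Module.End.mem_eigenspace_iff.2 hk))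

/-- All nonempty words with negative indices have positive degree, so degree zero leaves only the
vacuum subspace. -/
theorem IsVacuum.mem_of_degree_zero {U₀ : Submodule ℂ U} (h : D.IsVacuum X U₀)
    {d : Module.End ℂ U} {wt : ℤ → ℤ} (hd : IsDegree X U₀ d wt) {v : U} (hv : d v = 0) :
    v ∈ U₀ := by
  have h1 : v ∈ U₀ ⊔ ⨆ k : ℕ, d.eigenspace ((k + 1 : ℕ) : ℂ) := by
    rw [h.sup_eigenspace hd]
    trivial
  obtain ⟨u, hu, r, hr, rfl⟩ := Submodule.mem_sup.1 h1
  have hr0 : r ∈ d.eigenspace 0 := by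
    rw [map_add, hd.vac u hu, zero_add] at hv
    rw [Module.End.mem_eigenspace_iff, hv, zero_smul]
  have h2 := d.eigenspaces_iSupIndep 0
  have h3 : ⨆ k : ℕ, d.eigenspace ((k + 1 : ℕ) : ℂ) ≤ ⨆ (j : ℂ) (_ : j ≠ 0), d.eigenspace j :=
    iSup_le fun k => le_iSup₂_of_le ((k + 1 : ℕ) : ℂ) (Nat.cast_ne_zero.2 k.succ_ne_zero) le_rfl
  have h4 := (Submodule.disjoint_def.1 h2) r hr0 (h3 hr)
  rw [h4, add_zero]
  exact hu

theorem IsVacuum.iSup_eigenspace {U₀ : Submodule ℂ U} (h : D.IsVacuum X U₀)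
    {d : Module.End ℂ U} {wt : ℤ → ℤ} (hd : IsDegree X U₀ d wt) :
    ⨆ k : ℕ, d.eigenspace (k : ℂ) = ⊤ := by
  rw [eq_top_iff, ← h.sup_eigenspace hd]
  refine sup_le ?_ (iSup_le fun k => le_iSup (fun k : ℕ => d.eigenspace (k : ℂ)) (k + 1))
  intro v hv
  refine Submodule.mem_iSup_of_mem 0 (Module.End.mem_eigenspace_iff.2 ?_)
  rw [hd.vac v hv, Nat.cast_zero, zero_smul]

/-- If only vectors of degree zero are annihilated by all modes of negative degree, then every
nonzero submodule meets the vacuum subspace. -/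
theorem IsVacuum.inf_ne_bot {U₀ : Submodule ℂ U} (h : D.IsVacuum X U₀)
    {d : Module.End ℂ U} {wt : ℤ → ℤ} (hd : IsDegree X U₀ d wt)
    (hlow : ∀ (k : ℕ) (v : U), v ≠ 0 → d v = (k : ℂ) • v →
      (∀ x n, wt n < 0 → ((X x)[[n]]) v = 0) → k = 0)
    {T : Submodule ℂ U} (hT : ∀ x n, wt n < 0 → ∀ v ∈ T, ((X x)[[n]]) v ∈ T)
    (hTd : ∀ v ∈ T, d v ∈ T) (hne : T ≠ ⊥) : ∃ v ∈ T, v ∈ U₀ ∧ v ≠ 0 := by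
  classical
  have hsup := h.iSup_eigenspace hd
  -- `Nat.find` selects an eigenvector in `T` of least degree.
  have hex := exists_eigenvector_mem hsup hTd hne
  obtain ⟨v, hvT, hv0, hv⟩ := Nat.find_spec hex
  have hk : Nat.find hex = 0 := by
    refine hlow _ v hv0 hv fun x n hn => ?_
    by_contra hxv
    have h1 := hd.mode_mem hv x n
    -- A nonzero image under a mode of negative degree would contradict minimality, or else would
    -- have a negative degree, which does not occur.
    by_cases hs : 0 ≤ (Nat.find hex : ℤ) + wt n
    · obtain ⟨j, hj⟩ := Int.eq_ofNat_of_zero_le hs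
      refine Nat.find_min hex (m := j) (by omega) ⟨_, hT x n hn v hvT, hxv, ?_⟩
      rw [h1]
      congr 1
      exact_mod_cast congrArg (Int.cast : ℤ → ℂ) hj
    · have h2 := eigenspace_eq_bot_of_notMem (d := d) (s := Set.range fun k : ℕ => (k : ℂ))
        (by rw [iSup_range]; exact hsup) (μ := (Nat.find hex : ℂ) + wt n) (by
          rintro ⟨j, hj⟩
          have hj' : (j : ℂ) = (Nat.find hex : ℂ) + wt n := hj
          have : (j : ℤ) = (Nat.find hex : ℤ) + wt n := by exact_mod_cast hj'
          omega)
      have h3 := Module.End.mem_eigenspace_iff.2 h1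
      rw [h2] at h3
      exact hxv h3
  rw [hk, Nat.cast_zero, zero_smul] at hv
  exact ⟨v, hvT, h.mem_of_degree_zero hd hv, hv0⟩

/-! ### The universal vacuum module -/

/-- The universal module generated by a vacuum vector. -/
def Univ (D : LinearOPE G) : Type := FreeModes G ⧸ D.vacIdeal

instance (D : LinearOPE G) : AddCommGroup D.Univ :=
  inferInstanceAs (AddCommGroup (FreeModes G ⧸ D.vacIdeal))

instance (D : LinearOPE G) : Module (FreeModes G) D.Univ :=
  inferInstanceAs (Module (FreeModes G) (FreeModes G ⧸ D.vacIdeal))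

instance (D : LinearOPE G) : Module ℂ D.Univ :=
  inferInstanceAs (Module ℂ (FreeModes G ⧸ D.vacIdeal))

instance (D : LinearOPE G) : IsScalarTower ℂ (FreeModes G) D.Univ :=
  inferInstanceAs (IsScalarTower ℂ (FreeModes G) (FreeModes G ⧸ D.vacIdeal))

/-- The projection from the free algebra onto the universal vacuum module. -/
def univProj (D : LinearOPE G) : FreeModes G →ₗ[FreeModes G] D.Univ := D.vacIdeal.mkQ

theorem univProj_surjective (D : LinearOPE G) : Function.Surjective D.univProj :=
  D.vacIdeal.mkQ_surjective

theorem univProj_eq_zero (D : LinearOPE G) (b : FreeModes G) :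
    D.univProj b = 0 ↔ b ∈ D.vacIdeal := Submodule.Quotient.mk_eq_zero _

theorem Univ.relator_smul (x y : G) (n m : ℤ) (v : D.Univ) : D.relator x y n m • v = 0 := by
  obtain ⟨b, rfl⟩ := D.univProj_surjective v
  rw [← map_smul, univProj_eq_zero]
  exact Submodule.subset_span (Or.inl ⟨x, y, n, m, b, rfl⟩)

theorem Univ.sym_vac (x : G) (n : ℤ) (hn : 0 ≤ n) : sym x n • D.univProj 1 = 0 := by
  rw [← map_smul, univProj_eq_zero, smul_eq_mul, mul_one]
  exact Submodule.subset_span (Or.inr ⟨x, n, hn, rfl⟩)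

theorem Univ.sym_comm (x y : G) (n m : ℤ) (v : D.Univ) : sym x n • sym y m • v
      = koszul (D.parity x) (D.parity y) • sym y m • sym x n • v
        + ∑ z, D.bracket x y z • sym z (n + m) • v
        + (if n + m + 1 = 0 then D.form₀ x y else 0) • v
        + (if n + m = 0 then (n : ℂ) * D.form₁ x y else 0) • v := by
  have h := Univ.relator_smul x y n m v
  simp only [LinearOPE.relator, sub_smul, mul_smul, Finset.sum_smul, smul_assoc,
    algebraMap_smul] at h
  rw [← sub_eq_zero, ← h]
  abel

theorem Univ.sym_trunc (v : D.Univ) : ∀ x : G, ∃ N : ℤ, ∀ n, N ≤ n → sym x n • v = 0 := by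
  have key : ∀ (b : FreeModes G) (v : D.Univ),
      (∀ x : G, ∃ N : ℤ, ∀ n, N ≤ n → sym x n • v = 0) →
      ∀ x : G, ∃ N : ℤ, ∀ n, N ≤ n → sym x n • b • v = 0 := by
    intro b
    induction b using FreeAlgebra.induction with
    | grade0 r =>
      intro v hv x
      obtain ⟨N, hN⟩ := hv x
      refine ⟨N, fun n hn => ?_⟩
      rw [algebraMap_smul, smul_comm, hN n hn, smul_zero]
    | grade1 ym =>
      obtain ⟨y, m⟩ := ym
      intro v hv x
      choose N hN using hv
      obtain ⟨K, hK⟩ := (Set.finite_range N).bddAbove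
      have hK' : ∀ z, N z ≤ K := fun z => hK ⟨z, rfl⟩
      refine ⟨|K| + |m| + 1, fun n hn => ?_⟩
      have h1 := le_abs_self K
      have h2 := neg_abs_le m
      have h3 := abs_nonneg K
      have h4 := abs_nonneg m
      have h := Univ.sym_comm x y n m v
      simp only [hN x n (by linarith [hK' x]), smul_zero, zero_add,
        if_neg (show n + m + 1 ≠ 0 by linarith), if_neg (show n + m ≠ 0 by linarith), zero_smul,
        add_zero] at h
      refine h.trans (Finset.sum_eq_zero fun z _ => ?_)
      rw [hN z (n + m) (by linarith [hK' z]), smul_zero]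
    | mul a b ha hb =>
      intro v hv
      rw [mul_smul]
      exact ha _ (hb v hv)
    | add a b ha hb =>
      intro v hv x
      obtain ⟨N, hN⟩ := ha v hv x
      obtain ⟨K, hK⟩ := hb v hv x
      refine ⟨max N K, fun n hn => ?_⟩
      rw [add_smul, smul_add, hN n (le_trans (le_max_left _ _) hn),
        hK n (le_trans (le_max_right _ _) hn), add_zero]
  obtain ⟨b, rfl⟩ := D.univProj_surjective v
  have h := key b (D.univProj 1) fun x => ⟨0, fun n hn => Univ.sym_vac x n hn⟩
  rwa [← map_smul, smul_eq_mul, mul_one] at h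

/-- The generating fields on the universal vacuum module. -/
def univField (D : LinearOPE G) (x : G) : VertexOperator ℂ D.Univ :=
  mkField (fun n => Algebra.lsmul ℂ ℂ D.Univ (sym x n)) (fun v => Univ.sym_trunc v x)

theorem univField_mode (D : LinearOPE G) (x : G) (n : ℤ) (v : D.Univ) :
    ((D.univField x)[[n]]) v = sym x n • v :=
  LinearMap.congr_fun (mkField_mode _ _ n) v

/-- A subspace stable under the modes is stable under the free algebra. -/
theorem freeModes_smul_mem {M : Type*} [AddCommGroup M] [Module ℂ M] [Module (FreeModes G) M]
    [IsScalarTower ℂ (FreeModes G) M] {S : Submodule ℂ M}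
    (h : ∀ x n, ∀ v ∈ S, (sym x n : FreeModes G) • v ∈ S) (b : FreeModes G) :
    ∀ v ∈ S, b • v ∈ S := by
  induction b using FreeAlgebra.induction with
  | grade0 r => intro v hv; rw [algebraMap_smul]; exact Submodule.smul_mem _ _ hv
  | grade1 p => exact fun v hv => h p.1 p.2 v hv
  | mul a b ha hb => intro v hv; rw [mul_smul]; exact ha _ (hb v hv)
  | add a b ha hb => intro v hv; rw [add_smul]; exact Submodule.add_mem _ (ha v hv) (hb v hv)

theorem univField_isVacuum (D : LinearOPE G) :
    D.IsVacuum D.univField (Submodule.span ℂ {D.univProj 1}) where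
  realizes := by
    rw [realizes_iff]
    intro x y n m w
    simp only [univField_mode]
    exact Univ.sym_comm x y n m w
  annihilates x n hn v hv := by
    obtain ⟨c, rfl⟩ := Submodule.mem_span_singleton.1 hv
    rw [map_smul, univField_mode, Univ.sym_vac x n hn, smul_zero]
  generates S hS h := by
    simp only [univField_mode] at h
    rw [eq_top_iff]
    intro v _
    obtain ⟨b, rfl⟩ := D.univProj_surjective v
    have := freeModes_smul_mem h b _ (hS (Submodule.mem_span_singleton_self _))
    rwa [← map_smul, smul_eq_mul, mul_one] at this

theorem genField_isVacuum (D : LinearOPE G) :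
    D.IsVacuum D.genField (Submodule.span ℂ {D.vac}) where
  realizes := D.genField_realizes
  annihilates x n hn v hv := by
    obtain ⟨c, rfl⟩ := Submodule.mem_span_singleton.1 hv
    rw [map_smul, genField_mode, D.sym_vac x n hn, smul_zero]
  generates S hS h := by
    simp only [genField_mode] at h
    rw [eq_top_iff]
    intro v _
    obtain ⟨b, rfl⟩ := D.proj_surjective v
    have := freeModes_smul_mem h b _ (hS (Submodule.mem_span_singleton_self _))
    rwa [D.smul_vac] at this

/-- The universal vacuum module is simple if each nonzero submodule contains the vacuum. -/
theorem maxIdeal_eq_vacIdeal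
    (h : ∀ T : Submodule ℂ D.Univ, (∀ x n, ∀ v ∈ T, ((D.univField x)[[n]]) v ∈ T) → T ≠ ⊥ →
      ∃ v ∈ T, v ∈ Submodule.span ℂ {D.univProj 1} ∧ v ≠ 0) : D.maxIdeal = D.vacIdeal := by
  refine sup_eq_left.2 (sSup_le ?_)
  rintro I ⟨hI, hItop⟩
  by_contra hle
  -- A left ideal strictly above `vacIdeal` gives a nonzero submodule of the universal module. This
  -- submodule contains the vacuum, so `1 ∈ I`.
  have hne : (I.map D.univProj).restrictScalars ℂ ≠ ⊥ := by
    intro h0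
    refine hle fun b hb => ?_
    have h1 : D.univProj b ∈ (I.map D.univProj).restrictScalars ℂ :=
      Submodule.mem_map_of_mem hb
    rw [h0, Submodule.mem_bot] at h1
    exact (D.univProj_eq_zero b).1 h1
  obtain ⟨v, hvT, hv, hv0⟩ := h _ (fun x n v hv => by
    rw [univField_mode]
    exact Submodule.smul_mem (I.map D.univProj) _ hv) hne
  obtain ⟨c, rfl⟩ := Submodule.mem_span_singleton.1 hv
  have hc : c ≠ 0 := fun h0 => hv0 (by rw [h0, zero_smul])
  have h1 := Submodule.smul_mem _ c⁻¹ hvT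
  rw [smul_smul, inv_mul_cancel₀ hc, one_smul] at h1
  obtain ⟨b, hb, hb1⟩ := h1
  have h2 : b - 1 ∈ D.vacIdeal := by
    rw [← univProj_eq_zero, map_sub, sub_eq_zero]
    exact hb1
  have h3 : (1 : FreeModes G) ∈ I := by
    have := Submodule.sub_mem _ hb (hI h2)
    rwa [sub_sub_cancel] at this
  exact hItop ((Ideal.eq_top_iff_one I).2 h3)

end LinearOPE

/-! ### Operator product expansions for the three algebras -/

section Products

variable {W : Type*} [AddCommGroup W] [Module ℂ W] {ε c : ℂ} {A B C P Q R : VertexOperator ℂ W}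

theorem OPE.prod_of_two_le (h : OPE ε A B P Q 0) {n : ℤ} (hn : 2 ≤ n) : nthProd ε A n B = 0 := by
  rcases hn.eq_or_lt with rfl | hn
  · exact h.prod_two
  · exact h.prod_eq_zero (by omega)

theorem OPE.derivField_right (h : OPE ε A B (c • idField W) 0 0) :
    OPE ε A (derivField B) 0 (c • idField W) 0 := by
  intro i j w
  have h1 := h i (j - 1) w
  rw [derivField_mode, derivField_mode, map_smul, smul_comm ε, ← smul_sub, h1]
  simp only [mode_zero, mode_smul, idField_mode, smul_zero, add_zero, zero_add]
  have e : i + (j - 1) = -1 ↔ i + j - 1 = -1 := by omega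
  simp only [e]
  split_ifs with hij
  · have : (-j : ℂ) = i := by
      rw [neg_eq_iff_add_eq_zero]
      exact_mod_cast (by omega : j + i = 0)
    rw [this]
  · simp

theorem neg_one_smul_field (A : VertexOperator ℂ W) : (-1 : ℂ) • A = -A :=
  neg_one_smul ℂ A

theorem nthProd_neg_two_id (A : VertexOperator ℂ W) :
    nthProd 1 A (-2) (idField W) = derivField A := by
  have h := nthProd_derivField_left 1 A (idField W) (-1)
  rw [nthProd_neg_one_id] at h
  rw [h]
  norm_num

theorem nthProd_neg_one_annihilates {v : W} (hA : ∀ n : ℤ, 0 ≤ n → (A[[n]]) v = 0)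
    (hB : ∀ n : ℤ, 0 ≤ n → (B[[n]]) v = 0) {n : ℤ} (hn : 0 ≤ n) :
    ((nthProd ε A (-1) B)[[n]]) v = 0 := by
  rw [nthProd_neg_one_mode, finsum_eq_zero_of_forall_eq_zero fun j => ?_,
    finsum_eq_zero_of_forall_eq_zero fun j => ?_, smul_zero, add_zero]
  · rw [hA _ (by omega), map_zero]
  · rw [hB _ (by omega), map_zero]

theorem derivField_annihilates {v : W} (hA : ∀ n : ℤ, 0 ≤ n → (A[[n]]) v = 0) {n : ℤ}
    (hn : 0 ≤ n) : ((derivField A)[[n]]) v = 0 := by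
  rw [derivField_mode]
  rcases hn.eq_or_lt with rfl | hn
  · simp
  · rw [hA _ (by omega), smul_zero]

/-- This computes the Sugawara degree of a vector killed by all modes of index at least one. -/
theorem nthProd_neg_one_mode_one {v : W} (hA : ∀ n : ℤ, 1 ≤ n → (A[[n]]) v = 0)
    (hB : ∀ n : ℤ, 1 ≤ n → (B[[n]]) v = 0) :
    ((nthProd ε A (-1) B)[[1]]) v = ε • (B[[0]]) ((A[[0]]) v) := by
  rw [nthProd_neg_one_mode, finsum_eq_zero_of_forall_eq_zero fun j => ?_, finsum_single_zero,
    zero_add]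
  · simp
  · intro j hj
    rw [hA _ (by omega), map_zero]
  · rw [hB _ (by omega), map_zero]

end Products

/-! ### The Weyl relations -/

section Weyl

variable {W : Type*} [AddCommGroup W] [Module ℂ W] {X : WeylGen → VertexOperator ℂ W}

theorem weylOPE_isHomogeneous : weylOPE.IsHomogeneous where
  bracket x y z h := by simp [weylOPE] at h
  form₀ x y _ := rfl
  form₁ x y _ := rfl

section Relations

variable (hX : weylOPE.Realizes X)
include hX

theorem weyl_a_a : OPE 1 (X .a) (X .a) 0 0 0 := by
  have := hX .a .a
  simpa [weylOPE] using this

theorem weyl_aStar_aStar : OPE 1 (X .aStar) (X .aStar) 0 0 0 := by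
  have := hX .aStar .aStar
  simpa [weylOPE] using this

theorem weyl_a_aStar : OPE 1 (X .a) (X .aStar) (idField W) 0 0 := by
  have := hX .a .aStar
  simpa [weylOPE] using this

theorem weyl_aStar_a : OPE 1 (X .aStar) (X .a) (-idField W) 0 0 := by
  have := hX .aStar .a
  simpa [weylOPE, neg_one_smul_field] using this

theorem weyl_a_beta :
    OPE 1 (X .a) (nthProd 1 (X .a) (-1) (X .aStar)) (X .a) 0 0 := by
  have h := (weyl_a_a hX).normal (one_mul 1) (weyl_a_aStar hX) (weyl_a_aStar hX).isLocal
    (fun s _ => nthProd_zero_left _ _ _) (fun s _ => nthProd_zero_left _ _ _)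
  simpa [nthProd_zero_left, nthProd_zero_right, nthProd_neg_one_id] using h

theorem weyl_aStar_beta :
    OPE 1 (X .aStar) (nthProd 1 (X .a) (-1) (X .aStar)) (-X .aStar) 0 0 := by
  have h := (weyl_aStar_a hX).normal (one_mul 1) (weyl_aStar_aStar hX) (weyl_a_aStar hX).isLocal
    (fun s hs => by
      rw [nthProd_neg_left, one_mul, id_nthProd, if_neg (by omega), neg_zero])
    (fun s _ => nthProd_zero_left _ _ _)
  simpa [nthProd_zero_left, nthProd_zero_right, nthProd_neg_left, id_nthProd] using h

theorem weyl_a_omega :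
    OPE 1 (X .a) (nthProd 1 (X .a) (-1) (derivField (X .aStar))) 0 (X .a) 0 := by
  have h1 : OPE 1 (X .a) (derivField (X .aStar)) 0 (idField W) 0 := by
    have := OPE.derivField_right (c := 1) (A := X .a) (B := X .aStar) (ε := 1)
      (by simpa using weyl_a_aStar hX)
    simpa using this
  have h := (weyl_a_a hX).normal (one_mul 1) h1 h1.isLocal
    (fun s _ => nthProd_zero_left _ _ _) (fun s _ => nthProd_zero_left _ _ _)
  simpa [nthProd_zero_left, nthProd_zero_right, nthProd_neg_one_id] using h

theorem weyl_aStar_omega :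
    OPE 1 (X .aStar) (nthProd 1 (X .a) (-1) (derivField (X .aStar)))
      (-derivField (X .aStar)) 0 0 := by
  have h1 : OPE 1 (X .a) (derivField (X .aStar)) 0 (idField W) 0 := by
    have := OPE.derivField_right (c := 1) (A := X .a) (B := X .aStar) (ε := 1)
      (by simpa using weyl_a_aStar hX)
    simpa using this
  have h2 : OPE 1 (X .aStar) (derivField (X .aStar)) 0 0 0 := by
    have := OPE.derivField_right (c := 0) (A := X .aStar) (B := X .aStar) (ε := 1)
      (by simpa using weyl_aStar_aStar hX)
    simpa using this
  have h := (weyl_aStar_a hX).normal (one_mul 1) h2 h1.isLocal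
    (fun s hs => by
      rw [nthProd_neg_left, one_mul, id_nthProd, if_neg (by omega), neg_zero])
    (fun s _ => nthProd_zero_left _ _ _)
  simpa [nthProd_zero_left, nthProd_zero_right, nthProd_neg_left, id_nthProd] using h

end Relations

/-- The operator `2 ω_(1) + β_(0)`. -/
def weylDegree (X : WeylGen → VertexOperator ℂ W) : Module.End ℂ W :=
  (2 : ℂ) • (nthProd 1 (X .a) (-1) (derivField (X .aStar)))[[1]]
    + (nthProd 1 (X .a) (-1) (X .aStar))[[0]]

theorem weylDegree_eq_zero {v : W} (hv : ∀ x (n : ℤ), 0 ≤ n → ((X x)[[n]]) v = 0) :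
    weylDegree X v = 0 := by
  rw [weylDegree, LinearMap.add_apply, LinearMap.smul_apply,
    nthProd_neg_one_annihilates (hv .a) (fun n hn => derivField_annihilates (hv .aStar) hn)
      (by omega), nthProd_neg_one_annihilates (hv .a) (hv .aStar) le_rfl, smul_zero, add_zero]

/-- Under `ω_(1)` alone the mode `a*_(-1)` has degree `0`. Adding `β_(0)` to `2 ω_(1)` gives `a_(n)`
and `a*_(n)` the same degree `-(2n + 1)`, so the negative modes are exactly those of positive
degree. -/
theorem weylDegree_isDegree {W₀ : Submodule ℂ W} (h : weylOPE.IsVacuum X W₀) :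
    LinearOPE.IsDegree X W₀ (weylDegree X) fun n => -(2 * n + 1) where
  pos n hn := by omega
  comm x n w := by
    rw [weylDegree]
    simp only [LinearMap.add_apply, LinearMap.smul_apply, map_add, map_smul]
    cases x
    · have h1 := weyl_a_beta h.realizes n 0 w
      have h2 := weyl_a_omega h.realizes n 1 w
      simp only [mode_zero, add_zero, smul_zero, zero_add, add_sub_cancel_right] at h1 h2
      push_cast
      linear_combination (norm := module) (-1 : ℂ) • h1 - (2 : ℂ) • h2
    · have h1 := weyl_aStar_beta h.realizes n 0 w
      have h2 := weyl_aStar_omega h.realizes n 1 w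
      simp only [mode_zero, mode_neg, derivField_mode, add_zero, smul_zero, add_sub_cancel_right]
        at h1 h2
      push_cast at h2 ⊢
      linear_combination (norm := module) (-1 : ℂ) • h1 - (2 : ℂ) • h2
  vac v hv := weylDegree_eq_zero fun x n hn => h.annihilates x n hn v hv

theorem mode_stable_add_smul {T : Submodule ℂ W} {f g : Module.End ℂ W} (c : ℂ)
    (hf : ∀ v ∈ T, f v ∈ T) (hg : ∀ v ∈ T, g v ∈ T) : ∀ v ∈ T, (c • f + g) v ∈ T :=
  fun v hv => Submodule.add_mem _ (Submodule.smul_mem _ _ (hf v hv)) (hg v hv)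

theorem derivField_mem {A : VertexOperator ℂ W} {T : Submodule ℂ W}
    (hA : ∀ n, ∀ v ∈ T, (A[[n]]) v ∈ T) (n : ℤ) (v : W) (hv : v ∈ T) :
    ((derivField A)[[n]]) v ∈ T := by
  rw [derivField_mode]
  exact Submodule.smul_mem _ _ (hA _ _ hv)

theorem eq_zero_of_natCast_smul {k : ℕ} {v : W} (hv : v ≠ 0) (h : (k : ℂ) • v = 0) : k = 0 := by
  rcases smul_eq_zero.1 h with h | h
  · exact_mod_cast h
  · exact absurd h hv

/-- A vector killed by all modes of negative degree is killed by all `x_(n)` with `n ≥ 0`, hence by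
the degree operator itself. -/
theorem weyl_maxIdeal : weylOPE.maxIdeal = weylOPE.vacIdeal := by
  refine LinearOPE.maxIdeal_eq_vacIdeal fun T hT hne => ?_
  have hvac := weylOPE.univField_isVacuum
  refine hvac.inf_ne_bot (weylDegree_isDegree hvac) ?_ (fun x n _ => hT x n) ?_ hne
  · intro k v hv hk hlow
    rw [weylDegree_eq_zero fun x n hn => hlow x n (by omega)] at hk
    exact eq_zero_of_natCast_smul hv hk.symm
  · exact mode_stable_add_smul 2
      (fun v hv => nthProd_mem (hT .a) (derivField_mem (hT .aStar)) _ _ hv)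
      fun v hv => nthProd_mem (hT .a) (hT .aStar) _ _ hv

theorem weyl_Y_state (l : List (WeylGen × ℤ)) :
    weylOPE.vertex.Y (weylOPE.state l) = weylOPE.fieldWord weylOPE.genField l :=
  weylOPE.vertex_Y_state weylOPE_isHomogeneous weyl_maxIdeal l

end Weyl

/-! ### The Clifford relations -/

section Clifford

variable {W : Type*} [AddCommGroup W] [Module ℂ W] {X : CliffordGen → VertexOperator ℂ W}

theorem cliffordOPE_isHomogeneous : cliffordOPE.IsHomogeneous where
  bracket x y z h := by simp [cliffordOPE] at h
  form₀ x y _ := rfl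
  form₁ x y _ := rfl

/-- The field `γ = ψ_(-1) ψ*`. -/
def gammaField (X : CliffordGen → VertexOperator ℂ W) : VertexOperator ℂ W :=
  nthProd (-1) (X .psi) (-1) (X .psiStar)

/-- The field `γ_(-1) γ`. -/
def gammaSq (X : CliffordGen → VertexOperator ℂ W) : VertexOperator ℂ W :=
  nthProd 1 (gammaField X) (-1) (gammaField X)

theorem eq_zero_of_eq_neg_one_smul {A : VertexOperator ℂ W} (h : A = (-1 : ℂ) • A) : A = 0 := by
  have h2 : (2 : ℂ) • A = 0 := by
    nth_rewrite 1 [show (2 : ℂ) • A = A + A from two_smul _ _, h]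
    module
  exact (smul_eq_zero.1 h2).resolve_left two_ne_zero

section Relations

variable (hX : cliffordOPE.Realizes X)
include hX

theorem clifford_psi_psi : OPE (-1) (X .psi) (X .psi) 0 0 0 := by
  have := hX .psi .psi
  simpa [cliffordOPE] using this

theorem clifford_psiStar_psiStar : OPE (-1) (X .psiStar) (X .psiStar) 0 0 0 := by
  have := hX .psiStar .psiStar
  simpa [cliffordOPE] using this

theorem clifford_psi_psiStar : OPE (-1) (X .psi) (X .psiStar) (idField W) 0 0 := by
  have := hX .psi .psiStar
  simpa [cliffordOPE] using this

theorem clifford_psiStar_psi : OPE (-1) (X .psiStar) (X .psi) (idField W) 0 0 := by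
  have := hX .psiStar .psi
  simpa [cliffordOPE] using this

theorem clifford_psi_gamma : OPE 1 (X .psi) (gammaField X) (-X .psi) 0 0 := by
  have h := (clifford_psi_psi hX).normal (by norm_num) (clifford_psi_psiStar hX)
    (clifford_psi_psiStar hX).isLocal
    (fun s _ => nthProd_zero_left _ _ _) (fun s _ => nthProd_zero_left _ _ _)
  unfold gammaField
  simpa [nthProd_zero_left, nthProd_zero_right, nthProd_neg_one_id, neg_one_smul_field] using h

theorem clifford_psiStar_gamma : OPE 1 (X .psiStar) (gammaField X) (X .psiStar) 0 0 := by
  have h := (clifford_psiStar_psi hX).normal (by norm_num) (clifford_psiStar_psiStar hX)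
    (clifford_psi_psiStar hX).isLocal
    (fun s hs => by
      rw [neg_one_mul, neg_neg, id_nthProd, if_neg (by omega)])
    (fun s _ => nthProd_zero_left _ _ _)
  unfold gammaField
  simpa [nthProd_zero_left, nthProd_zero_right, id_nthProd] using h

theorem clifford_gamma_psi : OPE 1 (gammaField X) (X .psi) (X .psi) 0 0 := by
  have := (clifford_psi_gamma hX).symm_zero (one_mul 1)
  simpa using this

theorem clifford_gamma_psiStar : OPE 1 (gammaField X) (X .psiStar) (-X .psiStar) 0 0 := by
  have := (clifford_psiStar_gamma hX).symm_zero (one_mul 1)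
  simpa using this

theorem clifford_gamma_gamma : OPE 1 (gammaField X) (gammaField X) 0 (idField W) 0 := by
  have h := (clifford_gamma_psi hX).normal (one_mul 1) (clifford_gamma_psiStar hX)
    (clifford_psi_psiStar hX).isLocal
    (fun s hs => by rw [one_mul]; exact (clifford_psi_psiStar hX).prod_of_two_le hs)
    (fun s _ => nthProd_zero_left _ _ _)
  nth_rewrite 2 [gammaField]
  simpa [nthProd_zero_left, nthProd_zero_right, nthProd_neg_right,
    (clifford_psi_psiStar hX).prod_zero, (clifford_psi_psiStar hX).prod_one] using h

/-- An odd field in front of itself: exchanging the two factors `ψ_(-1)` changes the sign. -/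
theorem clifford_psi_prod_gamma : nthProd 1 (X .psi) (-1) (gammaField X) = 0 := by
  have h := (clifford_psi_psi hX).comm (by norm_num) (η := -1) (θ := -1) (X .psiStar) (-1) (-1)
  refine eq_zero_of_eq_neg_one_smul ?_
  simpa [nthProd_zero_left, gammaField] using h

theorem clifford_psiStar_prod_psiStar : nthProd (-1) (X .psiStar) (-1) (X .psiStar) = 0 := by
  have h := (clifford_psiStar_psiStar hX).comm (by norm_num) (η := 1) (θ := 1) (idField W)
    (-1) (-1)
  refine eq_zero_of_eq_neg_one_smul ?_
  simpa [nthProd_zero_left, nthProd_neg_one_id] using h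

theorem clifford_psiStar_prod_gamma : nthProd 1 (X .psiStar) (-1) (gammaField X) = 0 := by
  have h := (clifford_psiStar_psi hX).comm (by norm_num) (η := -1) (θ := -1) (X .psiStar) (-1) (-1)
  simpa [nthProd_zero_left, nthProd_zero_right, gammaField, clifford_psiStar_prod_psiStar hX,
    id_nthProd] using h

/-- The bosonization identity `∂ψ = :γψ:`. The exchanged product vanishes, and the commutator term
`ψ_(-2) id` is the derivative. -/
theorem clifford_gamma_prod_psi : nthProd 1 (gammaField X) (-1) (X .psi) = derivField (X .psi) := by
  have h := (clifford_gamma_psi hX).comm (one_mul 1) (η := 1) (θ := 1) (idField W) (-1) (-1)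
  simpa [nthProd_zero_left, nthProd_neg_one_id, clifford_psi_prod_gamma hX, nthProd_neg_two_id]
    using h

theorem clifford_gamma_prod_psiStar :
    nthProd 1 (gammaField X) (-1) (X .psiStar) = -derivField (X .psiStar) := by
  have h := (clifford_gamma_psiStar hX).comm (one_mul 1) (η := 1) (θ := 1) (idField W) (-1) (-1)
  simpa [nthProd_zero_left, nthProd_neg_one_id, clifford_psiStar_prod_gamma hX, nthProd_neg_two_id,
    nthProd_neg_left] using h

theorem clifford_psi_gammaSq :
    OPE 1 (X .psi) (gammaSq X) (-derivField (X .psi)) (X .psi) 0 := by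
  have h := (clifford_psi_gamma hX).normal (one_mul 1) (clifford_psi_gamma hX)
    (clifford_gamma_gamma hX).isLocal
    (fun s hs => by
      rw [one_mul, nthProd_neg_left, (clifford_psi_gamma hX).prod_of_two_le hs, neg_zero])
    (fun s _ => nthProd_zero_left _ _ _)
  unfold gammaSq
  simpa [nthProd_zero_left, nthProd_zero_right, nthProd_neg_right, nthProd_neg_left,
    (clifford_psi_gamma hX).prod_zero, (clifford_psi_gamma hX).prod_one,
    clifford_psi_prod_gamma hX, clifford_gamma_prod_psi hX] using h

theorem clifford_psiStar_gammaSq :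
    OPE 1 (X .psiStar) (gammaSq X) (-derivField (X .psiStar)) (X .psiStar) 0 := by
  have h := (clifford_psiStar_gamma hX).normal (one_mul 1) (clifford_psiStar_gamma hX)
    (clifford_gamma_gamma hX).isLocal
    (fun s hs => by rw [one_mul, (clifford_psiStar_gamma hX).prod_of_two_le hs])
    (fun s _ => nthProd_zero_left _ _ _)
  unfold gammaSq
  simpa [nthProd_zero_left, nthProd_zero_right,
    (clifford_psiStar_gamma hX).prod_zero, (clifford_psiStar_gamma hX).prod_one,
    clifford_psiStar_prod_gamma hX, clifford_gamma_prod_psiStar hX] using h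

/-- The Clifford degree is expressed through `γ` alone, twice the bosonic Virasoro zero mode. Since
`γ` is a combination of `E` and `N`, this grading operator also acts on `gl(1|1)`-submodules. -/
theorem gammaSq_mode_one_comm (x : CliffordGen) (n : ℤ) (w : W) :
    ((gammaSq X)[[1]]) (((X x)[[n]]) w)
      = ((X x)[[n]]) (((gammaSq X)[[1]]) w) + ((-(2 * n + 1) : ℤ) : ℂ) • ((X x)[[n]]) w := by
  cases x
  · have h := clifford_psi_gammaSq hX n 1 w
    simp only [mode_zero, mode_neg, derivField_mode, smul_zero, add_zero,
      add_sub_cancel_right] at h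
    push_cast at h ⊢
    linear_combination (norm := module) (-1 : ℂ) • h
  · have h := clifford_psiStar_gammaSq hX n 1 w
    simp only [mode_zero, mode_neg, derivField_mode, smul_zero, add_zero,
      add_sub_cancel_right] at h
    push_cast at h ⊢
    linear_combination (norm := module) (-1 : ℂ) • h

end Relations

theorem gammaSq_mode_one_eq_zero {v : W} (hv : ∀ x (n : ℤ), 0 ≤ n → ((X x)[[n]]) v = 0) :
    ((gammaSq X)[[1]]) v = 0 := by
  have h : ∀ n : ℤ, 0 ≤ n → ((gammaField X)[[n]]) v = 0 := fun n hn =>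
    nthProd_neg_one_annihilates (hv .psi) (hv .psiStar) hn
  exact nthProd_neg_one_annihilates h h (by omega)

theorem gammaSq_isDegree {W₀ : Submodule ℂ W} (h : cliffordOPE.IsVacuum X W₀) :
    LinearOPE.IsDegree X W₀ ((gammaSq X)[[1]]) fun n => -(2 * n + 1) where
  pos n hn := by omega
  comm := gammaSq_mode_one_comm h.realizes
  vac v hv := gammaSq_mode_one_eq_zero fun x n hn => h.annihilates x n hn v hv

/-- A nonzero subspace stable under the modes of the Clifford fields and of `γ_(-1) γ` meets the
vacuum subspace. -/
theorem clifford_inf_ne_bot {W₀ : Submodule ℂ W} (h : cliffordOPE.IsVacuum X W₀)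
    {T : Submodule ℂ W} (hT : ∀ x n, ∀ v ∈ T, ((X x)[[n]]) v ∈ T) (hne : T ≠ ⊥) :
    ∃ v ∈ T, v ∈ W₀ ∧ v ≠ 0 := by
  refine h.inf_ne_bot (gammaSq_isDegree h) ?_ (fun x n _ => hT x n) ?_ hne
  · intro k v hv hk hlow
    rw [gammaSq_mode_one_eq_zero fun x n hn => hlow x n (by omega)] at hk
    exact eq_zero_of_natCast_smul hv hk.symm
  · have h1 : ∀ n, ∀ v ∈ T, ((gammaField X)[[n]]) v ∈ T := fun n v hv =>
      nthProd_mem (hT .psi) (hT .psiStar) _ _ hv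
    exact fun v hv => nthProd_mem h1 h1 _ _ hv

theorem clifford_maxIdeal : cliffordOPE.maxIdeal = cliffordOPE.vacIdeal :=
  LinearOPE.maxIdeal_eq_vacIdeal fun _ hT hne =>
    clifford_inf_ne_bot cliffordOPE.univField_isVacuum hT hne

theorem clifford_Y_state (l : List (CliffordGen × ℤ)) :
    cliffordOPE.vertex.Y (cliffordOPE.state l)
      = cliffordOPE.fieldWord cliffordOPE.genField l :=
  cliffordOPE.vertex_Y_state cliffordOPE_isHomogeneous clifford_maxIdeal l

end Clifford

/-! ### The affine `gl(1|1)` relations -/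

section Gl

variable {W : Type*} [AddCommGroup W] [Module ℂ W] {X : GlGen → VertexOperator ℂ W}

theorem gl_univ {V : Type*} [AddCommMonoid V] (f : GlGen → V) :
    ∑ z, f z = f .E + (f .N + (f .psiPlus + f .psiMinus)) := by
  have : (Finset.univ : Finset GlGen) = {.E, .N, .psiPlus, .psiMinus} := rfl
  rw [this, Finset.sum_insert (by simp), Finset.sum_insert (by simp), Finset.sum_pair (by simp)]

theorem glOPE_isHomogeneous : glOPE.IsHomogeneous where
  bracket x y z h := by cases x <;> cases y <;> cases z <;> first | rfl | simp [glOPE] at h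
  form₀ x y h := by simp [glOPE] at h
  form₁ x y h := by cases x <;> cases y <;> first | rfl | simp [glOPE] at h

section Relations

variable (hX : glOPE.Realizes X)
include hX

theorem gl_E_E : OPE 1 (X .E) (X .E) 0 0 0 := by
  have := hX .E .E
  simpa [glOPE, gl_univ] using this

theorem gl_E_N : OPE 1 (X .E) (X .N) 0 (idField W) 0 := by
  have := hX .E .N
  simpa [glOPE, gl_univ] using this

theorem gl_E_psiPlus : OPE 1 (X .E) (X .psiPlus) 0 0 0 := by
  have := hX .E .psiPlus
  simpa [glOPE, gl_univ] using this

theorem gl_E_psiMinus : OPE 1 (X .E) (X .psiMinus) 0 0 0 := by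
  have := hX .E .psiMinus
  simpa [glOPE, gl_univ] using this

theorem gl_N_E : OPE 1 (X .N) (X .E) 0 (idField W) 0 := by
  have := hX .N .E
  simpa [glOPE, gl_univ] using this

theorem gl_N_N : OPE 1 (X .N) (X .N) 0 0 0 := by
  have := hX .N .N
  simpa [glOPE, gl_univ] using this

theorem gl_N_psiPlus : OPE 1 (X .N) (X .psiPlus) (X .psiPlus) 0 0 := by
  have := hX .N .psiPlus
  simpa [glOPE, gl_univ] using this

theorem gl_N_psiMinus : OPE 1 (X .N) (X .psiMinus) (-X .psiMinus) 0 0 := by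
  have := hX .N .psiMinus
  simpa [glOPE, gl_univ, neg_one_smul_field] using this

theorem gl_psiPlus_E : OPE 1 (X .psiPlus) (X .E) 0 0 0 := by
  have := hX .psiPlus .E
  simpa [glOPE, gl_univ] using this

theorem gl_psiPlus_N : OPE 1 (X .psiPlus) (X .N) (-X .psiPlus) 0 0 := by
  have := hX .psiPlus .N
  simpa [glOPE, gl_univ, neg_one_smul_field] using this

theorem gl_psiPlus_psiPlus : OPE (-1) (X .psiPlus) (X .psiPlus) 0 0 0 := by
  have := hX .psiPlus .psiPlus
  simpa [glOPE, gl_univ] using this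

theorem gl_psiPlus_psiMinus : OPE (-1) (X .psiPlus) (X .psiMinus) (X .E) (idField W) 0 := by
  have := hX .psiPlus .psiMinus
  simpa [glOPE, gl_univ] using this

theorem gl_psiMinus_E : OPE 1 (X .psiMinus) (X .E) 0 0 0 := by
  have := hX .psiMinus .E
  simpa [glOPE, gl_univ] using this

theorem gl_psiMinus_N : OPE 1 (X .psiMinus) (X .N) (X .psiMinus) 0 0 := by
  have := hX .psiMinus .N
  simpa [glOPE, gl_univ] using this

theorem gl_psiMinus_psiPlus :
    OPE (-1) (X .psiMinus) (X .psiPlus) (X .E) (-idField W) 0 := by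
  have := hX .psiMinus .psiPlus
  simpa [glOPE, gl_univ, neg_one_smul_field] using this

theorem gl_psiMinus_psiMinus : OPE (-1) (X .psiMinus) (X .psiMinus) 0 0 0 := by
  have := hX .psiMinus .psiMinus
  simpa [glOPE, gl_univ] using this

end Relations

theorem OPE.normal_even {θ : ℂ} {A B C P₁ Q₁ P₂ Q₂ : VertexOperator ℂ W}
    (hB : OPE 1 A B P₁ Q₁ 0) (hC : OPE 1 A C P₂ Q₂ 0) (hBC : Local θ B C)
    (hP : ∀ s : ℤ, 2 ≤ s → nthProd θ P₁ s C = 0)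
    (hQ : ∀ s : ℤ, 1 ≤ s → nthProd θ Q₁ s C = 0) :
    OPE 1 A (nthProd θ B (-1) C)
      (nthProd θ B (-1) P₂ + nthProd θ P₁ (-1) C)
      (nthProd θ B (-1) Q₂ + nthProd θ P₁ 0 C + nthProd θ Q₁ (-1) C)
      (nthProd θ P₁ 1 C + (2 : ℂ) • nthProd θ Q₁ 0 C) := by
  have h := hB.normal (one_mul 1) hC hBC (by simpa only [one_mul] using hP)
    (by simpa only [one_mul] using hQ)
  simpa only [one_mul, one_smul] using h

/-- The Sugawara field at level one. -/
def sugawara (X : GlGen → VertexOperator ℂ W) : VertexOperator ℂ W :=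
  (1 / 2 : ℂ) • (nthProd 1 (X .N) (-1) (X .E) + nthProd 1 (X .E) (-1) (X .N)
    + (-1 : ℂ) • nthProd (-1) (X .psiPlus) (-1) (X .psiMinus)
    + nthProd (-1) (X .psiMinus) (-1) (X .psiPlus) + nthProd 1 (X .E) (-1) (X .E))

/-! ### The Sugawara field of affine `gl(1|1)` and its action on the generators -/

section Sugawara

/-- The generators should be primary of weight one. The summand `E_(-1) E` of `sugawara` makes this
true for `N`: it cancels the term `-2E` in the second-order pole coming from the odd pair. -/
theorem ope_sugawara {ε : ℂ} {A P₁ Q₁ R₁ P₂ Q₂ R₂ P₃ Q₃ R₃ P₄ Q₄ R₄ P₅ Q₅ R₅ : VertexOperator ℂ W}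
    (h₁ : OPE ε A (nthProd 1 (X .N) (-1) (X .E)) P₁ Q₁ R₁)
    (h₂ : OPE ε A (nthProd 1 (X .E) (-1) (X .N)) P₂ Q₂ R₂)
    (h₃ : OPE ε A (nthProd (-1) (X .psiPlus) (-1) (X .psiMinus)) P₃ Q₃ R₃)
    (h₄ : OPE ε A (nthProd (-1) (X .psiMinus) (-1) (X .psiPlus)) P₄ Q₄ R₄)
    (h₅ : OPE ε A (nthProd 1 (X .E) (-1) (X .E)) P₅ Q₅ R₅)
    (hP : P₁ + P₂ + (-1 : ℂ) • P₃ + P₄ + P₅ = 0)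
    (hQ : Q₁ + Q₂ + (-1 : ℂ) • Q₃ + Q₄ + Q₅ = (2 : ℂ) • A)
    (hR : R₁ + R₂ + (-1 : ℂ) • R₃ + R₄ + R₅ = 0) : OPE ε A (sugawara X) 0 A 0 := by
  refine (((((h₁.add_right h₂).add_right (h₃.smul_right (-1))).add_right h₄).add_right
    h₅).smul_right (1 / 2)).congr ?_ ?_ ?_
  · rw [hP, smul_zero]
  · rw [hQ, smul_smul]
    norm_num
  · rw [hR, smul_zero]

variable (hX : glOPE.Realizes X)
include hX

theorem id_prod_of_nonneg (A : VertexOperator ℂ W) {s : ℤ} (hs : 0 ≤ s) :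
    nthProd 1 (idField W) s A = 0 := by
  rw [id_nthProd, if_neg (by omega)]

theorem gl_E_sugawara : OPE 1 (X .E) (sugawara X) 0 (X .E) 0 := by
  refine ope_sugawara
    ((gl_E_N hX).normal_even (gl_E_E hX) (gl_N_E hX).isLocal
      (fun s _ => nthProd_zero_left _ _ _)
      (fun s hs => by rw [id_prod_of_nonneg hX _ (by omega)]))
    ((gl_E_E hX).normal_even (gl_E_N hX) (gl_E_N hX).isLocal
      (fun s _ => nthProd_zero_left _ _ _) (fun s _ => nthProd_zero_left _ _ _))
    ((gl_E_psiPlus hX).normal_even (gl_E_psiMinus hX) (gl_psiPlus_psiMinus hX).isLocal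
      (fun s _ => nthProd_zero_left _ _ _) (fun s _ => nthProd_zero_left _ _ _))
    ((gl_E_psiMinus hX).normal_even (gl_E_psiPlus hX) (gl_psiMinus_psiPlus hX).isLocal
      (fun s _ => nthProd_zero_left _ _ _) (fun s _ => nthProd_zero_left _ _ _))
    ((gl_E_E hX).normal_even (gl_E_E hX) (gl_E_E hX).isLocal
      (fun s _ => nthProd_zero_left _ _ _) (fun s _ => nthProd_zero_left _ _ _)) ?_ ?_ ?_
  · simp [nthProd_zero_left, nthProd_zero_right]
  · simp [nthProd_zero_left, nthProd_zero_right, id_nthProd, nthProd_neg_one_id, two_smul]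
  · simp [nthProd_zero_left, id_nthProd]

theorem gl_N_sugawara : OPE 1 (X .N) (sugawara X) 0 (X .N) 0 := by
  refine ope_sugawara
    ((gl_N_N hX).normal_even (gl_N_E hX) (gl_N_E hX).isLocal
      (fun s _ => nthProd_zero_left _ _ _) (fun s _ => nthProd_zero_left _ _ _))
    ((gl_N_E hX).normal_even (gl_N_N hX) (gl_E_N hX).isLocal
      (fun s _ => nthProd_zero_left _ _ _)
      (fun s hs => by rw [id_prod_of_nonneg hX _ (by omega)]))
    ((gl_N_psiPlus hX).normal_even (gl_N_psiMinus hX) (gl_psiPlus_psiMinus hX).isLocal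
      (fun s hs => by rw [(gl_psiPlus_psiMinus hX).prod_of_two_le hs])
      (fun s _ => nthProd_zero_left _ _ _))
    ((gl_N_psiMinus hX).normal_even (gl_N_psiPlus hX) (gl_psiMinus_psiPlus hX).isLocal
      (fun s hs => by
        rw [nthProd_neg_left, (gl_psiMinus_psiPlus hX).prod_of_two_le hs, neg_zero])
      (fun s _ => nthProd_zero_left _ _ _))
    ((gl_N_E hX).normal_even (gl_N_E hX) (gl_E_E hX).isLocal
      (fun s _ => nthProd_zero_left _ _ _)
      (fun s hs => by rw [id_prod_of_nonneg hX _ (by omega)])) ?_ ?_ ?_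
  · simp [nthProd_zero_left, nthProd_zero_right, nthProd_neg_left, nthProd_neg_right]
  · simp [nthProd_zero_left, nthProd_zero_right, nthProd_neg_left, id_nthProd, nthProd_neg_one_id,
      (gl_psiPlus_psiMinus hX).prod_zero, (gl_psiMinus_psiPlus hX).prod_zero]
    module
  · simp [nthProd_zero_left, nthProd_neg_left, id_nthProd,
      (gl_psiPlus_psiMinus hX).prod_one, (gl_psiMinus_psiPlus hX).prod_one]
    module

theorem gl_psiPlus_sugawara : OPE 1 (X .psiPlus) (sugawara X) 0 (X .psiPlus) 0 := by
  have hneg : (-1 : ℂ) * -1 = 1 := by norm_num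
  have h₃ := (gl_psiPlus_psiPlus hX).normal (by norm_num) (gl_psiPlus_psiMinus hX)
    (gl_psiPlus_psiMinus hX).isLocal
    (fun s _ => nthProd_zero_left _ _ _) (fun s _ => nthProd_zero_left _ _ _)
  have h₄ := (gl_psiPlus_psiMinus hX).normal (by norm_num) (gl_psiPlus_psiPlus hX)
    (gl_psiMinus_psiPlus hX).isLocal
    (fun s hs => by rw [hneg, (gl_E_psiPlus hX).prod_of_two_le hs])
    (fun s hs => by rw [hneg, id_prod_of_nonneg hX _ (by omega)])
  rw [hneg] at h₃ h₄
  refine ope_sugawara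
    ((gl_psiPlus_N hX).normal_even (gl_psiPlus_E hX) (gl_N_E hX).isLocal
      (fun s hs => by
        rw [nthProd_neg_left, (gl_psiPlus_E hX).prod_of_two_le hs, neg_zero])
      (fun s _ => nthProd_zero_left _ _ _))
    ((gl_psiPlus_E hX).normal_even (gl_psiPlus_N hX) (gl_E_N hX).isLocal
      (fun s _ => nthProd_zero_left _ _ _) (fun s _ => nthProd_zero_left _ _ _))
    h₃ h₄
    ((gl_psiPlus_E hX).normal_even (gl_psiPlus_E hX) (gl_E_E hX).isLocal
      (fun s _ => nthProd_zero_left _ _ _) (fun s _ => nthProd_zero_left _ _ _)) ?_ ?_ ?_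
  · simp [nthProd_zero_left, nthProd_zero_right, nthProd_neg_left, nthProd_neg_right]
    module
  · simp [nthProd_zero_left, nthProd_zero_right, nthProd_neg_left, id_nthProd, nthProd_neg_one_id,
      (gl_psiPlus_E hX).prod_zero, (gl_E_psiPlus hX).prod_zero]
    module
  · simp [nthProd_zero_left, nthProd_neg_left, id_nthProd,
      (gl_psiPlus_E hX).prod_one, (gl_E_psiPlus hX).prod_one]

theorem gl_psiMinus_sugawara : OPE 1 (X .psiMinus) (sugawara X) 0 (X .psiMinus) 0 := by
  have hneg : (-1 : ℂ) * -1 = 1 := by norm_num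
  have h₃ := (gl_psiMinus_psiPlus hX).normal (by norm_num) (gl_psiMinus_psiMinus hX)
    (gl_psiPlus_psiMinus hX).isLocal
    (fun s hs => by rw [hneg, (gl_E_psiMinus hX).prod_of_two_le hs])
    (fun s hs => by rw [hneg, nthProd_neg_left, id_prod_of_nonneg hX _ (by omega), neg_zero])
  have h₄ := (gl_psiMinus_psiMinus hX).normal (by norm_num) (gl_psiMinus_psiPlus hX)
    (gl_psiMinus_psiPlus hX).isLocal
    (fun s _ => nthProd_zero_left _ _ _) (fun s _ => nthProd_zero_left _ _ _)
  rw [hneg] at h₃ h₄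
  refine ope_sugawara
    ((gl_psiMinus_N hX).normal_even (gl_psiMinus_E hX) (gl_N_E hX).isLocal
      (fun s hs => by
        rw [(gl_psiMinus_E hX).prod_of_two_le hs])
      (fun s _ => nthProd_zero_left _ _ _))
    ((gl_psiMinus_E hX).normal_even (gl_psiMinus_N hX) (gl_E_N hX).isLocal
      (fun s _ => nthProd_zero_left _ _ _) (fun s _ => nthProd_zero_left _ _ _))
    h₃ h₄
    ((gl_psiMinus_E hX).normal_even (gl_psiMinus_E hX) (gl_E_E hX).isLocal
      (fun s _ => nthProd_zero_left _ _ _) (fun s _ => nthProd_zero_left _ _ _)) ?_ ?_ ?_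
  · simp [nthProd_zero_left, nthProd_zero_right]
    module
  · simp [nthProd_zero_left, nthProd_zero_right, nthProd_neg_left, nthProd_neg_right, id_nthProd,
      nthProd_neg_one_id, (gl_psiMinus_E hX).prod_zero, (gl_E_psiMinus hX).prod_zero]
    module
  · simp [nthProd_zero_left, nthProd_neg_left, id_nthProd,
      (gl_psiMinus_E hX).prod_one, (gl_E_psiMinus hX).prod_one]

theorem gl_sugawara (x : GlGen) : OPE 1 (X x) (sugawara X) 0 (X x) 0 := by
  cases x
  · exact gl_E_sugawara hX
  · exact gl_N_sugawara hX
  · exact gl_psiPlus_sugawara hX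
  · exact gl_psiMinus_sugawara hX

end Sugawara

theorem sugawara_isDegree {W₀ : Submodule ℂ W} (h : glOPE.IsVacuum X W₀) :
    LinearOPE.IsDegree X W₀ ((sugawara X)[[1]]) fun n => -n where
  pos n hn := by omega
  comm x n w := by
    have h1 := gl_sugawara h.realizes x n 1 w
    simp only [mode_zero, smul_zero, add_zero, zero_add, add_sub_cancel_right] at h1
    push_cast
    linear_combination (norm := module) (-1 : ℂ) • h1
  vac v hv := by
    have h1 := fun x (n : ℤ) (hn : 0 ≤ n) => h.annihilates x n hn v hv
    simp only [sugawara, mode_smul, mode_add]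
    rw [nthProd_neg_one_annihilates (h1 _) (h1 _) zero_le_one,
      nthProd_neg_one_annihilates (h1 _) (h1 _) zero_le_one,
      nthProd_neg_one_annihilates (h1 _) (h1 _) zero_le_one,
      nthProd_neg_one_annihilates (h1 _) (h1 _) zero_le_one,
      nthProd_neg_one_annihilates (h1 _) (h1 _) zero_le_one]
    simp

/-- `E_(0)` commutes with all modes, as `E` is central and its form contribution has the factor `n =
0`; it kills the vacuum subspace, which generates. -/
theorem gl_E_zero_mode {W₀ : Submodule ℂ W} (h : glOPE.IsVacuum X W₀) (w : W) :
    ((X .E)[[0]]) w = 0 := by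
  have h1 : LinearMap.ker ((X .E)[[0]]) = ⊤ := by
    refine h.generates _ (fun v hv => h.annihilates _ 0 le_rfl v hv) ?_
    intro x n v hv
    rw [LinearMap.mem_ker] at hv ⊢
    have h2 := LinearOPE.realizes_iff.1 h.realizes .E x 0 n v
    rw [h2, hv]
    cases x <;> simp [glOPE]
  exact LinearMap.mem_ker.1 (h1 ▸ Submodule.mem_top)

theorem gl_maxIdeal : glOPE.maxIdeal = glOPE.vacIdeal := by
  refine LinearOPE.maxIdeal_eq_vacIdeal fun T hT hne => ?_
  have hvac := glOPE.univField_isVacuum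
  have hX := hvac.realizes
  refine hvac.inf_ne_bot (sugawara_isDegree hvac) ?_ (fun x n _ => hT x n) ?_ hne
  · intro k v hv hk hlow
    have h1 := fun x (n : ℤ) (hn : 1 ≤ n) => hlow x n (by omega)
    have hE := gl_E_zero_mode hvac
    -- The modes `Ψ^±_(0)` satisfy `(Ψ⁺_(0))² = 0` and, because `E_(0) = 0`, anticommute.
    have hsq := fun w => gl_psiPlus_psiPlus hX 0 0 w
    have hPM := fun w => gl_psiPlus_psiMinus hX 0 0 w
    simp only [add_zero, hE, Int.cast_zero, zero_smul, intChoose_zero_left, mode_zero,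
      smul_zero] at hPM hsq
    -- All positive modes kill `v`, so only products of zero modes contribute to its degree, and
    -- those containing `E_(0)` vanish.
    have hk' : (k : ℂ) • v = ((glOPE.univField .psiMinus)[[0]])
        (((glOPE.univField .psiPlus)[[0]]) v) := by
      rw [← hk]
      simp only [sugawara, mode_smul, mode_add]
      rw [nthProd_neg_one_mode_one (h1 _) (h1 _), nthProd_neg_one_mode_one (h1 _) (h1 _),
        nthProd_neg_one_mode_one (h1 _) (h1 _), nthProd_neg_one_mode_one (h1 _) (h1 _),
        nthProd_neg_one_mode_one (h1 _) (h1 _)]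
      simp only [hE, map_zero]
      linear_combination (norm := module) (-1 / 2 : ℂ) • hPM v
    have hPP : ∀ w, ((glOPE.univField .psiPlus)[[0]]) (((glOPE.univField .psiPlus)[[0]]) w)
        = 0 := fun w => by
      linear_combination (norm := module) (1 / 2 : ℂ) • hsq w
    by_contra hk0
    have hkc : (k : ℂ) ≠ 0 := Nat.cast_ne_zero.2 hk0
    -- Applying `Ψ⁺_(0)` once more gives `k Ψ⁺_(0) v = -Ψ⁻_(0) (Ψ⁺_(0))² v = 0`; if `k ≠ 0` then
    -- `Ψ⁺_(0) v = 0`, and `hk'` forces `v = 0`.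
    have h2 : (k : ℂ) • ((glOPE.univField .psiPlus)[[0]]) v = 0 := by
      rw [← map_smul, hk']
      have h3 := hPM (((glOPE.univField .psiPlus)[[0]]) v)
      rw [hPP, map_zero, smul_zero, sub_zero] at h3
      simpa using h3
    rw [(smul_eq_zero.1 h2).resolve_left hkc, map_zero] at hk'
    exact hv ((smul_eq_zero.1 hk').resolve_left hkc)
  · intro v hv
    have h2 := fun (ε : ℂ) x y => nthProd_mem (ε := ε) (hT x) (hT y) (-1) 1 hv
    simp only [sugawara, mode_smul, mode_add]
    exact Submodule.smul_mem _ _ (Submodule.add_mem _ (Submodule.add_mem _ (Submodule.add_mem _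
      (Submodule.add_mem _ (h2 _ _ _) (h2 _ _ _)) (Submodule.smul_mem _ _ (h2 _ _ _)))
      (h2 _ _ _)) (h2 _ _ _))

theorem gl_Y_state (l : List (GlGen × ℤ)) :
    glOPE.vertex.Y (glOPE.state l) = glOPE.fieldWord glOPE.genField l :=
  glOPE.vertex_Y_state glOPE_isHomogeneous gl_maxIdeal l

end Gl

/-! ### The free field realization of `gl(1|1)` -/

section Realization

variable {W : Type*} [AddCommGroup W] [Module ℂ W] {X : WeylGen → VertexOperator ℂ W}
  {Z : CliffordGen → VertexOperator ℂ W}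

/-- The field `β = a_(-1) a*`. -/
def betaField (X : WeylGen → VertexOperator ℂ W) : VertexOperator ℂ W :=
  nthProd 1 (X .a) (-1) (X .aStar)

/-- The fields `E = γ + β`, `N = (γ - β) / 2`, `Ψ⁺ = a ψ`, `Ψ⁻ = a* ψ*`. -/
def glField (X : WeylGen → VertexOperator ℂ W) (Z : CliffordGen → VertexOperator ℂ W) :
    GlGen → VertexOperator ℂ W
  | .E => gammaField Z + betaField X
  | .N => (1 / 2 : ℂ) • (gammaField Z + (-1 : ℂ) • betaField X)
  | .psiPlus => nthProd 1 (X .a) (-1) (Z .psi)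
  | .psiMinus => nthProd 1 (X .aStar) (-1) (Z .psiStar)

theorem OPE.symm_zero_one {A B P : VertexOperator ℂ W} (h : OPE 1 A B P 0 0) :
    OPE 1 B A (-P) 0 0 := by
  have := h.symm_zero (one_mul 1)
  rwa [one_smul] at this

theorem OPE.symm_zero_neg_one {A B P : VertexOperator ℂ W} (h : OPE (-1) A B P 0 0) :
    OPE (-1) B A P 0 0 := by
  have := h.symm_zero (by norm_num)
  rwa [neg_one_smul_field, neg_neg] at this

theorem OPE.symm_zero_zero {A B : VertexOperator ℂ W} (h : OPE 1 A B 0 0 0) :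
    OPE 1 B A 0 0 0 := by
  have := h.symm_zero_one
  rwa [neg_zero] at this

theorem OPE.normal_zero {θ : ℂ} {A B C : VertexOperator ℂ W} (hB : OPE 1 A B 0 0 0)
    (hC : OPE 1 A C 0 0 0) (hBC : Local θ B C) : OPE 1 A (nthProd θ B (-1) C) 0 0 0 := by
  have h := hB.normal_even hC hBC (fun s _ => nthProd_zero_left _ _ _)
    (fun s _ => nthProd_zero_left _ _ _)
  simpa [nthProd_zero_left, nthProd_zero_right] using h

/-! ### Commutators of `β`, `γ` and the composite odd fields -/

section Relations

variable (hX : weylOPE.Realizes X) (hZ : cliffordOPE.Realizes Z)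
  (hXZ : ∀ x z, OPE 1 (X x) (Z z) 0 0 0)

include hX in
theorem beta_a : OPE 1 (betaField X) (X .a) (-X .a) 0 0 := (weyl_a_beta hX).symm_zero_one

include hX in
theorem beta_aStar : OPE 1 (betaField X) (X .aStar) (X .aStar) 0 0 := by
  have := (weyl_aStar_beta hX).symm_zero_one
  rwa [neg_neg] at this

include hX in
-- The bosonic current has norm `-1`, against `+1` for `γ`; this sign makes `E = γ + β` isotropic.
theorem beta_beta : OPE 1 (betaField X) (betaField X) 0 (-idField W) 0 := by
  have h := (beta_a hX).normal_even (beta_aStar hX) (weyl_a_aStar hX).isLocal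
    (fun s hs => by rw [nthProd_neg_left, (weyl_a_aStar hX).prod_of_two_le hs, neg_zero])
    (fun s _ => nthProd_zero_left _ _ _)
  nth_rewrite 2 [betaField]
  simpa [nthProd_zero_left, nthProd_zero_right, nthProd_neg_left, (weyl_a_aStar hX).prod_zero,
    (weyl_a_aStar hX).prod_one] using h

include hX hXZ in
theorem beta_clifford (z : CliffordGen) : OPE 1 (betaField X) (Z z) 0 0 0 :=
  (OPE.normal_zero (hXZ .a z).symm_zero_zero (hXZ .aStar z).symm_zero_zero
    (weyl_a_aStar hX).isLocal).symm_zero_zero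

include hZ hXZ in
theorem gamma_weyl (x : WeylGen) : OPE 1 (gammaField Z) (X x) 0 0 0 :=
  (OPE.normal_zero (hXZ x .psi) (hXZ x .psiStar) (clifford_psi_psiStar hZ).isLocal).symm_zero_zero

include hX hZ hXZ in
theorem beta_gamma : OPE 1 (betaField X) (gammaField Z) 0 0 0 :=
  OPE.normal_zero (beta_clifford hX hXZ .psi) (beta_clifford hX hXZ .psiStar)
    (clifford_psi_psiStar hZ).isLocal

include hX hXZ in
theorem beta_psiPlus :
    OPE 1 (betaField X) (glField X Z .psiPlus) (-glField X Z .psiPlus) 0 0 := by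
  have h := (beta_a hX).normal_even (beta_clifford hX hXZ .psi) (hXZ .a .psi).isLocal
    (fun s hs => by rw [nthProd_neg_left, (hXZ .a .psi).prod_of_two_le hs, neg_zero])
    (fun s _ => nthProd_zero_left _ _ _)
  simpa [glField, nthProd_zero_left, nthProd_zero_right, nthProd_neg_left,
    (hXZ .a .psi).prod_zero, (hXZ .a .psi).prod_one] using h

include hX hXZ in
theorem beta_psiMinus :
    OPE 1 (betaField X) (glField X Z .psiMinus) (glField X Z .psiMinus) 0 0 := by
  have h := (beta_aStar hX).normal_even (beta_clifford hX hXZ .psiStar)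
    (hXZ .aStar .psiStar).isLocal
    (fun s hs => by rw [(hXZ .aStar .psiStar).prod_of_two_le hs])
    (fun s _ => nthProd_zero_left _ _ _)
  simpa [glField, nthProd_zero_left, nthProd_zero_right,
    (hXZ .aStar .psiStar).prod_zero, (hXZ .aStar .psiStar).prod_one] using h

include hZ hXZ in
theorem gamma_psiPlus :
    OPE 1 (gammaField Z) (glField X Z .psiPlus) (glField X Z .psiPlus) 0 0 := by
  have h := (gamma_weyl hZ hXZ .a).normal_even (clifford_gamma_psi hZ) (hXZ .a .psi).isLocal
    (fun s _ => nthProd_zero_left _ _ _) (fun s _ => nthProd_zero_left _ _ _)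
  simpa [glField, nthProd_zero_left, nthProd_zero_right] using h

include hZ hXZ in
theorem gamma_psiMinus :
    OPE 1 (gammaField Z) (glField X Z .psiMinus) (-glField X Z .psiMinus) 0 0 := by
  have h := (gamma_weyl hZ hXZ .aStar).normal_even (clifford_gamma_psiStar hZ)
    (hXZ .aStar .psiStar).isLocal
    (fun s _ => nthProd_zero_left _ _ _) (fun s _ => nthProd_zero_left _ _ _)
  simpa [glField, nthProd_zero_left, nthProd_zero_right, nthProd_neg_right] using h

include hX in
theorem aStar_prod_a : nthProd 1 (X .aStar) (-1) (X .a) = betaField X := by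
  have h := (weyl_a_aStar hX).comm (one_mul 1) (η := 1) (θ := 1) (idField W) (-1) (-1)
  simpa [nthProd_zero_left, nthProd_neg_one_id, id_nthProd, betaField, eq_comm] using h

include hX hXZ in
theorem psiPlus_a : OPE 1 (glField X Z .psiPlus) (X .a) 0 0 0 :=
  (OPE.normal_zero (weyl_a_a hX) (hXZ .a .psi) (hXZ .a .psi).isLocal).symm_zero_zero

include hX hXZ in
theorem psiMinus_aStar : OPE 1 (glField X Z .psiMinus) (X .aStar) 0 0 0 :=
  (OPE.normal_zero (weyl_aStar_aStar hX) (hXZ .aStar .psiStar)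
    (hXZ .aStar .psiStar).isLocal).symm_zero_zero

include hX hXZ in
theorem psiPlus_aStar : OPE 1 (glField X Z .psiPlus) (X .aStar) (Z .psi) 0 0 := by
  have h := (weyl_aStar_a hX).normal_even (hXZ .aStar .psi) (hXZ .a .psi).isLocal
    (fun s hs => by rw [nthProd_neg_left, id_nthProd, if_neg (by omega), neg_zero])
    (fun s _ => nthProd_zero_left _ _ _)
  have h' : OPE 1 (X .aStar) (glField X Z .psiPlus) (-Z .psi) 0 0 := by
    simpa [glField, nthProd_zero_left, nthProd_zero_right, nthProd_neg_left, id_nthProd] using h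
  have := h'.symm_zero_one
  rwa [neg_neg] at this

include hZ hXZ in
theorem psiPlus_psi : OPE (-1) (glField X Z .psiPlus) (Z .psi) 0 0 0 := by
  have h := (hXZ .a .psi).symm_zero_zero.normal (one_mul 1) (clifford_psi_psi hZ)
    (hXZ .a .psi).isLocal
    (fun s _ => nthProd_zero_left _ _ _) (fun s _ => nthProd_zero_left _ _ _)
  refine OPE.symm_zero_neg_one ?_
  simpa [glField, nthProd_zero_left, nthProd_zero_right] using h

include hZ hXZ in
theorem psiMinus_psiStar : OPE (-1) (glField X Z .psiMinus) (Z .psiStar) 0 0 0 := by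
  have h := (hXZ .aStar .psiStar).symm_zero_zero.normal (one_mul 1) (clifford_psiStar_psiStar hZ)
    (hXZ .aStar .psiStar).isLocal
    (fun s _ => nthProd_zero_left _ _ _) (fun s _ => nthProd_zero_left _ _ _)
  refine OPE.symm_zero_neg_one ?_
  simpa [glField, nthProd_zero_left, nthProd_zero_right] using h

include hZ hXZ in
theorem psiPlus_psiStar : OPE (-1) (glField X Z .psiPlus) (Z .psiStar) (X .a) 0 0 := by
  have h := (hXZ .a .psiStar).symm_zero_zero.normal (one_mul 1) (clifford_psiStar_psi hZ)
    (hXZ .a .psi).isLocal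
    (fun s _ => nthProd_zero_left _ _ _) (fun s _ => nthProd_zero_left _ _ _)
  refine OPE.symm_zero_neg_one ?_
  simpa [glField, nthProd_zero_left, nthProd_zero_right, nthProd_neg_one_id] using h

include hX hZ hXZ in
theorem psiPlus_psiPlus : OPE (-1) (glField X Z .psiPlus) (glField X Z .psiPlus) 0 0 0 := by
  have h := (psiPlus_a hX hXZ).normal (one_mul 1) (psiPlus_psi hZ hXZ)
    (hXZ .a .psi).isLocal
    (fun s _ => nthProd_zero_left _ _ _) (fun s _ => nthProd_zero_left _ _ _)
  nth_rewrite 2 [glField]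
  simpa [nthProd_zero_left, nthProd_zero_right] using h

include hX hZ hXZ in
theorem psiMinus_psiMinus : OPE (-1) (glField X Z .psiMinus) (glField X Z .psiMinus) 0 0 0 := by
  have h := (psiMinus_aStar hX hXZ).normal (one_mul 1) (psiMinus_psiStar hZ hXZ)
    (hXZ .aStar .psiStar).isLocal
    (fun s _ => nthProd_zero_left _ _ _) (fun s _ => nthProd_zero_left _ _ _)
  nth_rewrite 2 [glField]
  simpa [nthProd_zero_left, nthProd_zero_right] using h

include hX hZ hXZ in
-- The contraction of the Weyl pair leaves `ψ_(-1) ψ* = γ`, that of the Clifford pair leaves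
-- `a*_(-1) a = β`, and the double contraction gives the level.
theorem psiPlus_psiMinus :
    OPE (-1) (glField X Z .psiPlus) (glField X Z .psiMinus) (glField X Z .E) (idField W) 0 := by
  have h := (psiPlus_aStar hX hXZ).normal (one_mul 1) (psiPlus_psiStar hZ hXZ)
    (hXZ .aStar .psiStar).isLocal
    (fun s hs => by rw [mul_one, (clifford_psi_psiStar hZ).prod_of_two_le hs])
    (fun s _ => nthProd_zero_left _ _ _)
  change OPE (-1) (glField X Z .psiPlus) (nthProd 1 (X .aStar) (-1) (Z .psiStar))
    (gammaField Z + betaField X) (idField W) 0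
  rw [add_comm (gammaField Z)]
  simpa [nthProd_zero_left, nthProd_zero_right, aStar_prod_a hX, gammaField,
    (clifford_psi_psiStar hZ).prod_zero, (clifford_psi_psiStar hZ).prod_one] using h

include hX hZ hXZ in
theorem psiMinus_psiPlus :
    OPE (-1) (glField X Z .psiMinus) (glField X Z .psiPlus) (glField X Z .E) (-idField W) 0 := by
  have h := psiPlus_psiMinus hX hZ hXZ
  rw [← one_smul ℂ (idField W)] at h
  have h2 := h.symm (by norm_num)
  rwa [neg_one_smul_field, neg_neg, mul_one, neg_one_smul_field] at h2

include hX hZ hXZ in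
theorem glField_E_E : OPE 1 (glField X Z .E) (glField X Z .E) 0 0 0 := by
  refine (((clifford_gamma_gamma hZ).add_right (beta_gamma hX hZ hXZ).symm_zero_zero).add_left
    ((beta_gamma hX hZ hXZ).add_right (beta_beta hX))).congr ?_ ?_ ?_ <;> simp

include hX hZ hXZ in
theorem glField_E_N : OPE 1 (glField X Z .E) (glField X Z .N) 0 (idField W) 0 := by
  refine (((clifford_gamma_gamma hZ).add_right
    ((beta_gamma hX hZ hXZ).symm_zero_zero.smul_right (-1))).add_left
    ((beta_gamma hX hZ hXZ).add_right ((beta_beta hX).smul_right (-1)))).smul_right (1 / 2)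
    |>.congr ?_ ?_ ?_
  · simp
  · simp
    module
  · simp

include hX hZ hXZ in
theorem glField_N_E : OPE 1 (glField X Z .N) (glField X Z .E) 0 (idField W) 0 := by
  have h := glField_E_N hX hZ hXZ
  rw [← one_smul ℂ (idField W)] at h
  have h2 := h.symm (one_mul 1)
  simpa using h2

include hX hZ hXZ in
theorem glField_N_N : OPE 1 (glField X Z .N) (glField X Z .N) 0 0 0 := by
  refine ((((clifford_gamma_gamma hZ).add_right
    ((beta_gamma hX hZ hXZ).symm_zero_zero.smul_right (-1))).add_left
    (((beta_gamma hX hZ hXZ).add_right ((beta_beta hX).smul_right (-1))).smul_left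
    (-1))).smul_right (1 / 2)).smul_left (1 / 2) |>.congr ?_ ?_ ?_
  · simp
  · simp [neg_one_smul_field]
  · simp

include hX hZ hXZ in
theorem glField_E_psiPlus : OPE 1 (glField X Z .E) (glField X Z .psiPlus) 0 0 0 := by
  refine ((gamma_psiPlus hZ hXZ).add_left (beta_psiPlus hX hXZ)).congr ?_ ?_ ?_ <;> simp

include hX hZ hXZ in
theorem glField_E_psiMinus : OPE 1 (glField X Z .E) (glField X Z .psiMinus) 0 0 0 := by
  refine ((gamma_psiMinus hZ hXZ).add_left (beta_psiMinus hX hXZ)).congr ?_ ?_ ?_ <;> simp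

include hX hZ hXZ in
theorem glField_N_psiPlus :
    OPE 1 (glField X Z .N) (glField X Z .psiPlus) (glField X Z .psiPlus) 0 0 := by
  refine (((gamma_psiPlus hZ hXZ).add_left ((beta_psiPlus hX hXZ).smul_left (-1))).smul_left
    (1 / 2)).congr ?_ ?_ ?_
  · module
  · simp
  · simp

include hX hZ hXZ in
theorem glField_N_psiMinus :
    OPE 1 (glField X Z .N) (glField X Z .psiMinus) (-glField X Z .psiMinus) 0 0 := by
  refine (((gamma_psiMinus hZ hXZ).add_left ((beta_psiMinus hX hXZ).smul_left (-1))).smul_left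
    (1 / 2)).congr ?_ ?_ ?_
  · module
  · simp
  · simp

include hX hZ hXZ in
-- Half of the table is computed by Wick's formula; the opposite orders follow by skew-symmetry.
theorem glField_realizes : glOPE.Realizes (glField X Z) := by
  intro x y
  have e : ∀ A : VertexOperator ℂ W, (-1 : ℂ) • A = -A := neg_one_smul_field
  cases x <;> cases y <;>
    simp only [glOPE, gl_univ, koszul_zero_left, koszul_zero_right, koszul_one_one, zero_smul,
      one_smul, zero_add, add_zero, e]
  · exact glField_E_E hX hZ hXZ
  · exact glField_E_N hX hZ hXZ
  · exact glField_E_psiPlus hX hZ hXZ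
  · exact glField_E_psiMinus hX hZ hXZ
  · exact glField_N_E hX hZ hXZ
  · exact glField_N_N hX hZ hXZ
  · exact glField_N_psiPlus hX hZ hXZ
  · exact glField_N_psiMinus hX hZ hXZ
  · exact (glField_E_psiPlus hX hZ hXZ).symm_zero_zero
  · exact (glField_N_psiPlus hX hZ hXZ).symm_zero_one
  · exact psiPlus_psiPlus hX hZ hXZ
  · exact psiPlus_psiMinus hX hZ hXZ
  · exact (glField_E_psiMinus hX hZ hXZ).symm_zero_zero
  · have := (glField_N_psiMinus hX hZ hXZ).symm_zero_one
    rwa [neg_neg] at this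
  · exact psiMinus_psiPlus hX hZ hXZ
  · exact psiMinus_psiMinus hX hZ hXZ

end Relations
end Realization

/-! ### Fields on a tensor product -/

section Tensor

universe u v

variable {W₁ : Type u} {W₂ : Type v} [AddCommGroup W₁] [Module ℂ W₁] [AddCommGroup W₂]
  [Module ℂ W₂]

/-- The field `A ⊗ id`. -/
def leftField (W₂ : Type v) [AddCommGroup W₂] [Module ℂ W₂] (A : VertexOperator ℂ W₁) :
    VertexOperator ℂ (W₁ ⊗[ℂ] W₂) := tensorField A (idField W₂)

/-- The field `id ⊗ B`. -/
def rightField (W₁ : Type u) [AddCommGroup W₁] [Module ℂ W₁] (B : VertexOperator ℂ W₂) :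
    VertexOperator ℂ (W₁ ⊗[ℂ] W₂) := tensorField (idField W₁) B

theorem tensorField_mode_tmul (A : VertexOperator ℂ W₁) (B : VertexOperator ℂ W₂) (n : ℤ)
    (x : W₁) (y : W₂) : ((tensorField A B)[[n]]) (x ⊗ₜ y)
      = ∑ᶠ i : ℤ, (A[[i]]) x ⊗ₜ[ℂ] (B[[n - 1 - i]]) y := by
  rw [tensorField, mkField_mode, tensorMode_tmul]

theorem leftField_mode_tmul (A : VertexOperator ℂ W₁) (n : ℤ) (x : W₁) (y : W₂) :
    ((leftField W₂ A)[[n]]) (x ⊗ₜ y) = (A[[n]]) x ⊗ₜ y := by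
  rw [leftField, tensorField_mode_tmul, finsum_eq_single _ n]
  · rw [idField_mode, if_pos (by omega)]
  · intro i hi
    rw [idField_mode, if_neg (by omega), TensorProduct.tmul_zero]

theorem rightField_mode_tmul (B : VertexOperator ℂ W₂) (n : ℤ) (x : W₁) (y : W₂) :
    ((rightField W₁ B)[[n]]) (x ⊗ₜ y) = x ⊗ₜ (B[[n]]) y := by
  rw [rightField, tensorField_mode_tmul, finsum_eq_single _ (-1)]
  · rw [idField_mode, if_pos rfl, show n - 1 - -1 = n by ring]
  · intro i hi
    rw [idField_mode, if_neg hi, TensorProduct.zero_tmul]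

theorem tensor_ope_iff {ε : ℂ} {A B P Q R : VertexOperator ℂ (W₁ ⊗[ℂ] W₂)} :
    OPE ε A B P Q R ↔ ∀ (i j : ℤ) (x : W₁) (y : W₂),
      (A[[i]]) ((B[[j]]) (x ⊗ₜ y)) - ε • (B[[j]]) ((A[[i]]) (x ⊗ₜ y))
      = (P[[i + j]]) (x ⊗ₜ y) + (i : ℂ) • (Q[[i + j - 1]]) (x ⊗ₜ y)
        + intChoose i 2 • (R[[i + j - 2]]) (x ⊗ₜ y) := by
  refine ⟨fun h i j x y => h i j _, fun h i j w => ?_⟩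
  induction w using TensorProduct.induction_on with
  | zero => simp only [map_zero, smul_zero, sub_zero, add_zero]
  | tmul x y => exact h i j x y
  | add s t hs ht =>
    simp only [map_add]
    linear_combination (norm := module) hs + ht

theorem OPE.leftField {ε : ℂ} {A B P Q R : VertexOperator ℂ W₁} (h : OPE ε A B P Q R) :
    OPE ε (leftField W₂ A) (leftField W₂ B) (leftField W₂ P) (leftField W₂ Q)
      (leftField W₂ R) := by
  rw [tensor_ope_iff]
  intro i j x y
  simp only [leftField_mode_tmul, TensorProduct.smul_tmul', ← TensorProduct.add_tmul,
    ← TensorProduct.sub_tmul]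
  rw [h]

theorem OPE.rightField {ε : ℂ} {A B P Q R : VertexOperator ℂ W₂} (h : OPE ε A B P Q R) :
    OPE ε (rightField W₁ A) (rightField W₁ B) (rightField W₁ P) (rightField W₁ Q)
      (rightField W₁ R) := by
  rw [tensor_ope_iff]
  intro i j x y
  simp only [rightField_mode_tmul, ← TensorProduct.tmul_smul, ← TensorProduct.tmul_add,
    ← TensorProduct.tmul_sub]
  rw [h]

theorem leftField_rightField (A : VertexOperator ℂ W₁) (B : VertexOperator ℂ W₂) :
    OPE 1 (leftField W₂ A) (rightField W₁ B) 0 0 0 := by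
  rw [tensor_ope_iff]
  intro i j x y
  simp only [leftField_mode_tmul, rightField_mode_tmul, mode_zero, one_smul, sub_self, smul_zero,
    add_zero]

theorem tensorField_ext {A B : VertexOperator ℂ (W₁ ⊗[ℂ] W₂)}
    (h : ∀ n x y, (A[[n]]) (x ⊗ₜ y) = (B[[n]]) (x ⊗ₜ y)) : A = B := by
  refine field_ext fun n w => ?_
  induction w using TensorProduct.induction_on with
  | zero => rw [map_zero, map_zero]
  | tmul x y => exact h n x y
  | add s t hs ht => rw [map_add, map_add, hs, ht]

theorem leftField_id : leftField W₂ (idField W₁) = idField (W₁ ⊗[ℂ] W₂) := by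
  refine tensorField_ext fun n x y => ?_
  rw [leftField_mode_tmul, idField_mode, idField_mode]
  split_ifs
  · rfl
  · rw [TensorProduct.zero_tmul]

theorem rightField_id : rightField W₁ (idField W₂) = idField (W₁ ⊗[ℂ] W₂) := leftField_id

theorem leftField_nthProd (ε : ℂ) (A B : VertexOperator ℂ W₁) (n : ℤ) :
    leftField W₂ (nthProd ε A n B) = nthProd ε (leftField W₂ A) n (leftField W₂ B) := by
  refine tensorField_ext fun k x y => ?_
  have h1 := ((mode_comp_evZero A B x k fun j => n - j).smul (sgnChoose n)).map_finsum
    ((TensorProduct.mk ℂ W₁ W₂).flip y)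
  have h2 := ((EvZero.map (mode_evZero' A x) fun j => B[[n + k - j]]).smul
    (sgnChoose n)).map_finsum ((TensorProduct.mk ℂ W₁ W₂).flip y)
  simp only [LinearMap.flip_apply, TensorProduct.mk_apply, ← TensorProduct.smul_tmul'] at h1 h2
  rw [leftField_mode_tmul, nthProd_mode, nthProd_mode, TensorProduct.sub_tmul,
    ← TensorProduct.smul_tmul', h1, h2]
  simp only [leftField_mode_tmul]

theorem rightField_nthProd (ε : ℂ) (A B : VertexOperator ℂ W₂) (n : ℤ) :
    rightField W₁ (nthProd ε A n B) = nthProd ε (rightField W₁ A) n (rightField W₁ B) := by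
  refine tensorField_ext fun k x y => ?_
  have h1 := ((mode_comp_evZero A B y k fun j => n - j).smul (sgnChoose n)).map_finsum
    (TensorProduct.mk ℂ W₁ W₂ x)
  have h2 := ((EvZero.map (mode_evZero' A y) fun j => B[[n + k - j]]).smul
    (sgnChoose n)).map_finsum (TensorProduct.mk ℂ W₁ W₂ x)
  simp only [TensorProduct.mk_apply, TensorProduct.tmul_smul] at h1 h2
  rw [rightField_mode_tmul, nthProd_mode, nthProd_mode, TensorProduct.tmul_sub,
    TensorProduct.tmul_smul, h1, h2]
  simp only [rightField_mode_tmul]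

theorem finsum_int {V : Type*} [AddCommMonoid V] {f : ℤ → V} (hf : (Function.support f).Finite) :
    ∑ᶠ i, f i = ∑ᶠ j : ℕ, f (-1 - j) + ∑ᶠ j : ℕ, f j := by
  have h1 : (Set.range fun j : ℕ => (-1 - j : ℤ)) ∪ (Set.range fun j : ℕ => (j : ℤ))
      = Set.univ := by
    rw [Set.eq_univ_iff_forall]
    intro i
    rcases lt_or_ge i 0 with hi | hi
    · exact Or.inl ⟨(-1 - i).toNat, by simp only; omega⟩
    · exact Or.inr ⟨i.toNat, by simp only; omega⟩
  have h2 : Disjoint (Set.range fun j : ℕ => (-1 - j : ℤ)) (Set.range fun j : ℕ => (j : ℤ)) := by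
    rw [Set.disjoint_left]
    rintro _ ⟨j, rfl⟩ ⟨k, hk⟩
    simp only at hk
    omega
  rw [← finsum_mem_univ, ← h1, finsum_mem_union' h2 (hf.subset Set.inter_subset_right)
    (hf.subset Set.inter_subset_right), finsum_mem_range, finsum_mem_range]
  · exact Nat.cast_injective
  · intro i j h
    simp only at h
    omega

/-- Since `A ⊗ id` and `id ⊗ B` commute, normal ordering does not matter, and the two half-infinite
sums join to one over `ℤ`. So Wick's formula applies to tensor products. -/
theorem tensorField_eq (A : VertexOperator ℂ W₁) (B : VertexOperator ℂ W₂) :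
    tensorField A B = nthProd 1 (leftField W₂ A) (-1) (rightField W₁ B) := by
  refine tensorField_ext fun k x y => ?_
  rw [tensorField_mode_tmul, finsum_int (tensor_finite A B k x y), nthProd_neg_one_mode, one_smul]
  simp only [leftField_mode_tmul, rightField_mode_tmul]
  congr 1
  refine finsum_congr fun j => ?_
  rw [show k - 1 - (-1 - (j : ℤ)) = k + j by ring]

end Tensor

/-! ### The fermionic Fock space -/

section Fock

/-- The generator paired with a given generator. -/
def CliffordGen.dual : CliffordGen → CliffordGen
  | .psi => .psiStar
  | .psiStar => .psi

theorem cliffordOPE_form₀ (x y : CliffordGen) :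
    cliffordOPE.form₀ x y = if y = x.dual then 1 else 0 := by
  cases x <;> cases y <;> simp [cliffordOPE, CliffordGen.dual]

/-- The exterior algebra on the creation modes. -/
abbrev FockSpace : Type := ExteriorAlgebra ℂ (CliffordGen × ℕ →₀ ℂ)

/-- The modes act on the exterior algebra by multiplications and contractions. -/
def fockMode (p : CliffordGen × ℤ) : Module.End ℂ FockSpace :=
  if p.2 < 0 then
    LinearMap.mulLeft ℂ (ExteriorAlgebra.ι ℂ (Finsupp.single (p.1, (-1 - p.2).toNat) 1))
  else CliffordAlgebra.contractLeft (Finsupp.lapply (p.1.dual, p.2.toNat))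

/-- Contraction is an antiderivation of the exterior algebra, so its anticommutator with
multiplication by a vector is the pairing. The creation mode `m` is stored at `-1 - m`, which
matches `n` precisely when `n + m + 1 = 0`. -/
theorem fockMode_mixed (x y : CliffordGen) {n m : ℤ} (hn : ¬ n < 0) (hm : m < 0)
    (w : FockSpace) : fockMode (x, n) (fockMode (y, m) w) + fockMode (y, m) (fockMode (x, n) w)
      = (if n + m + 1 = 0 then cliffordOPE.form₀ x y else 0) • w := by
  simp only [fockMode, if_neg hn, if_pos hm, LinearMap.mulLeft_apply]
  rw [ExteriorAlgebra.ι, CliffordAlgebra.contractLeft_ι_mul, sub_add_cancel, Finsupp.lapply_apply,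
    Finsupp.single_apply, cliffordOPE_form₀]
  congr 1
  by_cases h1 : n + m + 1 = 0
  · by_cases h2 : y = x.dual
    · rw [if_pos (by rw [h2, show (-1 - m).toNat = n.toNat by omega]), if_pos h1, if_pos h2]
    · rw [if_neg (fun h => h2 (Prod.ext_iff.1 h).1), if_pos h1, if_neg h2]
  · rw [if_neg (fun h => h1 (by have := (Prod.ext_iff.1 h).2; simp only at this; omega)),
      if_neg h1]

theorem form₀_symm (x y : CliffordGen) : cliffordOPE.form₀ x y = cliffordOPE.form₀ y x := by
  cases x <;> cases y <;> rfl

theorem fockMode_comm (x y : CliffordGen) (n m : ℤ) (w : FockSpace) :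
    fockMode (x, n) (fockMode (y, m) w) + fockMode (y, m) (fockMode (x, n) w)
      = (if n + m + 1 = 0 then cliffordOPE.form₀ x y else 0) • w := by
  by_cases hn : n < 0 <;> by_cases hm : m < 0
  · simp only [fockMode, if_pos hn, if_pos hm, LinearMap.mulLeft_apply]
    rw [if_neg (by omega), zero_smul, ← mul_assoc, ← mul_assoc, ← add_mul,
      ExteriorAlgebra.ι_add_mul_swap, zero_mul]
  · rw [add_comm, fockMode_mixed y x hm hn, form₀_symm, add_comm m n]
  · exact fockMode_mixed x y hn hm w
  · simp only [fockMode, if_neg hn, if_neg hm]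
    rw [if_neg (by omega), zero_smul, CliffordAlgebra.contractLeft_comm, neg_add_cancel]

/-- The representation of the free algebra on the Fock space. -/
def fockRep : FreeModes CliffordGen →ₐ[ℂ] Module.End ℂ FockSpace := FreeAlgebra.lift ℂ fockMode

theorem fockRep_sym (x : CliffordGen) (n : ℤ) : fockRep (sym x n) = fockMode (x, n) :=
  FreeAlgebra.lift_ι_apply _ _

theorem fockRep_relator (x y : CliffordGen) (n m : ℤ) :
    fockRep (cliffordOPE.relator x y n m) = 0 := by
  refine LinearMap.ext fun w => ?_
  have h := fockMode_comm x y n m w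
  have h1 : ∀ x, cliffordOPE.parity x = 1 := fun _ => rfl
  have h2 : ∀ x y z, cliffordOPE.bracket x y z = 0 := fun _ _ _ => rfl
  have h3 : cliffordOPE.form₁ x y = 0 := rfl
  simp only [LinearOPE.relator, map_sub, map_mul, map_smul, fockRep_sym, h1, h2, h3, zero_smul,
    Finset.sum_const_zero, sub_zero, mul_zero, ite_self, map_zero, koszul_one_one,
    AlgHom.commutes, LinearMap.sub_apply, LinearMap.smul_apply, Module.End.mul_apply,
    Module.algebraMap_end_apply, LinearMap.zero_apply]
  rw [← h]
  module

theorem fockRep_vacIdeal {b : FreeModes CliffordGen} (hb : b ∈ cliffordOPE.vacIdeal) :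
    fockRep b 1 = 0 := by
  induction hb using Submodule.span_induction with
  | mem b hb =>
    rcases hb with ⟨x, y, n, m, b, rfl⟩ | ⟨x, n, hn, rfl⟩
    · rw [map_mul, fockRep_relator, zero_mul, LinearMap.zero_apply]
    · rw [fockRep_sym, fockMode, if_neg (by simpa using hn)]
      exact CliffordAlgebra.contractLeft_one (Q := (0 : QuadraticForm ℂ (CliffordGen × ℕ →₀ ℂ))) _
  | zero => rw [map_zero, LinearMap.zero_apply]
  | add a b _ _ ha hb => rw [map_add, LinearMap.add_apply, ha, hb, add_zero]
  | smul u b _ hb => rw [smul_eq_mul, map_mul, Module.End.mul_apply, hb, map_zero]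

/-- The exterior algebra is a representation in which the vacuum acts as `1 ≠ 0`. Without this, `F`
and all charge spaces could be zero. -/
theorem clifford_vac_ne_zero : cliffordOPE.vac ≠ 0 := by
  intro h
  rw [LinearOPE.vac, LinearOPE.proj_eq_zero, clifford_maxIdeal] at h
  have := fockRep_vacIdeal h
  rw [map_one fockRep, Module.End.one_apply] at this
  exact one_ne_zero this

end Fock

/-! ### Stable subspaces -/

section Stable

variable {W : Type*} [AddCommGroup W] [Module ℂ W]

/-- If a sum of operators with distinct weights preserves a subspace stable under the grading
operator, then so does each of them. -/
theorem comp_mem_of_finsum_mem {T : Submodule ℂ W} {Λ : Module.End ℂ W}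
    (hΛ : ∀ w ∈ T, Λ w ∈ T) {f : ℤ → Module.End ℂ W} {c : ℤ → ℂ} (hc : Function.Injective c)
    (hf : ∀ i w, Λ (f i w) = f i (Λ w) + c i • f i w)
    (hfin : ∀ w, (Function.support fun i => f i w).Finite)
    (hsum : ∀ w ∈ T, ∑ᶠ i, f i w ∈ T) (i : ℤ) : ∀ w ∈ T, f i w ∈ T := by
  have hfin' : ∀ (k : ℕ) w, (Function.support fun i => c i ^ k • f i w).Finite := fun k w =>
    (hfin w).subset fun i hi h0 => hi (by simp only at h0 ⊢; rw [h0, smul_zero])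
  -- Commuting with `Λ` inserts one more factor `c i` into the sum, so all power-weighted sums stay
  -- in `T` and the Vandermonde argument applies.
  have key : ∀ (k : ℕ), ∀ w ∈ T, ∑ᶠ i, c i ^ k • f i w ∈ T := by
    intro k
    induction k with
    | zero => simpa using hsum
    | succ k ih =>
      intro w hw
      have h1 := hΛ _ (ih w hw)
      have h2 := ih _ (hΛ w hw)
      have h3 : Λ (∑ᶠ i, c i ^ k • f i w) = ∑ᶠ i, Λ (c i ^ k • f i w) :=
        Λ.toAddMonoidHom.map_finsum (hfin' k w)
      have h4 : ∀ i, Λ (c i ^ k • f i w) = c i ^ k • f i (Λ w) + c i ^ (k + 1) • f i w := by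
        intro i
        rw [map_smul, hf, smul_add, smul_smul, pow_succ]
      rw [h3, finsum_congr h4, finsum_add_distrib (hfin' k _) (hfin' (k + 1) w)] at h1
      have := Submodule.sub_mem _ h1 h2
      rwa [add_sub_cancel_left] at this
  intro w hw
  by_cases hi : f i w = 0
  · rw [hi]
    exact Submodule.zero_mem _
  · refine mem_of_sum_pow_smul_mem hc (hfin w).toFinset (u := fun i => f i w) (fun k => ?_) i
      (by simpa using hi)
    rw [← finsum_eq_sum_of_support_subset]
    · exact key k w hw
    · intro j hj
      rw [Set.Finite.coe_toFinset]
      exact fun h0 => hj (by simp only at h0 ⊢; rw [h0, smul_zero])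

/-- The span of the vectors obtained from `T` by applying `c` of the operators `p i`. -/
def chain {ι : Type*} (p : ι → Module.End ℂ W) (T : Submodule ℂ W) : ℕ → Submodule ℂ W
  | 0 => T
  | c + 1 => ⨆ i, (chain p T c).map (p i)

variable {ι κ : Type*} {p : ι → Module.End ℂ W} {q : κ → Module.End ℂ W} {T : Submodule ℂ W}

theorem mem_chain_succ {c : ℕ} {u : W} (hu : u ∈ chain p T c) (i : ι) :
    p i u ∈ chain p T (c + 1) :=
  Submodule.mem_iSup_of_mem i (Submodule.mem_map_of_mem hu)

theorem chain_succ_le {c : ℕ} {S : Submodule ℂ W} (h : ∀ i, ∀ u ∈ chain p T c, p i u ∈ S) :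
    chain p T (c + 1) ≤ S :=
  iSup_le fun i => Submodule.map_le_iff_le_comap.2 fun u hu => h i u hu

/-- An opposite operator passes the outermost `p i` up to a scalar and a sign, and finally cancels
one step against `T`. -/
theorem chain_comp_mem (hpq : ∀ i k, ∃ ε η : ℂ, ∀ w, q k (p i w) = ε • p i (q k w) + η • w)
    (hT : ∀ i k, ∀ w ∈ T, q k (p i w) ∈ T) (k : κ) (c : ℕ) :
    ∀ u ∈ chain p T (c + 1), q k u ∈ chain p T c := by
  induction c with
  | zero => exact chain_succ_le (S := T.comap (q k)) fun i u hu => hT i k u hu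
  | succ c ih =>
    refine chain_succ_le (S := (chain p T (c + 1)).comap (q k)) fun i u hu => ?_
    obtain ⟨ε, η, h⟩ := hpq i k
    rw [Submodule.mem_comap, h]
    exact Submodule.add_mem _ (Submodule.smul_mem _ _ (mem_chain_succ (ih u hu) i))
      (Submodule.smul_mem _ _ hu)

theorem chain_le_eigenspace {d : Module.End ℂ W} {μ ν : ℂ}
    (hp : ∀ i w, d (p i w) = p i (d w) + ν • p i w) (hT : T ≤ d.eigenspace μ) (c : ℕ) :
    chain p T c ≤ d.eigenspace (μ + c * ν) := by
  induction c with
  | zero => simpa [chain] using hT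
  | succ c ih =>
    refine chain_succ_le fun i u hu => ?_
    have h := Module.End.mem_eigenspace_iff.1 (ih hu)
    rw [Module.End.mem_eigenspace_iff, hp, h, map_smul]
    push_cast
    module

/-- A subspace of an eigenspace of `d` is the whole eigenspace if it is stable under all products
of a raising and a lowering operator and the raising and lowering operators act irreducibly. -/
theorem eq_eigenspace_of_pair_stable {d : Module.End ℂ W} {μ : ℂ}
    (hp : ∀ i w, d (p i w) = p i (d w) + (1 : ℂ) • p i w)
    (hq : ∀ k w, d (q k w) = q k (d w) + (-1 : ℂ) • q k w)
    (hpq : ∀ i k, ∃ ε η : ℂ, ∀ w, q k (p i w) = ε • p i (q k w) + η • w)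
    (hqp : ∀ k i, ∃ ε η : ℂ, ∀ w, p i (q k w) = ε • q k (p i w) + η • w)
    (hirr : ∀ S : Submodule ℂ W, (∀ i, ∀ w ∈ S, p i w ∈ S) → (∀ k, ∀ w ∈ S, q k w ∈ S) →
      S ≠ ⊥ → S = ⊤)
    (hT₁ : ∀ i k, ∀ w ∈ T, q k (p i w) ∈ T) (hT₂ : ∀ k i, ∀ w ∈ T, p i (q k w) ∈ T)
    (hne : T ≠ ⊥) (hT : T ≤ d.eigenspace μ) : T = d.eigenspace μ := by
  -- The two chains together are stable: a raising operator lengthens one chain and shortens the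
  -- other, and at length zero it passes from one to the other.
  have htop : (⨆ c, chain p T c) ⊔ ⨆ c, chain q T c = ⊤ := by
    refine hirr _ ?_ ?_ ?_
    · intro i
      suffices h : (⨆ c, chain p T c) ⊔ ⨆ c, chain q T c
          ≤ ((⨆ c, chain p T c) ⊔ ⨆ c, chain q T c).comap (p i) from fun w hw => h hw
      refine sup_le (iSup_le fun c u hu => ?_) (iSup_le fun c => ?_)
      · exact Submodule.mem_sup_left (Submodule.mem_iSup_of_mem (c + 1) (mem_chain_succ hu i))
      · intro u hu
        cases c with
        | zero =>
          exact Submodule.mem_sup_left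
            (Submodule.mem_iSup_of_mem 1 (mem_chain_succ (p := p) (c := 0) (show u ∈ chain p T 0 from hu) i))
        | succ c =>
          exact Submodule.mem_sup_right
            (Submodule.mem_iSup_of_mem c (chain_comp_mem hqp hT₂ i c u hu))
    · intro k
      suffices h : (⨆ c, chain p T c) ⊔ ⨆ c, chain q T c
          ≤ ((⨆ c, chain p T c) ⊔ ⨆ c, chain q T c).comap (q k) from fun w hw => h hw
      refine sup_le (iSup_le fun c => ?_) (iSup_le fun c u hu => ?_)
      · intro u hu
        cases c with
        | zero =>
          exact Submodule.mem_sup_right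
            (Submodule.mem_iSup_of_mem 1 (mem_chain_succ (p := q) (c := 0) (show u ∈ chain q T 0 from hu) k))
        | succ c =>
          exact Submodule.mem_sup_left
            (Submodule.mem_iSup_of_mem c (chain_comp_mem hpq hT₁ k c u hu))
      · exact Submodule.mem_sup_right (Submodule.mem_iSup_of_mem (c + 1) (mem_chain_succ hu k))
    · intro h
      refine hne (eq_bot_iff.2 (h ▸ ?_))
      exact le_sup_of_le_left (le_iSup (chain p T) 0)
  -- Chains of positive length have charges different from `μ`, so only `T` lies in charge `μ`.
  have hle : (⨆ c, chain p T c) ⊔ ⨆ c, chain q T c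
      ≤ T ⊔ ⨆ (ν : ℂ) (_ : ν ≠ μ), d.eigenspace ν := by
    refine sup_le (iSup_le fun c => ?_) (iSup_le fun c => ?_)
    · cases c with
      | zero => exact le_sup_left
      | succ c =>
        refine le_sup_of_le_right ((chain_le_eigenspace hp hT (c + 1)).trans
          (le_iSup₂_of_le (μ + (c + 1 : ℕ) * 1) (fun h => ?_) le_rfl))
        rw [add_eq_left, mul_one] at h
        exact Nat.cast_ne_zero.2 c.succ_ne_zero h
    · cases c with
      | zero => exact le_sup_left
      | succ c =>
        refine le_sup_of_le_right ((chain_le_eigenspace hq hT (c + 1)).trans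
          (le_iSup₂_of_le (μ + (c + 1 : ℕ) * -1) (fun h => ?_) le_rfl))
        rw [add_eq_left, mul_neg_one, neg_eq_zero] at h
        exact Nat.cast_ne_zero.2 c.succ_ne_zero h
  -- For a vector of charge `μ` the component outside `T` also has charge `μ`, and independence of
  -- eigenspaces makes it zero.
  refine le_antisymm hT fun v hv => ?_
  have hv' : v ∈ T ⊔ ⨆ (ν : ℂ) (_ : ν ≠ μ), d.eigenspace ν := hle (by rw [htop]; trivial)
  obtain ⟨t, ht, r, hr, rfl⟩ := Submodule.mem_sup.1 hv'
  have h1 : r ∈ d.eigenspace μ := by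
    have := Submodule.sub_mem _ hv (hT ht)
    rwa [add_sub_cancel_left] at this
  rw [(Submodule.disjoint_def.1 (d.eigenspaces_iSupIndep μ)) r h1 hr, add_zero]
  exact ht

end Stable

/-! ### Irreducibility of the charge spaces -/

section Charge

variable {W : Type*} [AddCommGroup W] [Module ℂ W] {X : WeylGen → VertexOperator ℂ W}
  {Z : CliffordGen → VertexOperator ℂ W}

/-- The modes of `a*` and `ψ`, which raise the charge. -/
def raising (X : WeylGen → VertexOperator ℂ W) (Z : CliffordGen → VertexOperator ℂ W) :
    ℤ ⊕ ℤ → Module.End ℂ W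
  | .inl j => (X .aStar)[[j]]
  | .inr n => (Z .psi)[[n]]

/-- The modes of `a` and `ψ*`, which lower the charge. -/
def lowering (X : WeylGen → VertexOperator ℂ W) (Z : CliffordGen → VertexOperator ℂ W) :
    ℤ ⊕ ℤ → Module.End ℂ W
  | .inl i => (X .a)[[i]]
  | .inr m => (Z .psiStar)[[m]]

variable (hX : weylOPE.Realizes X) (hZ : cliffordOPE.Realizes Z)
  (hXZ : ∀ x z, OPE 1 (X x) (Z z) 0 0 0)

include hXZ in
theorem weyl_clifford_comm (x : WeylGen) (z : CliffordGen) (i j : ℤ) (w : W) :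
    ((X x)[[i]]) (((Z z)[[j]]) w) = ((Z z)[[j]]) (((X x)[[i]]) w) := by
  rw [ope_zero_iff.1 (hXZ x z), one_smul]

include hX in
theorem weyl_mode_comm (i j : ℤ) (w : W) : ((X .a)[[i]]) (((X .aStar)[[j]]) w)
    = ((X .aStar)[[j]]) (((X .a)[[i]]) w) + (if i + j = -1 then (1 : ℂ) else 0) • w := by
  have h := weyl_a_aStar hX i j w
  simp only [one_smul, mode_zero, smul_zero, add_zero, idField_mode] at h
  rw [sub_eq_iff_eq_add'.1 h]
  split_ifs <;> simp

include hZ in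
theorem clifford_mode_comm (n m : ℤ) (w : W) : ((Z .psi)[[n]]) (((Z .psiStar)[[m]]) w)
    = (-1 : ℂ) • ((Z .psiStar)[[m]]) (((Z .psi)[[n]]) w)
      + (if n + m = -1 then (1 : ℂ) else 0) • w := by
  have h := clifford_psi_psiStar hZ n m w
  simp only [mode_zero, smul_zero, add_zero, idField_mode] at h
  rw [sub_eq_iff_eq_add'.1 h]
  split_ifs <;> simp

include hX hZ hXZ in
theorem raising_lowering (k i : ℤ ⊕ ℤ) : ∃ ε η : ℂ, ∀ w, raising X Z i (lowering X Z k w)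
    = ε • lowering X Z k (raising X Z i w) + η • w := by
  rcases i with j | n <;> rcases k with i | m
  · refine ⟨1, -(if i + j = -1 then (1 : ℂ) else 0), fun w => ?_⟩
    simp only [raising, lowering]
    rw [weyl_mode_comm hX]
    module
  · refine ⟨1, 0, fun w => ?_⟩
    simp only [raising, lowering]
    rw [weyl_clifford_comm hXZ]
    module
  · refine ⟨1, 0, fun w => ?_⟩
    simp only [raising, lowering]
    rw [weyl_clifford_comm hXZ]
    module
  · exact ⟨-1, _, fun w => clifford_mode_comm hZ n m w⟩

include hX hZ hXZ in
theorem lowering_raising (i k : ℤ ⊕ ℤ) : ∃ ε η : ℂ, ∀ w, lowering X Z k (raising X Z i w)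
    = ε • raising X Z i (lowering X Z k w) + η • w := by
  rcases i with j | n <;> rcases k with i | m
  · refine ⟨1, (if i + j = -1 then (1 : ℂ) else 0), fun w => ?_⟩
    simp only [raising, lowering]
    rw [weyl_mode_comm hX, one_smul]
  · refine ⟨1, 0, fun w => ?_⟩
    simp only [raising, lowering]
    rw [weyl_clifford_comm hXZ]
    module
  · refine ⟨1, 0, fun w => ?_⟩
    simp only [raising, lowering]
    rw [weyl_clifford_comm hXZ]
    module
  · refine ⟨-1, (if n + m = -1 then (1 : ℂ) else 0), fun w => ?_⟩
    simp only [raising, lowering]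
    rw [clifford_mode_comm hZ]
    module

include hX hZ hXZ in
theorem charge_raising (i : ℤ ⊕ ℤ) (w : W) : ((glField X Z .E)[[0]]) (raising X Z i w)
    = raising X Z i (((glField X Z .E)[[0]]) w) + (1 : ℂ) • raising X Z i w := by
  rcases i with j | n
  · have h1 := gamma_weyl hZ hXZ .aStar 0 j w
    have h2 := beta_aStar hX 0 j w
    simp only [mode_zero, smul_zero, add_zero, zero_add] at h1 h2
    simp only [glField, raising, mode_add]
    rw [map_add]
    linear_combination (norm := module) h1 + h2
  · have h1 := clifford_gamma_psi hZ 0 n w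
    have h2 := beta_clifford hX hXZ .psi 0 n w
    simp only [mode_zero, smul_zero, add_zero, zero_add] at h1 h2
    simp only [glField, raising, mode_add]
    rw [map_add]
    linear_combination (norm := module) h1 + h2

include hX hZ hXZ in
theorem charge_lowering (k : ℤ ⊕ ℤ) (w : W) : ((glField X Z .E)[[0]]) (lowering X Z k w)
    = lowering X Z k (((glField X Z .E)[[0]]) w) + (-1 : ℂ) • lowering X Z k w := by
  rcases k with i | m
  · have h1 := gamma_weyl hZ hXZ .a 0 i w
    have h2 := beta_a hX 0 i w
    simp only [mode_zero, mode_neg, smul_zero, add_zero, zero_add] at h1 h2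
    simp only [glField, lowering, mode_add]
    rw [map_add]
    linear_combination (norm := module) h1 + h2
  · have h1 := clifford_gamma_psiStar hZ 0 m w
    have h2 := beta_clifford hX hXZ .psiStar 0 m w
    simp only [mode_zero, mode_neg, smul_zero, add_zero, zero_add] at h1 h2
    simp only [glField, lowering, mode_add]
    rw [map_add]
    linear_combination (norm := module) h1 + h2

theorem charge_glField (hX : weylOPE.Realizes X) (hZ : cliffordOPE.Realizes Z)
    (hXZ : ∀ x z, OPE 1 (X x) (Z z) 0 0 0) (x : GlGen) (n : ℤ) (w : W) :
    ((glField X Z .E)[[0]]) (((glField X Z x)[[n]]) w)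
      = ((glField X Z x)[[n]]) (((glField X Z .E)[[0]]) w) := by
  rw [LinearOPE.realizes_iff.1 (glField_realizes hX hZ hXZ) .E x 0 n w]
  cases x <;> simp [glOPE]

include hXZ in
-- As the factors commute, a mode of the normally ordered product is one sum over `ℤ`, to which
-- `comp_mem_of_finsum_mem` can be applied.
theorem weyl_prod_clifford_mode (x : WeylGen) (z : CliffordGen) (k : ℤ) (w : W) :
    (Function.support fun i : ℤ => ((X x)[[i]]) (((Z z)[[k - 1 - i]]) w)).Finite ∧
      ((nthProd 1 (X x) (-1) (Z z))[[k]]) w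
        = ∑ᶠ i : ℤ, ((X x)[[i]]) (((Z z)[[k - 1 - i]]) w) := by
  have hfin : (Function.support fun i : ℤ => ((X x)[[i]]) (((Z z)[[k - 1 - i]]) w)).Finite := by
    obtain ⟨N, hN⟩ := field_trunc (X x) w
    obtain ⟨K, hK⟩ := field_trunc (Z z) w
    refine (Set.finite_Icc (k - 1 - K) N).subset fun i hi => ?_
    by_contra hlt
    apply hi
    have hlt' : ¬ (k - 1 - K ≤ i ∧ i ≤ N) := hlt
    simp only
    by_cases h : N ≤ i
    · rw [weyl_clifford_comm hXZ, hN i h, map_zero]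
    · rw [hK _ (by omega), map_zero]
  refine ⟨hfin, ?_⟩
  rw [finsum_int hfin, nthProd_neg_one_mode, one_smul]
  congr 1
  · refine finsum_congr fun j => ?_
    rw [show k - 1 - (-1 - (j : ℤ)) = k + j by ring]
  · exact finsum_congr fun j => (weyl_clifford_comm hXZ _ _ _ _ _).symm

/-! ### Submodules over `gl(1|1)` are stable under single products of modes -/

section StableSubspace

variable {T : Submodule ℂ W} (hT : ∀ x n, ∀ w ∈ T, ((glField X Z x)[[n]]) w ∈ T)

include hT in
theorem gammaSq_mem : ∀ w ∈ T, ((gammaSq Z)[[1]]) w ∈ T := by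
  have h : ∀ n, ∀ w ∈ T, ((gammaField Z)[[n]]) w ∈ T := by
    intro n w hw
    have h1 := Submodule.add_mem _ (hT .N n w hw) (Submodule.smul_mem _ (1 / 2 : ℂ) (hT .E n w hw))
    have h2 : gammaField Z = glField X Z .N + (1 / 2 : ℂ) • glField X Z .E := by
      simp only [glField]
      module
    rwa [h2, mode_add, mode_smul]
  exact fun w hw => nthProd_mem h h _ _ hw

include hX hZ hXZ hT in
theorem weyl_clifford_mem (x : WeylGen) (z : CliffordGen)
    (h : ∀ n, ∀ w ∈ T, ((nthProd 1 (X x) (-1) (Z z))[[n]]) w ∈ T) (i j : ℤ) :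
    ∀ w ∈ T, ((X x)[[i]]) (((Z z)[[j]]) w) ∈ T := by
  -- The grading operator does not see the Weyl modes, so each summand gets its weight from the
  -- Clifford mode alone.
  have hcomm : OPE 1 (X x) (gammaSq Z) 0 0 0 :=
    OPE.normal_zero (gamma_weyl hZ hXZ x).symm_zero_zero (gamma_weyl hZ hXZ x).symm_zero_zero
      (clifford_gamma_gamma hZ).isLocal
  -- The index `i + j + 1` selects the mode containing the summand `(i, j)`; the weights of its
  -- summands are pairwise distinct.
  have key := comp_mem_of_finsum_mem (gammaSq_mem hT)
    (f := fun i' => (X x)[[i']] ∘ₗ (Z z)[[i + j + 1 - 1 - i']])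
    (c := fun i' => ((-(2 * (i + j + 1 - 1 - i') + 1) : ℤ) : ℂ)) ?_ ?_ ?_ ?_ i
  · intro w hw
    have := key w hw
    rwa [LinearMap.comp_apply, show i + j + 1 - 1 - i = j by ring] at this
  · intro i₁ i₂ h
    simp only [Int.cast_inj] at h
    omega
  · intro i' w
    simp only [LinearMap.comp_apply]
    have h1 := ope_zero_iff.1 hcomm i' 1 (((Z z)[[i + j + 1 - 1 - i']]) w)
    rw [one_smul] at h1
    rw [← h1, gammaSq_mode_one_comm hZ, map_add, map_smul]
  · exact fun w => (weyl_prod_clifford_mode hXZ x z (i + j + 1) w).1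
  · intro w hw
    have := h (i + j + 1) w hw
    rwa [(weyl_prod_clifford_mode hXZ x z (i + j + 1) w).2] at this

include hX hZ hXZ hT in
theorem a_psi_mem (i n : ℤ) : ∀ w ∈ T, ((X .a)[[i]]) (((Z .psi)[[n]]) w) ∈ T :=
  weyl_clifford_mem hX hZ hXZ hT .a .psi (hT .psiPlus) i n

include hX hZ hXZ hT in
theorem aStar_psiStar_mem (i n : ℤ) :
    ∀ w ∈ T, ((X .aStar)[[i]]) (((Z .psiStar)[[n]]) w) ∈ T :=
  weyl_clifford_mem hX hZ hXZ hT .aStar .psiStar (hT .psiMinus) i n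

include hX hZ hXZ hT in
-- If `ψ_(N) w = 0`, then `ψ_(N) ψ*_(-1-N) w = w`. Inserting this pair writes the claim as a
-- composite of two operators already known to preserve `T`.
theorem a_aStar_mem (i j : ℤ) : ∀ w ∈ T, ((X .a)[[i]]) (((X .aStar)[[j]]) w) ∈ T := by
  intro w hw
  obtain ⟨N, hN⟩ := field_trunc (Z .psi) w
  have h := a_psi_mem hX hZ hXZ hT i N _ (aStar_psiStar_mem hX hZ hXZ hT j (-1 - N) w hw)
  rw [← weyl_clifford_comm hXZ, clifford_mode_comm hZ, hN N le_rfl, map_zero, smul_zero, zero_add,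
    if_pos (by ring), one_smul] at h
  exact h

include hX hZ hXZ hT in
-- The same device with a Weyl pair: for large `N` the product `a_(N) a*_(-1-N)` acts as the
-- identity on `ψ*_(m) w`.
theorem psi_psiStar_mem (n m : ℤ) :
    ∀ w ∈ T, ((Z .psi)[[n]]) (((Z .psiStar)[[m]]) w) ∈ T := by
  intro w hw
  obtain ⟨N, hN⟩ := field_trunc (X .a) w
  have h := a_psi_mem hX hZ hXZ hT N n _ (aStar_psiStar_mem hX hZ hXZ hT (-1 - N) m w hw)
  rw [weyl_clifford_comm hXZ, weyl_mode_comm hX, weyl_clifford_comm hXZ, hN N le_rfl, map_zero,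
    map_zero, zero_add, if_pos (by ring), one_smul] at h
  exact h

include hX hZ hXZ hT in
theorem raising_lowering_mem (k i : ℤ ⊕ ℤ) :
    ∀ w ∈ T, raising X Z i (lowering X Z k w) ∈ T := by
  intro w hw
  rcases i with j | n <;> rcases k with i | m <;> simp only [raising, lowering]
  · have h := a_aStar_mem hX hZ hXZ hT i j w hw
    rw [weyl_mode_comm hX] at h
    have := Submodule.sub_mem _ h (Submodule.smul_mem _ (if i + j = -1 then (1 : ℂ) else 0) hw)
    rwa [add_sub_cancel_right] at this
  · exact aStar_psiStar_mem hX hZ hXZ hT j m w hw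
  · rw [← weyl_clifford_comm hXZ]
    exact a_psi_mem hX hZ hXZ hT i n w hw
  · exact psi_psiStar_mem hX hZ hXZ hT n m w hw

include hX hZ hXZ hT in
theorem lowering_raising_mem (i k : ℤ ⊕ ℤ) :
    ∀ w ∈ T, lowering X Z k (raising X Z i w) ∈ T := by
  intro w hw
  obtain ⟨ε, η, h⟩ := lowering_raising hX hZ hXZ i k
  rw [h]
  exact Submodule.add_mem _ (Submodule.smul_mem _ _ (raising_lowering_mem hX hZ hXZ hT k i w hw))
    (Submodule.smul_mem _ _ hw)

include hX hZ hXZ hT in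
/-- A nonzero `gl(1|1)`-stable subspace of a charge space is the whole charge space. -/
theorem eq_charge_space
    (hirr : ∀ S : Submodule ℂ W, (∀ x n, ∀ w ∈ S, ((X x)[[n]]) w ∈ S) →
      (∀ z n, ∀ w ∈ S, ((Z z)[[n]]) w ∈ S) → S ≠ ⊥ → S = ⊤)
    (hne : T ≠ ⊥) {μ : ℂ} (hμ : T ≤ Module.End.eigenspace ((glField X Z .E)[[0]]) μ) :
    T = Module.End.eigenspace ((glField X Z .E)[[0]]) μ := by
  refine eq_eigenspace_of_pair_stable (charge_raising hX hZ hXZ) (charge_lowering hX hZ hXZ)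
    (lowering_raising hX hZ hXZ) (raising_lowering hX hZ hXZ) ?_
    (lowering_raising_mem hX hZ hXZ hT) (raising_lowering_mem hX hZ hXZ hT) hne hμ
  intro S hp hq hS
  refine hirr S (fun x n => ?_) (fun z n => ?_) hS
  · cases x
    · exact hq (.inl n)
    · exact hp (.inl n)
  · cases z
    · exact hp (.inr n)
    · exact hq (.inr n)

end StableSubspace

include hX hZ hXZ in
-- Once `ψ*_(N) v = 0`, the anticommutator `{ψ_(-1-N), ψ*_(N)} = 1` shows that `ψ_(-1-N) v` cannot
-- vanish unless `v` does.
theorem charge_space_succ_ne_bot {μ : ℂ}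
    (h : Module.End.eigenspace ((glField X Z .E)[[0]]) μ ≠ ⊥) :
    Module.End.eigenspace ((glField X Z .E)[[0]]) (μ + 1) ≠ ⊥ := by
  obtain ⟨v, hv, hv0⟩ := Submodule.exists_mem_ne_zero_of_ne_bot h
  obtain ⟨N, hN⟩ := field_trunc (Z .psiStar) v
  intro hbot
  refine hv0 ?_
  have h1 : ((Z .psi)[[-1 - N]]) v ∈ Module.End.eigenspace ((glField X Z .E)[[0]]) (μ + 1) := by
    have := charge_raising hX hZ hXZ (.inr (-1 - N)) v
    rw [Module.End.mem_eigenspace_iff.1 hv, map_smul] at this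
    rw [Module.End.mem_eigenspace_iff, add_smul]
    exact this
  rw [hbot, Submodule.mem_bot] at h1
  have h2 := clifford_mode_comm hZ (-1 - N) N v
  rw [hN N le_rfl, map_zero, h1, map_zero, smul_zero, zero_add, if_pos (by ring), one_smul] at h2
  exact h2.symm

include hX hZ hXZ in
theorem charge_space_pred_ne_bot {μ : ℂ}
    (h : Module.End.eigenspace ((glField X Z .E)[[0]]) μ ≠ ⊥) :
    Module.End.eigenspace ((glField X Z .E)[[0]]) (μ + -1) ≠ ⊥ := by
  obtain ⟨v, hv, hv0⟩ := Submodule.exists_mem_ne_zero_of_ne_bot h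
  obtain ⟨N, hN⟩ := field_trunc (Z .psi) v
  intro hbot
  refine hv0 ?_
  have h1 : ((Z .psiStar)[[-1 - N]]) v
      ∈ Module.End.eigenspace ((glField X Z .E)[[0]]) (μ + -1) := by
    have := charge_lowering hX hZ hXZ (.inr (-1 - N)) v
    rw [Module.End.mem_eigenspace_iff.1 hv, map_smul] at this
    rw [Module.End.mem_eigenspace_iff, add_smul]
    exact this
  rw [hbot, Submodule.mem_bot] at h1
  have h2 := clifford_mode_comm hZ N (-1 - N) v
  rw [hN N le_rfl, map_zero, h1, map_zero, smul_zero, zero_add, if_pos (by ring), one_smul] at h2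
  exact h2.symm

include hX hZ hXZ in
/-- The charge spaces with charge in a coset of the integers are all nonzero if they span. -/
theorem charge_space_ne_bot [Nontrivial W] {Δ : ℂ}
    (h : ⨆ s : ℤ, Module.End.eigenspace ((glField X Z .E)[[0]]) ((s : ℂ) + Δ) = ⊤) (s : ℤ) :
    Module.End.eigenspace ((glField X Z .E)[[0]]) ((s : ℂ) + Δ) ≠ ⊥ := by
  obtain ⟨s₀, hs₀⟩ : ∃ s₀ : ℤ,
      Module.End.eigenspace ((glField X Z .E)[[0]]) ((s₀ : ℂ) + Δ) ≠ ⊥ := by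
    by_contra! hall
    rw [iSup_congr hall, iSup_bot] at h
    exact bot_ne_top h
  -- From one nonzero charge space every integer shift is reached by steps of `±1`.
  induction s using Int.inductionOn' (b := s₀) with
  | zero => exact hs₀
  | succ k _ ih =>
    have := charge_space_succ_ne_bot hX hZ hXZ ih
    rwa [add_right_comm, ← Int.cast_one, ← Int.cast_add] at this
  | pred k _ ih =>
    have := charge_space_pred_ne_bot hX hZ hXZ ih
    rwa [add_right_comm, ← sub_eq_add_neg, ← Int.cast_one, ← Int.cast_sub] at this

end Charge

/-! ### The tensor product with the Clifford vertex algebra -/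

section TensorRealization

universe u v

variable {W₁ : Type u} {W₂ : Type v} [AddCommGroup W₁] [Module ℂ W₁] [AddCommGroup W₂]
  [Module ℂ W₂] {G : Type} [Fintype G] {D : LinearOPE G}

theorem leftField_sum_add {ι : Type*} (s : Finset ι) (c : ι → ℂ) (A : ι → VertexOperator ℂ W₁)
    (r : ℂ) : leftField W₂ (∑ i ∈ s, c i • A i + r • idField W₁)
      = ∑ i ∈ s, c i • leftField W₂ (A i) + r • idField (W₁ ⊗[ℂ] W₂) := by
  refine tensorField_ext fun n x y => ?_
  rw [← leftField_id]
  simp only [leftField_mode_tmul, mode_add, mode_sum, mode_smul, TensorProduct.add_tmul,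
    TensorProduct.sum_tmul, TensorProduct.smul_tmul']

theorem rightField_sum_add {ι : Type*} (s : Finset ι) (c : ι → ℂ) (B : ι → VertexOperator ℂ W₂)
    (r : ℂ) : rightField W₁ (∑ i ∈ s, c i • B i + r • idField W₂)
      = ∑ i ∈ s, c i • rightField W₁ (B i) + r • idField (W₁ ⊗[ℂ] W₂) := by
  refine tensorField_ext fun n x y => ?_
  rw [← rightField_id]
  simp only [rightField_mode_tmul, mode_add, mode_sum, mode_smul, TensorProduct.tmul_add,
    TensorProduct.tmul_sum, TensorProduct.tmul_smul]

theorem leftField_smul_id (r : ℂ) :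
    leftField W₂ (r • idField W₁) = r • idField (W₁ ⊗[ℂ] W₂) := by
  simpa using leftField_sum_add (W₂ := W₂) (∅ : Finset ℕ) 0 (fun _ => idField W₁) r

theorem rightField_smul_id (r : ℂ) :
    rightField W₁ (r • idField W₂) = r • idField (W₁ ⊗[ℂ] W₂) := by
  simpa using rightField_sum_add (W₁ := W₁) (∅ : Finset ℕ) 0 (fun _ => idField W₂) r

theorem leftField_zero : leftField W₂ (0 : VertexOperator ℂ W₁) = 0 := by
  simpa using leftField_smul_id (W₁ := W₁) (W₂ := W₂) 0

theorem rightField_zero : rightField W₁ (0 : VertexOperator ℂ W₂) = 0 := by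
  simpa using rightField_smul_id (W₁ := W₁) (W₂ := W₂) 0

theorem LinearOPE.Realizes.leftField {X : G → VertexOperator ℂ W₁} (h : D.Realizes X) :
    D.Realizes fun x => leftField W₂ (X x) := fun x y =>
  (h x y).leftField.congr (leftField_sum_add _ _ _ _) (leftField_smul_id _) leftField_zero

theorem LinearOPE.Realizes.rightField {X : G → VertexOperator ℂ W₂} (h : D.Realizes X) :
    D.Realizes fun x => rightField W₁ (X x) := fun x y =>
  (h x y).rightField.congr (rightField_sum_add _ _ _ _) (rightField_smul_id _) rightField_zero

/-- The vacuum of the right factor becomes the subspace `W₁ ⊗ v`; this is why `IsVacuum` allows a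
whole vacuum subspace. -/
theorem LinearOPE.IsVacuum.rightField {Z : G → VertexOperator ℂ W₂} {v : W₂}
    (h : D.IsVacuum Z (Submodule.span ℂ {v})) :
    D.IsVacuum (fun z => rightField W₁ (Z z))
      (LinearMap.range ((TensorProduct.mk ℂ W₁ W₂).flip v)) where
  realizes := h.realizes.rightField
  annihilates := by
    rintro x n hn _ ⟨w, rfl⟩
    rw [LinearMap.flip_apply, TensorProduct.mk_apply, rightField_mode_tmul,
      h.annihilates x n hn v (Submodule.mem_span_singleton_self v), TensorProduct.tmul_zero]
  generates S hS hgen := by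
    have h1 : ∀ x : W₁, S.comap (TensorProduct.mk ℂ W₁ W₂ x) = ⊤ := by
      intro x
      refine h.generates _ ?_ fun z n y hy => ?_
      · rw [Submodule.span_singleton_le_iff_mem]
        exact hS ⟨x, rfl⟩
      · have := hgen z n _ hy
        rwa [TensorProduct.mk_apply, rightField_mode_tmul] at this
    rw [eq_top_iff, ← TensorProduct.span_tmul_eq_top, Submodule.span_le]
    rintro _ ⟨x, y, rfl⟩
    exact (h1 x).ge (Submodule.mem_top (x := y))

end TensorRealization

/-! ### The `gl(1|1)`-action on `𝒩 ⊗ F` -/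

section Fock

universe u

variable {W : Type u} [AddCommGroup W] [Module ℂ W] {YW : M →ₗ[ℂ] VertexOperator ℂ W}

/-- The Weyl fields on `W ⊗ F`. -/
def fockWeyl (YW : M →ₗ[ℂ] VertexOperator ℂ W) (x : WeylGen) : VertexOperator ℂ (W ⊗[ℂ] F) :=
  leftField F (YW (weylOPE.state [(x, -1)]))

/-- The Clifford fields on `W ⊗ F`. -/
def fockClifford (W : Type u) [AddCommGroup W] [Module ℂ W] (z : CliffordGen) :
    VertexOperator ℂ (W ⊗[ℂ] F) :=
  rightField W (cliffordOPE.genField z)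

/-- The fields of `gl(1|1)` on `W ⊗ F`. -/
def fockGl (YW : M →ₗ[ℂ] VertexOperator ℂ W) : GlGen → VertexOperator ℂ (W ⊗[ℂ] F) :=
  glField (fockWeyl YW) (fockClifford W)

theorem fockWeyl_realizes (h : IsModule weyl YW) : weylOPE.Realizes (fockWeyl YW) :=
  (LinearOPE.realizes_of_isModule weyl_Y_state h).leftField

theorem fockClifford_isVacuum : cliffordOPE.IsVacuum (fockClifford W)
    (LinearMap.range ((TensorProduct.mk ℂ W F).flip cliffordOPE.vac)) :=
  cliffordOPE.genField_isVacuum.rightField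

theorem fockClifford_realizes : cliffordOPE.Realizes (fockClifford W) :=
  fockClifford_isVacuum.realizes

theorem fock_ope (x : WeylGen) (z : CliffordGen) :
    OPE 1 (fockWeyl YW x) (fockClifford W z) 0 0 0 :=
  leftField_rightField _ _

theorem fockGl_realizes (h : IsModule weyl YW) : glOPE.Realizes (fockGl YW) :=
  glField_realizes (fockWeyl_realizes h) fockClifford_realizes fock_ope

theorem fockY_tmul (a : M) (b : F) : fockY YW (a ⊗ₜ b) = tensorField (YW a) (clifford.Y b) := rfl

theorem fockY_vac_tmul_gamma (h : IsModule weyl YW) :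
    fockY YW (weyl.vac ⊗ₜ gammaVec) = gammaField (fockClifford W) := by
  have h1 : clifford.Y gammaVec = gammaField cliffordOPE.genField := by
    refine (clifford_Y_state _).trans ?_
    have hp : ∀ z, cliffordOPE.parity z = 1 := fun _ => rfl
    simp [LinearOPE.fieldWord, LinearOPE.wordParity, nthProd_neg_one_id, gammaField, hp]
  rw [fockY_tmul, h.1, h1]
  exact rightField_nthProd _ _ _ _

theorem weyl_Y_betaVec (h : IsModule weyl YW) :
    YW betaVec = betaField fun x => YW (weylOPE.state [(x, -1)]) := by
  refine (LinearOPE.fieldWord_of_isModule weyl_Y_state h _).trans ?_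
  have hp : ∀ x, weylOPE.parity x = 0 := fun _ => rfl
  simp [LinearOPE.fieldWord, LinearOPE.wordParity, nthProd_neg_one_id, betaField, hp]

theorem fockY_beta_tmul_vac (h : IsModule weyl YW) :
    fockY YW (betaVec ⊗ₜ clifford.vac) = betaField (fockWeyl YW) := by
  have h1 : clifford.Y clifford.vac = idField F := clifford_Y_state []
  rw [fockY_tmul, h1, weyl_Y_betaVec h]
  exact leftField_nthProd _ _ _ _

theorem fockY_gen_tmul_gen (x : WeylGen) (z : CliffordGen) :
    fockY YW (weylOPE.state [(x, -1)] ⊗ₜ cliffordOPE.state [(z, -1)])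
      = nthProd 1 (fockWeyl YW x) (-1) (fockClifford W z) := by
  have h1 : clifford.Y (cliffordOPE.state [(z, -1)]) = cliffordOPE.genField z :=
    LinearOPE.vertex_Y_gen clifford_Y_state z
  rw [fockY_tmul, h1, tensorField_eq]
  rfl

theorem fockY_glInMF (h : IsModule weyl YW) (x : GlGen) : fockY YW (glInMF x) = fockGl YW x := by
  cases x
  · rw [glInMF, map_add, fockY_vac_tmul_gamma h, fockY_beta_tmul_vac h]
    rfl
  · rw [glInMF, LinearMap.map_smul, map_sub, fockY_vac_tmul_gamma h, fockY_beta_tmul_vac h,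
      sub_eq_add_neg, ← neg_one_smul_field]
    rfl
  · exact fockY_gen_tmul_gen .a .psi
  · exact fockY_gen_tmul_gen .aStar .psiStar

theorem opE0_eq (h : IsModule weyl YW) : opE0 YW = (fockGl YW .E)[[0]] := by
  rw [opE0, fockY_glInMF h]

/-- The Weyl and Clifford fields act irreducibly on `W ⊗ F` if `W` is irreducible. -/
theorem fock_eq_top (h : IsModule weyl YW) (hirr : IsIrreducible YW)
    {S : Submodule ℂ (W ⊗[ℂ] F)} (hX : ∀ x n, ∀ w ∈ S, ((fockWeyl YW x)[[n]]) w ∈ S)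
    (hZ : ∀ z n, ∀ w ∈ S, ((fockClifford W z)[[n]]) w ∈ S) (hS : S ≠ ⊥) : S = ⊤ := by
  -- Clifford modes alone bring a nonzero vector of `S` into `W ⊗ vac`. The vectors `w` with `w ⊗
  -- vac ∈ S` then form a nonzero submodule of `W`, hence all of `W`.
  obtain ⟨_, hv, ⟨w, rfl⟩, hw⟩ := clifford_inf_ne_bot fockClifford_isVacuum hZ hS
  have h1 : IsStable YW (S.comap ((TensorProduct.mk ℂ W F).flip cliffordOPE.vac)) := by
    refine LinearOPE.isStable_of_gen weyl_Y_state h fun x n w hw => ?_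
    have := hX x n _ hw
    rwa [LinearMap.flip_apply, TensorProduct.mk_apply, fockWeyl, leftField_mode_tmul] at this
  rcases hirr.2.2 _ h1 le_top with h2 | h2
  · refine absurd ?_ hw
    have h3 := (Submodule.eq_bot_iff _).1 h2 w hv
    rw [h3, map_zero]
  · refine fockClifford_isVacuum.generates S ?_ hZ
    rintro _ ⟨x, rfl⟩
    exact h2.ge (Submodule.mem_top (x := x))

theorem fock_nontrivial (hirr : IsIrreducible YW) : Nontrivial (W ⊗[ℂ] F) := by
  have h1 : Nontrivial W := by
    obtain ⟨x, _, hx⟩ := Submodule.exists_mem_ne_zero_of_ne_bot hirr.2.1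
    exact ⟨x, 0, hx⟩
  have h2 : Nontrivial F := ⟨_, _, clifford_vac_ne_zero⟩
  infer_instance

/-- On `W ⊗ vac` the mode `γ_(0)` vanishes and `E(0)` acts as `β(0)`; the Clifford modes, which
generate the rest, shift the charge by `±1`. -/
theorem fock_iSup_eigenspace (h : IsModule weyl YW) {Δ : ℂ}
    (hΔ : ⨆ s : ℤ, Module.End.eigenspace ((YW betaVec)[[0]]) ((s : ℂ) + Δ) = ⊤) :
    ⨆ s : ℤ, Module.End.eigenspace ((fockGl YW .E)[[0]]) ((s : ℂ) + Δ) = ⊤ := by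
  have hX := fockWeyl_realizes h
  refine fockClifford_isVacuum.generates _ ?_ fun z n => ?_
  · rintro _ ⟨x, rfl⟩
    suffices hle : ⊤ ≤ (⨆ s : ℤ, Module.End.eigenspace ((fockGl YW .E)[[0]]) ((s : ℂ) + Δ)).comap
        ((TensorProduct.mk ℂ W F).flip cliffordOPE.vac) from hle (Submodule.mem_top (x := x))
    rw [← hΔ]
    refine iSup_le fun s x hx => Submodule.mem_iSup_of_mem s ?_
    rw [Module.End.mem_eigenspace_iff] at hx ⊢
    have h1 : ((gammaField (fockClifford W))[[0]]) (x ⊗ₜ cliffordOPE.vac) = 0 :=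
      nthProd_neg_one_annihilates
        (fun n hn => fockClifford_isVacuum.annihilates .psi n hn _ ⟨x, rfl⟩)
        (fun n hn => fockClifford_isVacuum.annihilates .psiStar n hn _ ⟨x, rfl⟩) le_rfl
    have h2 : betaField (fockWeyl YW) = leftField F (YW betaVec) := by
      rw [weyl_Y_betaVec h]
      exact (leftField_nthProd _ _ _ _).symm
    rw [LinearMap.flip_apply, TensorProduct.mk_apply, fockGl, glField, mode_add, h1, zero_add, h2,
      leftField_mode_tmul, hx, TensorProduct.smul_tmul']
  · suffices hle : (⨆ s : ℤ, Module.End.eigenspace ((fockGl YW .E)[[0]]) ((s : ℂ) + Δ))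
        ≤ (⨆ s : ℤ, Module.End.eigenspace ((fockGl YW .E)[[0]]) ((s : ℂ) + Δ)).comap
          ((fockClifford W z)[[n]]) from fun w hw => hle hw
    refine iSup_le fun s w hw => ?_
    rw [Module.End.mem_eigenspace_iff] at hw
    cases z
    · refine Submodule.mem_iSup_of_mem (s + 1) ?_
      have h1 := charge_raising hX fockClifford_realizes fock_ope (.inr n) w
      rw [Module.End.mem_eigenspace_iff]
      refine h1.trans ?_
      rw [show ((glField (fockWeyl YW) (fockClifford W) .E)[[0]]) w = _ from hw, map_smul,
        ← add_smul]
      push_cast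
      rw [add_right_comm]
      rfl
    · refine Submodule.mem_iSup_of_mem (s - 1) ?_
      have h1 := charge_lowering hX fockClifford_realizes fock_ope (.inr n) w
      rw [Module.End.mem_eigenspace_iff]
      refine h1.trans ?_
      rw [show ((glField (fockWeyl YW) (fockClifford W) .E)[[0]]) w = _ from hw, map_smul,
        ← add_smul]
      push_cast
      rw [add_right_comm, ← sub_eq_add_neg]
      rfl

/-- A field map with the prescribed generating fields makes the charge spaces irreducible. -/
theorem charge_space_isIrreducibleSub (h : IsModule weyl YW) (hirr : IsIrreducible YW)
    {YV : V1gl →ₗ[ℂ] VertexOperator ℂ (W ⊗[ℂ] F)} (hYV : IsModule affineGl YV)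
    (hgen : ∀ x, YV (glVec x) = fockGl YW x) {μ : ℂ}
    (hμ : Module.End.eigenspace ((fockGl YW .E)[[0]]) μ ≠ ⊥) :
    IsIrreducibleSub YV (Module.End.eigenspace ((fockGl YW .E)[[0]]) μ) := by
  have hX := fockWeyl_realizes h
  have hgen' : ∀ x, YV (glOPE.state [(x, -1)]) = fockGl YW x := hgen
  refine ⟨LinearOPE.isStable_of_gen gl_Y_state hYV fun x n w hw => ?_, hμ, fun T hT hle => ?_⟩
  · rw [hgen', Module.End.mem_eigenspace_iff] at *
    rw [fockGl, charge_glField hX fockClifford_realizes fock_ope, ← map_smul, ← hw]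
    rfl
  · rw [or_iff_not_imp_left]
    intro hne
    refine eq_charge_space hX fockClifford_realizes fock_ope (fun x n w hw => ?_)
      (fun S hXS hZS => fock_eq_top h hirr hXS hZS) hne hle
    have := hT (glVec x) n w hw
    rwa [hgen] at this

theorem exists_fock_module (h : IsModule weyl YW) :
    ∃ YV : V1gl →ₗ[ℂ] VertexOperator ℂ (W ⊗[ℂ] F),
      IsModule affineGl YV ∧ ∀ x, YV (glVec x) = fockGl YW x := by
  obtain ⟨YV, hYV⟩ := glOPE.exists_stateField glOPE_isHomogeneous gl_maxIdeal (fockGl_realizes h)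
  refine ⟨YV, LinearOPE.isModule_of_fieldWord (fockGl_realizes h) gl_Y_state hYV, fun x => ?_⟩
  refine (hYV _).trans ?_
  simp [LinearOPE.fieldWord, LinearOPE.wordParity, nthProd_neg_one_id]

end Fock

end VertexTheory

end

theorem mainTheorem4 {𝒩 : Type*} [AddCommGroup 𝒩] [Module ℂ 𝒩]
    (Y𝒩 : VertexTheory.M →ₗ[ℂ] VertexOperator ℂ 𝒩)
    (hmod : VertexTheory.IsModule VertexTheory.weyl Y𝒩)
    (hirr : VertexTheory.IsIrreducible Y𝒩)
    (hwt : VertexTheory.IsWeight Y𝒩)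
    (Δ : ℂ)
    (hΔ : ⨆ s : ℤ, Module.End.eigenspace ((Y𝒩 VertexTheory.betaVec)[[0]]) ((s : ℂ) + Δ) = ⊤) :
    ∃ YV : VertexTheory.V1gl →ₗ[ℂ] VertexOperator ℂ (𝒩 ⊗[ℂ] VertexTheory.F),
      (VertexTheory.IsModule VertexTheory.affineGl YV ∧
        ∀ x, YV (VertexTheory.glVec x) = VertexTheory.fockY Y𝒩 (VertexTheory.glInMF x)) ∧
      (∀ Y' : VertexTheory.V1gl →ₗ[ℂ] VertexOperator ℂ (𝒩 ⊗[ℂ] VertexTheory.F),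
        VertexTheory.IsModule VertexTheory.affineGl Y' →
        (∀ x, Y' (VertexTheory.glVec x) = VertexTheory.fockY Y𝒩 (VertexTheory.glInMF x)) →
        Y' = YV) ∧
      VertexTheory.IsCompletelyReducible YV ∧
      DirectSum.IsInternal
        (fun s : ℤ => Module.End.eigenspace (VertexTheory.opE0 Y𝒩) ((s : ℂ) + Δ)) ∧
      ∀ s : ℤ, VertexTheory.IsIrreducibleSub YV
        (Module.End.eigenspace (VertexTheory.opE0 Y𝒩) ((s : ℂ) + Δ)) := by
  have hE := VertexTheory.opE0_eq hmod
  have htop := VertexTheory.fock_iSup_eigenspace hmod hΔ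
  obtain ⟨YV, hYV, hgen⟩ := VertexTheory.exists_fock_module hmod
  have := VertexTheory.fock_nontrivial hirr
  have hsub : ∀ s : ℤ, VertexTheory.IsIrreducibleSub YV
      (Module.End.eigenspace (VertexTheory.opE0 Y𝒩) ((s : ℂ) + Δ)) := fun s => by
    rw [hE]
    exact VertexTheory.charge_space_isIrreducibleSub hmod hirr hYV hgen
      (VertexTheory.charge_space_ne_bot (VertexTheory.fockWeyl_realizes hmod)
        VertexTheory.fockClifford_realizes VertexTheory.fock_ope htop s)
  -- Distinct integers `s` give distinct eigenvalues `s + Δ`, so independence of eigenspaces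
  -- restricts to this family.
  have hind : iSupIndep fun s : ℤ =>
      Module.End.eigenspace (VertexTheory.opE0 Y𝒩) ((s : ℂ) + Δ) :=
    (Module.End.eigenspaces_iSupIndep (VertexTheory.opE0 Y𝒩)).comp
      fun s t h => Int.cast_injective (add_right_cancel h)
  rw [← hE] at htop
  refine ⟨YV, ⟨hYV, fun x => by rw [hgen, VertexTheory.fockY_glInMF hmod]⟩, fun Y' hY' hgen' => ?_,
    ⟨Set.range fun s : ℤ => Module.End.eigenspace (VertexTheory.opE0 Y𝒩) ((s : ℂ) + Δ), ?_,
      hind.sSupIndep_range, by rw [sSup_range, htop]⟩,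
    (DirectSum.isInternal_submodule_iff_iSupIndep_and_iSup_eq_top _).2 ⟨hind, htop⟩, hsub⟩
  · refine VertexTheory.LinearOPE.isModule_unique VertexTheory.gl_Y_state hY' hYV fun x => ?_
    exact (hgen' x).trans ((VertexTheory.fockY_glInMF hmod x).trans (hgen x).symm)
  · rintro _ ⟨s, rfl⟩
    exact hsub s
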